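/- Fix an integer $n\ge 1$ and put $\alpha=\pi/(2n+1)$. Let $V$ be the space of affine linear functions $f(x)=\langle a,x\rangle+b$ on the Euclidean plane $\mathbb{E}^2$, with the symmetric bilinear form $(f,g)=\langle a,c\rangle$ if $f(x)=\langle a,x\rangle+b$ and $g(x)=\langle c,x\rangle+e$. A seed $(\mathbf v,B)$ consists of a real skew-symmetric $3\times3$ matrix $B=(b_{ij})$, with quiver given by arrows $i\to j$ for $b_{ij}>0$, and an ordered basis $\mathbf v=(v_1,v_2,v_3)$ of $V$ such that $(v_i,v_i)=2$, $|(v_i,v_j)|=|b_{ij}|$ for $i\ne j$ and, if $(v_i,v_j)\neq0$ for all $i<j$, the number of pairs $i<j$ with $(v_i,v_j)>0$ is even if $B$ is acyclic and odd otherwise. The seed describes the region of the plane in which $v_1,v_2,v_3$ are all negative. Seeds which differ by a simultaneous reordering of the indices are identified, and for $w\in\mathbb{E}^2$ the seed $w+(\mathbf v,B)$ is obtained by translating all $v_i$ by $w$ and keeping $B$. Given a notion of positive vectors, the mutation of $(\mathbf v,B)$ at $k$ is $(\mathbf v',B')$, where $b'_{ij}=-b_{ij}$ if $k\in\{i,j\}$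 and $b'_{ij}=b_{ij}+(b_{ik}|b_{kj}|+|b_{ik}|b_{kj})/2$ otherwise; $v'_k=-v_k$; and, for $i\ne k$, $v_i'=v_i-(v_i,v_k)v_k$ if either $v_k$ is positive and $b_{ik}<0$, or $v_k$ is not positive and $b_{ik}>0$, and $v_i'=v_i$ in all other cases. The vertices of the exchange graph of a seed are the seeds obtained from it by finite sequences of mutations. Let $\Delta_0\subseteq\mathbb{E}^2$ be a triangle with angles $\alpha,n\alpha,n\alpha$, and let $d_1$ be the length of its two legs (its longer sides). Let $(\mathbf v_0,B_0)$ be the initial seed given by $\Delta_0$, each $v_i$ vanishing on one side and being negative on the interior, together with the acyclic quiver in which the base is the source, one leg is the sink, and there is an arrow from the other leg to the sink. Let $b$ be the line through the feet of the two altitudes of $\Delta_0$ on the source and on the sink. A vector $f\in V$ is called positive if the points of $b$ sufficiently far in the direction from the foot on the source to the foot on the sink all satisfy $f<0$ (the reference point lies infinitely far away on $b$ in this direction). Let $$R=\Big\langle\, d_1\frac{\sin(\alpha)\sin(n\alpha)}{\sin^2(k\alpha)} \;\Big|\; 1\le k\le n,\ \gcd(k,2n+1)=1\,\Big\rangle_{\mathbb{Z}}\subseteq\mathbb{R},$$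 and let $L\subseteq\mathbb{R}$ be the $\mathbb{Z}$-module spanned by the Euclidean lengths of all vectors $w\in\mathbb{E}^2$ such that the exchange graph of $(\mathbf v_0,B_0)$ contains two seeds $(\mathbf v_1,B_1)$ and $(\mathbf v_2,B_2)$ with $(\mathbf v_1,B_1)=w+(\mathbf v_2,B_2)$. 1. There exists an integer $d\geq 1$ such that $$R\subseteq L\subseteq \tfrac1d\mathbb{Z}[2\cos\alpha]\,d_1\qquad\text{and}\qquad R\subseteq\mathbb{Z}[2\cos\alpha]\,d_1\subseteq\tfrac1d\mathbb{Z}[2\cos\alpha]\,d_1 .$$ 2. The lattices $R$, $L$, $\mathbb{Z}[2\cos\alpha]\,d_1$ (and $\tfrac1d\mathbb{Z}[2\cos\alpha]\,d_1$) all have rank $\varphi(2n+1)/2$ over $\mathbb{Z}$, where $\varphi$ is Euler's totient function. -/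

import Mathlib

open Filter Topology

noncomputable section

namespace RealQuiver

/-- The Euclidean plane. -/
abbrev Plane : Type := EuclideanSpace ℝ (Fin 2)

/-- The three-dimensional space `V` of affine linear functions on the plane: the pair `(a, b)` is
the function `x ↦ ⟪a, x⟫ + b`. -/
abbrev AffFun : Type := Plane × ℝ

/-- The value of the affine linear function `f` at the point `x`. -/
def AffFun.eval (f : AffFun) (x : Plane) : ℝ := inner ℝ f.1 x + f.2

/-- The (degenerate) symmetric bilinear form on `V`: the inner product of the linear parts. -/
def form (f g : AffFun) : ℝ := inner ℝ f.1 g.1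

/-- The affine linear function translated by `w`: its value at `w + x` is the value of `f`
at `x`. -/
def AffFun.translate (w : Plane) (f : AffFun) : AffFun := (f.1, f.2 - inner ℝ f.1 w)

/-- The quiver of a skew-symmetric `3 × 3` matrix has an arrow `i → j` when `0 < B i j`. On three
vertices, without loops and `2`-cycles, an oriented cycle is an oriented triangle. -/
def IsAcyclic (B : Matrix (Fin 3) (Fin 3) ℝ) : Prop :=
  ¬ ∃ i j k, 0 < B i j ∧ 0 < B j k ∧ 0 < B k i

open Classical in
/-- An ordered basis `v` of `V` (three linearly independent vectors in a space of dimension three)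
is a geometric realisation of the skew-symmetric matrix `B`. -/
structure IsGeometricRealisation (v : Fin 3 → AffFun) (B : Matrix (Fin 3) (Fin 3) ℝ) : Prop where
  linearIndependent : LinearIndependent ℝ v
  form_self : ∀ i, form (v i) (v i) = 2
  abs_form : ∀ i j, i ≠ j → |form (v i) (v j)| = |B i j|
  parity : (∀ i j, i < j → form (v i) (v j) ≠ 0) →
    (Even (Finset.univ.filter
      (fun p : Fin 3 × Fin 3 => p.1 < p.2 ∧ 0 < form (v p.1) (v p.2))).card ↔ IsAcyclic B)

/-- A seed: a skew-symmetric real matrix together with a geometric realisation. -/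
@[ext]
structure Seed where
  v : Fin 3 → AffFun
  B : Matrix (Fin 3) (Fin 3) ℝ
  skew : B.transpose = -B
  realisation : IsGeometricRealisation v B

/-- Matrix mutation at `k`. -/
def mutateMatrix (B : Matrix (Fin 3) (Fin 3) ℝ) (k : Fin 3) : Matrix (Fin 3) (Fin 3) ℝ :=
  Matrix.of fun i j => if i = k ∨ j = k then -B i j
    else B i j + (B i k * |B k j| + |B i k| * B k j) / 2

open Classical in
/-- Mutation of the vectors at `k`, with respect to a set `Pos` of positive vectors. (If
`B i k = 0`, then `v i` is orthogonal to `v k` and is left unchanged.) -/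
def mutateVectors (Pos : AffFun → Prop) (v : Fin 3 → AffFun) (B : Matrix (Fin 3) (Fin 3) ℝ)
    (k : Fin 3) : Fin 3 → AffFun :=
  fun i => if i = k then -v i
    else if (Pos (v k) ∧ B i k < 0) ∨ (¬ Pos (v k) ∧ 0 < B i k) then
      v i - form (v i) (v k) • v k
    else v i

theorem mutateMatrix_skew {B : Matrix (Fin 3) (Fin 3) ℝ} (hB : B.transpose = -B) (k : Fin 3) :
    (mutateMatrix B k).transpose = -mutateMatrix B k := by
  have h : ∀ i j, B j i = -B i j := fun i j => congrFun (congrFun hB i) j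
  ext i j
  simp only [Matrix.transpose_apply, Matrix.neg_apply, mutateMatrix, Matrix.of_apply]
  by_cases hi : i = k
  · simp only [hi, or_true, true_or, if_true, h k j]
  · by_cases hj : j = k
    · simp only [hj, or_true, true_or, if_true, h i k]
    · simp only [hi, hj, or_self, if_false]
      rw [h i j, h k j, h i k, abs_neg, abs_neg]
      ring

/-- The oriented-triangle condition for three given arrows. -/
def Cyc (x y z : ℝ) : Prop := (0 < x ∧ 0 < y ∧ 0 < z) ∨ (x < 0 ∧ y < 0 ∧ z < 0)

theorem isAcyclic_iff {B : Matrix (Fin 3) (Fin 3) ℝ} (hB : B.transpose = -B) :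
    IsAcyclic B ↔ ¬ Cyc (B 0 1) (B 1 2) (B 2 0) := by
  have h : ∀ i j, B j i = -B i j := fun i j => congrFun (congrFun hB i) j
  have h00 : B 0 0 = 0 := by linarith [h 0 0]
  have h11 : B 1 1 = 0 := by linarith [h 1 1]
  have h22 : B 2 2 = 0 := by linarith [h 2 2]
  have h01 := h 0 1
  have h12 := h 1 2
  have h20 := h 2 0
  unfold IsAcyclic Cyc
  rw [not_iff_not]
  constructor
  · rintro ⟨i, j, k, h1, h2, h3⟩
    fin_cases i <;> fin_cases j <;> fin_cases k <;> simp only [Fin.zero_eta, Fin.mk_one,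
      Fin.reduceFinMk] at h1 h2 h3 <;>
    first
      | (exfalso; linarith)
      | (left; refine ⟨?_, ?_, ?_⟩ <;> linarith)
      | (right; refine ⟨?_, ?_, ?_⟩ <;> linarith)
  · rintro (⟨h1, h2, h3⟩ | ⟨h1, h2, h3⟩)
    · exact ⟨0, 1, 2, h1, h2, h3⟩
    · exact ⟨0, 2, 1, by linarith, by linarith, by linarith⟩

theorem core_same {a b c A P Q ci cj : ℝ} (ha : |a| = |A|)
    (hpar : a * b * c ≠ 0 → (a * b * c < 0 ↔ ¬ Cyc A Q (-P)))
    (hPQ : 0 < P * Q) (hc : (ci = b ∧ cj = c) ∨ (ci = 0 ∧ cj = 0)) :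
    |a - cj * b - ci * c + 2 * ci * cj| = |A + (P * |Q| - |P| * Q) / 2| ∧
    ((a - cj * b - ci * c + 2 * ci * cj) * (2 * ci - b) * (2 * cj - c) ≠ 0 →
     ((a - cj * b - ci * c + 2 * ci * cj) * (2 * ci - b) * (2 * cj - c) < 0 ↔
       ¬ Cyc (A + (P * |Q| - |P| * Q) / 2) (-Q) P)) := by
  have e1 : P * |Q| - |P| * Q = 0 := by
    rcases pos_and_pos_or_neg_and_neg_of_mul_pos hPQ with ⟨h, h'⟩ | ⟨h, h'⟩
    · rw [abs_of_pos h, abs_of_pos h']; ring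
    · rw [abs_of_neg h, abs_of_neg h']; ring
  have n1 : ∀ x : ℝ, ¬ Cyc x Q (-P) := by
    rintro x (⟨-, h, h'⟩ | ⟨-, h, h'⟩) <;> nlinarith
  have n2 : ∀ x : ℝ, ¬ Cyc x (-Q) P := by
    rintro x (⟨-, h, h'⟩ | ⟨-, h, h'⟩) <;> nlinarith
  have e2 : (a - cj * b - ci * c + 2 * ci * cj) = a := by
    rcases hc with ⟨h, h'⟩ | ⟨h, h'⟩ <;> rw [h, h'] <;> ring
  have e3 : a * (2 * ci - b) * (2 * cj - c) = a * b * c := by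
    rcases hc with ⟨h, h'⟩ | ⟨h, h'⟩ <;> rw [h, h'] <;> ring
  rw [e1, e2, e3]
  refine ⟨by simpa using ha, fun h => ?_⟩
  have := (hpar h).2 (n1 _)
  exact ⟨fun _ => n2 _, fun _ => this⟩

theorem core_diff {a b c A P Q ci cj : ℝ} (ha : |a| = |A|) (hb : |b| = |P|) (hc : |c| = |Q|)
    (hpar : a * b * c ≠ 0 → (a * b * c < 0 ↔ ¬ Cyc A Q (-P)))
    (hPQ : P * Q < 0) (hcc : (ci = b ∧ cj = 0) ∨ (ci = 0 ∧ cj = c)) :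
    |a - cj * b - ci * c + 2 * ci * cj| = |A + (P * |Q| - |P| * Q) / 2| ∧
    ((a - cj * b - ci * c + 2 * ci * cj) * (2 * ci - b) * (2 * cj - c) ≠ 0 →
     ((a - cj * b - ci * c + 2 * ci * cj) * (2 * ci - b) * (2 * cj - c) < 0 ↔
       ¬ Cyc (A + (P * |Q| - |P| * Q) / 2) (-Q) P)) := by
  have e2 : (a - cj * b - ci * c + 2 * ci * cj) = a - b * c := by
    rcases hcc with ⟨h, h'⟩ | ⟨h, h'⟩ <;> rw [h, h'] <;> ring
  have e3 : ∀ x : ℝ, x * (2 * ci - b) * (2 * cj - c) = -(x * (b * c)) := by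
    intro x
    rcases hcc with ⟨h, h'⟩ | ⟨h, h'⟩ <;> rw [h, h'] <;> ring
  rw [e2, e3]
  have hP : P ≠ 0 := by rintro rfl; simp at hPQ
  have hQ : Q ≠ 0 := by rintro rfl; simp at hPQ
  have hbc : b * c = P * Q ∨ b * c = -(P * Q) := by
    apply abs_eq_abs.1; rw [abs_mul, abs_mul, hb, hc]
  have hbc0 : b * c ≠ 0 := by
    rcases hbc with h | h <;> rw [h] <;> simp [hP, hQ]
  -- a Gram product and the arrow product have opposite or equal sign according to the orientation
  obtain ⟨s, hs, e1, c1, c2⟩ : ∃ s : ℝ, (s = 1 ∨ s = -1) ∧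
      (P * |Q| - |P| * Q) / 2 = s * (P * Q) ∧ (∀ x : ℝ, Cyc x Q (-P) ↔ 0 < s * x) ∧
      (∀ x : ℝ, Cyc x (-Q) P ↔ s * x < 0) := by
    rcases lt_or_gt_of_ne hP with h | h
    · have h' : 0 < Q := by nlinarith
      refine ⟨1, Or.inl rfl, ?_, fun x => ?_, fun x => ?_⟩
      · rw [abs_of_neg h, abs_of_pos h']; ring
      · unfold Cyc
        constructor
        · rintro (⟨h1, -, -⟩ | ⟨h1, h2, -⟩) <;> linarith
        · intro h1; left; refine ⟨by linarith, h', by linarith⟩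
      · unfold Cyc
        constructor
        · rintro (⟨h1, h2, -⟩ | ⟨h1, h2, -⟩) <;> linarith
        · intro h1; right; refine ⟨by linarith, by linarith, by linarith⟩
    · have h' : Q < 0 := by nlinarith
      refine ⟨-1, Or.inr rfl, ?_, fun x => ?_, fun x => ?_⟩
      · rw [abs_of_pos h, abs_of_neg h']; ring
      · unfold Cyc
        constructor
        · rintro (⟨h1, h2, -⟩ | ⟨h1, h2, -⟩) <;> linarith
        · intro h1; right; refine ⟨by linarith, h', by linarith⟩
      · unfold Cyc
        constructor
        · rintro (⟨h1, h2, -⟩ | ⟨h1, h2, -⟩) <;> linarith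
        · intro h1; left; refine ⟨by linarith, by linarith, by linarith⟩
  rw [e1]
  rw [c1] at hpar
  rw [c2]
  have hs2 : s * s = 1 := by rcases hs with h | h <;> rw [h] <;> norm_num
  have key : a * (b * c) = -(s * A) * (P * Q) := by
    have h1 : |a * (b * c)| = |-(s * A) * (P * Q)| := by
      rw [abs_mul, abs_mul, abs_mul, abs_neg, abs_mul, abs_mul, ha, hb, hc]
      rcases hs with h | h <;> rw [h] <;> simp
    by_cases h0 : a = 0
    · have : A = 0 := by simpa [h0] using ha.symm
      simp [h0, this]
    have h2 := hpar (by rw [mul_assoc]; exact mul_ne_zero h0 hbc0)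
    rw [mul_assoc] at h2
    by_cases h3 : 0 < s * A
    · have h4 : ¬ a * (b * c) < 0 := fun h => (h2.1 h) h3
      have h5 : 0 < -(s * A) * (P * Q) := by nlinarith
      rw [abs_of_nonneg (not_lt.1 h4), abs_of_pos h5] at h1
      exact h1
    · have h4 := h2.2 h3
      have h5 : -(s * A) * (P * Q) ≤ 0 := by nlinarith
      rw [abs_of_neg h4, abs_of_nonpos h5] at h1
      linarith
  have hPQ0 : P * Q ≠ 0 := hPQ.ne
  have rel : ∃ t : ℝ, (t = 1 ∨ t = -1) ∧ b * c = t * (P * Q) ∧ a = -(t * (s * A)) := by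
    rcases hbc with h | h
    · refine ⟨1, Or.inl rfl, by linarith, ?_⟩
      rw [h] at key
      have := mul_right_cancel₀ hPQ0 key
      linarith
    · refine ⟨-1, Or.inr rfl, by linarith, ?_⟩
      rw [h] at key
      have : a = s * A := mul_right_cancel₀ hPQ0 (by linarith)
      linarith
  obtain ⟨t, ht, hbct, hat⟩ := rel
  have hd : a - b * c = -(t * s) * (A + s * (P * Q)) := by
    rw [hbct, hat]
    linear_combination (t * P * Q) * hs2
  have ht2 : t * t = 1 := by rcases ht with h | h <;> rw [h] <;> norm_num
  have hpr : -((a - b * c) * (b * c)) = (s * (A + s * (P * Q))) * (P * Q) := by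
    rw [hd, hbct]
    linear_combination (s * (A + s * (P * Q)) * (P * Q)) * ht2
  constructor
  · rw [hd, abs_mul]
    rcases ht with h | h <;> rcases hs with h' | h' <;> rw [h, h'] <;> simp
  · rw [hpr]
    intro h0
    have h1 : s * (A + s * (P * Q)) ≠ 0 := left_ne_zero_of_mul h0
    constructor
    · intro h2 h3; nlinarith
    · intro h2
      have : 0 < s * (A + s * (P * Q)) := lt_of_le_of_ne (not_lt.1 h2) h1.symm
      nlinarith
theorem core {a b c A P Q ci cj : ℝ} {pos : Prop} (ha : |a| = |A|) (hb : |b| = |P|) (hc : |c| = |Q|)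
    (hpar : a * b * c ≠ 0 → (a * b * c < 0 ↔ ¬ Cyc A Q (-P)))
    (hci : ((pos ∧ P < 0) ∨ (¬pos ∧ 0 < P)) ∧ ci = b ∨
      ¬((pos ∧ P < 0) ∨ (¬pos ∧ 0 < P)) ∧ ci = 0)
    (hcj : ((pos ∧ Q < 0) ∨ (¬pos ∧ 0 < Q)) ∧ cj = c ∨
      ¬((pos ∧ Q < 0) ∨ (¬pos ∧ 0 < Q)) ∧ cj = 0) :
    |a - cj * b - ci * c + 2 * ci * cj| = |A + (P * |Q| - |P| * Q) / 2| ∧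
    |2 * ci - b| = |P| ∧ |2 * cj - c| = |Q| ∧
    ((a - cj * b - ci * c + 2 * ci * cj) * (2 * ci - b) * (2 * cj - c) ≠ 0 →
     ((a - cj * b - ci * c + 2 * ci * cj) * (2 * ci - b) * (2 * cj - c) < 0 ↔
       ¬ Cyc (A + (P * |Q| - |P| * Q) / 2) (-Q) P)) := by
  have hci' : ci = b ∨ ci = 0 := by tauto
  have hcj' : cj = c ∨ cj = 0 := by tauto
  have h2 : |2 * ci - b| = |P| := by
    rcases hci' with h | h <;> rw [h, ← hb]
    · congr 1; ring
    · rw [← abs_neg b]; congr 1; ring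
  have h3 : |2 * cj - c| = |Q| := by
    rcases hcj' with h | h <;> rw [h, ← hc]
    · congr 1; ring
    · rw [← abs_neg c]; congr 1; ring
  by_cases hP : P = 0
  · have hb0 : b = 0 := by simpa [hP] using hb
    have hci0 : ci = 0 := by rcases hci' with h | h <;> simp [h, hb0]
    refine ⟨?_, h2, h3, ?_⟩
    · simp [hP, hb0, hci0, ha]
    · intro h; simp [hb0, hci0] at h
  by_cases hQ : Q = 0
  · have hb0 : c = 0 := by simpa [hQ] using hc
    have hci0 : cj = 0 := by rcases hcj' with h | h <;> simp [h, hb0]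
    refine ⟨?_, h2, h3, ?_⟩
    · simp [hQ, hb0, hci0, ha]
    · intro h; simp [hb0, hci0] at h
  have main : 0 < P * Q ∧ ((ci = b ∧ cj = c) ∨ (ci = 0 ∧ cj = 0)) ∨
      P * Q < 0 ∧ ((ci = b ∧ cj = 0) ∨ (ci = 0 ∧ cj = c)) := by
    by_cases hpos : pos <;>
    rcases lt_or_gt_of_ne hP with hP | hP <;> rcases lt_or_gt_of_ne hQ with hQ | hQ <;>
    simp only [hpos, hP, hQ, hP.le.not_gt, hQ.le.not_gt, true_and, false_and, and_false, not_true,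
      not_false_iff, or_false, false_or, or_true] at hci hcj
    · exact Or.inl ⟨by nlinarith, by tauto⟩
    · exact Or.inr ⟨by nlinarith, by tauto⟩
    · exact Or.inr ⟨by nlinarith, by tauto⟩
    · exact Or.inl ⟨by nlinarith, by tauto⟩
    · exact Or.inl ⟨by nlinarith, by tauto⟩
    · exact Or.inr ⟨by nlinarith, by tauto⟩
    · exact Or.inr ⟨by nlinarith, by tauto⟩
    · exact Or.inl ⟨by nlinarith, by tauto⟩
  rcases main with ⟨h, h'⟩ | ⟨h, h'⟩
  · obtain ⟨h4, h5⟩ := core_same ha hpar h h'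
    exact ⟨h4, h2, h3, h5⟩
  · obtain ⟨h4, h5⟩ := core_diff ha hb hc hpar h h'
    exact ⟨h4, h2, h3, h5⟩

open Classical in
theorem even_card_iff {g : Fin 3 → Fin 3 → ℝ} (h01 : g 0 1 ≠ 0) (h02 : g 0 2 ≠ 0)
    (h12 : g 1 2 ≠ 0) :
    Even (Finset.univ.filter
      (fun p : Fin 3 × Fin 3 => p.1 < p.2 ∧ 0 < g p.1 p.2)).card ↔ g 0 1 * g 0 2 * g 1 2 < 0 := by
  have hc : (Finset.univ.filter (fun p : Fin 3 × Fin 3 => p.1 < p.2 ∧ 0 < g p.1 p.2)).card =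
      (if 0 < g 0 1 then 1 else 0) + (if 0 < g 0 2 then 1 else 0) +
        (if 0 < g 1 2 then 1 else 0) := by
    rw [Finset.card_filter, Fintype.sum_prod_type]
    simp only [Fin.sum_univ_three]
    simp
  rw [hc]
  rcases lt_or_gt_of_ne h01 with a | a <;> rcases lt_or_gt_of_ne h02 with b | b <;>
    rcases lt_or_gt_of_ne h12 with c | c <;>
    simp [a, b, c, a.le.not_gt, b.le.not_gt, c.le.not_gt, mul_neg_iff, mul_pos_iff, Nat.even_iff]

theorem form_comm (f g : AffFun) : form f g = form g f := real_inner_comm _ _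

theorem form_sub_smul (f g e : AffFun) (c d : ℝ) :
    form (f - c • e) (g - d • e) =
      form f g - d * form f e - c * form g e + c * d * form e e := by
  simp only [form, Prod.fst_sub, Prod.smul_fst, inner_sub_left, inner_sub_right, inner_smul_left,
    inner_smul_right, real_inner_comm g.1 e.1, RCLike.conj_to_real]
  ring

/-- Mutation of the vectors, written uniformly. -/
theorem mutateVectors_eq (Pos : AffFun → Prop) {v : Fin 3 → AffFun}
    {B : Matrix (Fin 3) (Fin 3) ℝ} (k : Fin 3) :
    ∃ c : Fin 3 → ℝ, c k = 2 ∧ (∀ i, mutateVectors Pos v B k i = v i - c i • v k) ∧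
      ∀ i, i ≠ k →
        (((Pos (v k) ∧ B i k < 0) ∨ (¬ Pos (v k) ∧ 0 < B i k)) ∧ c i = form (v i) (v k) ∨
        ¬ ((Pos (v k) ∧ B i k < 0) ∨ (¬ Pos (v k) ∧ 0 < B i k)) ∧ c i = 0) := by
  classical
  refine ⟨fun i => if i = k then 2 else
    if (Pos (v k) ∧ B i k < 0) ∨ (¬ Pos (v k) ∧ 0 < B i k) then form (v i) (v k) else 0,
    by simp, fun i => ?_, fun i hi => ?_⟩
  · by_cases hi : i = k
    · subst hi
      simp only [mutateVectors, if_true, two_smul]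
      abel
    · simp only [mutateVectors, hi, if_false]
      split_ifs <;> simp
  · simp only [hi, if_false]
    split_ifs with h
    · exact Or.inl ⟨h, rfl⟩
    · exact Or.inr ⟨h, rfl⟩

open Classical in
theorem parity_iff {v : Fin 3 → AffFun} {B : Matrix (Fin 3) (Fin 3) ℝ} (hB : B.transpose = -B) :
    ((∀ i j, i < j → form (v i) (v j) ≠ 0) →
      (Even (Finset.univ.filter (fun p : Fin 3 × Fin 3 =>
        p.1 < p.2 ∧ 0 < form (v p.1) (v p.2))).card ↔ IsAcyclic B)) ↔
    (form (v 0) (v 1) * form (v 0) (v 2) * form (v 1) (v 2) ≠ 0 →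
      (form (v 0) (v 1) * form (v 0) (v 2) * form (v 1) (v 2) < 0 ↔
        ¬ Cyc (B 0 1) (B 1 2) (B 2 0))) := by
  have hn : (∀ i j, i < j → form (v i) (v j) ≠ 0) ↔
      form (v 0) (v 1) * form (v 0) (v 2) * form (v 1) (v 2) ≠ 0 := by
    constructor
    · intro h
      exact mul_ne_zero (mul_ne_zero (h 0 1 (by decide)) (h 0 2 (by decide))) (h 1 2 (by decide))
    · intro h i j hij
      have h1 := right_ne_zero_of_mul h
      have h2 := left_ne_zero_of_mul h
      have h3 := right_ne_zero_of_mul h2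
      have h4 := left_ne_zero_of_mul h2
      fin_cases i <;> fin_cases j <;> first
        | exact absurd hij (by decide)
        | assumption
  rw [isAcyclic_iff hB, hn]
  refine forall_congr' fun h => ?_
  rw [even_card_iff (g := fun i j => form (v i) (v j)) (left_ne_zero_of_mul (left_ne_zero_of_mul h))
    (right_ne_zero_of_mul (left_ne_zero_of_mul h)) (right_ne_zero_of_mul h)]

theorem mutate_core (Pos : AffFun → Prop) {v : Fin 3 → AffFun} {B : Matrix (Fin 3) (Fin 3) ℝ}
    (hB : B.transpose = -B) (hv : IsGeometricRealisation v B) {i j k : Fin 3}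
    (hij : i ≠ j) (hik : i ≠ k) (hjk : j ≠ k)
    (hpar : form (v i) (v j) * form (v i) (v k) * form (v j) (v k) ≠ 0 →
      (form (v i) (v j) * form (v i) (v k) * form (v j) (v k) < 0 ↔
        ¬ Cyc (B i j) (B j k) (B k i)))
    {v' : Fin 3 → AffFun} (hv' : v' = mutateVectors Pos v B k)
    {B' : Matrix (Fin 3) (Fin 3) ℝ} (hB' : B' = mutateMatrix B k) :
    |form (v' i) (v' j)| = |B' i j| ∧ |form (v' i) (v' k)| = |B' i k| ∧
    |form (v' j) (v' k)| = |B' j k| ∧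
    (form (v' i) (v' j) * form (v' i) (v' k) * form (v' j) (v' k) ≠ 0 →
      (form (v' i) (v' j) * form (v' i) (v' k) * form (v' j) (v' k) < 0 ↔
        ¬ Cyc (B' i j) (B' j k) (B' k i))) := by
  have h : ∀ i j, B j i = -B i j := fun i j => congrFun (congrFun hB i) j
  obtain ⟨c, hck, hc, hcc⟩ := mutateVectors_eq Pos (v := v) (B := B) k
  rw [h i k] at hpar
  have key := core (hv.abs_form i j hij) (hv.abs_form i k hik) (hv.abs_form j k hjk) hpar
    (hcc i hik) (hcc j hjk)
  have e1 : form (v' i) (v' j) = form (v i) (v j) - c j * form (v i) (v k) -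
      c i * form (v j) (v k) + 2 * c i * c j := by
    rw [hv', hc, hc, form_sub_smul, hv.form_self]; ring
  have e2 : form (v' i) (v' k) = 2 * c i - form (v i) (v k) := by
    rw [hv', hc, hc, form_sub_smul, hv.form_self, hck]; ring
  have e3 : form (v' j) (v' k) = 2 * c j - form (v j) (v k) := by
    rw [hv', hc, hc, form_sub_smul, hv.form_self, hck]; ring
  have m1 : B' i j = B i j + (B i k * |B j k| - |B i k| * B j k) / 2 := by
    simp only [hB', mutateMatrix, Matrix.of_apply, hik, hjk, or_self, if_false]
    rw [h j k, abs_neg]; ring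
  have m2 : B' i k = -B i k := by simp [hB', mutateMatrix]
  have m3 : B' j k = -B j k := by simp [hB', mutateMatrix]
  have m4 : B' k i = B i k := by simp [hB', mutateMatrix, h i k]
  rw [e1, e2, e3, m1, m2, m3, m4, abs_neg, abs_neg]
  exact key

theorem mutate_realisation (Pos : AffFun → Prop) {v : Fin 3 → AffFun}
    {B : Matrix (Fin 3) (Fin 3) ℝ} (hB : B.transpose = -B) (hv : IsGeometricRealisation v B)
    (k : Fin 3) : IsGeometricRealisation (mutateVectors Pos v B k) (mutateMatrix B k) := by
  have hsk := mutateMatrix_skew hB k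
  have hp := (parity_iff hB).1 hv.parity
  have hs : ∀ i j, |mutateMatrix B k j i| = |mutateMatrix B k i j| := fun i j => by
    rw [show mutateMatrix B k j i = -mutateMatrix B k i j from congrFun (congrFun hsk i) j, abs_neg]
  obtain ⟨c, hck, hc, hcc⟩ := mutateVectors_eq Pos (v := v) (B := B) k
  have main : (|form (mutateVectors Pos v B k 0) (mutateVectors Pos v B k 1)| =
        |mutateMatrix B k 0 1| ∧
      |form (mutateVectors Pos v B k 0) (mutateVectors Pos v B k 2)| = |mutateMatrix B k 0 2| ∧
      |form (mutateVectors Pos v B k 1) (mutateVectors Pos v B k 2)| = |mutateMatrix B k 1 2|) ∧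
      (form (mutateVectors Pos v B k 0) (mutateVectors Pos v B k 1) *
          form (mutateVectors Pos v B k 0) (mutateVectors Pos v B k 2) *
          form (mutateVectors Pos v B k 1) (mutateVectors Pos v B k 2) ≠ 0 →
        (form (mutateVectors Pos v B k 0) (mutateVectors Pos v B k 1) *
          form (mutateVectors Pos v B k 0) (mutateVectors Pos v B k 2) *
          form (mutateVectors Pos v B k 1) (mutateVectors Pos v B k 2) < 0 ↔
        ¬ Cyc (mutateMatrix B k 0 1) (mutateMatrix B k 1 2) (mutateMatrix B k 2 0))) := by
    have hk : k = 0 ∨ k = 1 ∨ k = 2 := by fin_cases k <;> simp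
    have rot : ∀ x y z : ℝ, Cyc x y z ↔ Cyc y z x := fun x y z => by unfold Cyc; tauto
    rcases hk with rfl | rfl | rfl
    · obtain ⟨h1, h2, h3, h4⟩ := mutate_core Pos hB hv (i := 1) (j := 2) (k := 0)
        (by decide) (by decide) (by decide)
        (by rw [form_comm (v 1) (v 0), form_comm (v 2) (v 0), ← rot]
            rw [show form (v 1) (v 2) * form (v 0) (v 1) * form (v 0) (v 2) =
              form (v 0) (v 1) * form (v 0) (v 2) * form (v 1) (v 2) by ring]
            exact hp) rfl rfl
      generalize mutateVectors Pos v B 0 = V at *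
      generalize mutateMatrix B 0 = M at *
      rw [form_comm, hs] at h2 h3
      rw [form_comm (V 1) (V 0), form_comm (V 2) (V 0), ← rot,
        show form (V 1) (V 2) * form (V 0) (V 1) * form (V 0) (V 2) =
          form (V 0) (V 1) * form (V 0) (V 2) * form (V 1) (V 2) by ring] at h4
      exact ⟨⟨h2, h3, h1⟩, h4⟩
    · obtain ⟨h1, h2, h3, h4⟩ := mutate_core Pos hB hv (i := 2) (j := 0) (k := 1)
        (by decide) (by decide) (by decide)
        (by rw [form_comm (v 2) (v 0), form_comm (v 2) (v 1), rot]
            rw [show form (v 0) (v 2) * form (v 1) (v 2) * form (v 0) (v 1) =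
              form (v 0) (v 1) * form (v 0) (v 2) * form (v 1) (v 2) by ring]
            exact hp) rfl rfl
      generalize mutateVectors Pos v B 1 = V at *
      generalize mutateMatrix B 1 = M at *
      rw [form_comm, hs] at h1 h2
      rw [form_comm (V 2) (V 0), form_comm (V 2) (V 1), rot,
        show form (V 0) (V 2) * form (V 1) (V 2) * form (V 0) (V 1) =
          form (V 0) (V 1) * form (V 0) (V 2) * form (V 1) (V 2) by ring] at h4
      exact ⟨⟨h3, h1, h2⟩, h4⟩
    · obtain ⟨h1, h2, h3, h4⟩ := mutate_core Pos hB hv (i := 0) (j := 1) (k := 2)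
        (by decide) (by decide) (by decide) hp rfl rfl
      exact ⟨⟨h1, h2, h3⟩, h4⟩
  obtain ⟨⟨h01, h02, h12⟩, h4⟩ := main
  refine ⟨?_, ?_, ?_, (parity_iff hsk).2 h4⟩
  · have hli := hv.linearIndependent
    rw [Fintype.linearIndependent_iff] at hli ⊢
    intro g hg
    have hsum : ∑ i, (g i - if i = k then ∑ j, g j * c j else 0) • v i = 0 := by
      rw [← hg]
      simp only [hc, sub_smul, smul_sub, Finset.sum_sub_distrib, ite_smul, zero_smul,
        Finset.sum_ite_eq', Finset.mem_univ, if_true, Finset.sum_smul, smul_smul]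
    have h0 := hli _ hsum
    have hne : ∀ i, i ≠ k → g i = 0 := fun i hi => by simpa [hi] using h0 i
    have hk := h0 k
    rw [Finset.sum_eq_single k (fun i _ hi => by rw [hne i hi, zero_mul]) (by simp), hck] at hk
    simp only [if_true] at hk
    intro i
    by_cases hi : i = k
    · subst hi; linarith
    · exact hne i hi
  · intro i
    rw [hc, form_sub_smul, hv.form_self, hv.form_self]
    by_cases hi : i = k
    · subst hi; rw [hck, hv.form_self]; ring
    · rcases hcc i hi with ⟨-, h⟩ | ⟨-, h⟩ <;> rw [h] <;> ring
  · intro i j hij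
    fin_cases i <;> fin_cases j <;> first
      | exact absurd rfl hij
      | assumption
      | (rw [form_comm, hs]; assumption)

/-- Mutation of seeds at `k`, with respect to a set `Pos` of positive vectors. -/
def Seed.mutate (Pos : AffFun → Prop) (S : Seed) (k : Fin 3) : Seed where
  v := mutateVectors Pos S.v S.B k
  B := mutateMatrix S.B k
  skew := mutateMatrix_skew S.skew k
  realisation := mutate_realisation Pos S.skew S.realisation k

/-- `T` is a vertex of the exchange graph of `S`: it is obtained from `S` by a finite sequence of
mutations. -/
def InExchangeGraph (Pos : AffFun → Prop) (S T : Seed) : Prop :=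
  Relation.ReflTransGen (fun S₁ S₂ : Seed => ∃ k, S₂ = S₁.mutate Pos k) S T

/-- `T = w + S`. Seeds which differ by a reordering of their three indices are identified. -/
def IsTranslate (w : Plane) (S T : Seed) : Prop :=
  ∃ σ : Equiv.Perm (Fin 3), (∀ i, T.v (σ i) = (S.v i).translate w) ∧
    ∀ i j, T.B (σ i) (σ j) = S.B i j

/-- Positivity with respect to the reference point `u` which lies infinitely far away on the line
through `p` and `q`, in the direction from `p` to `q`: the vector `f` is positive if `u` belongs to
the half-plane `{f < 0}`, i.e. if the points far out on the ray from `p` through `q` do. -/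
def IsPositive (p q : Plane) (f : AffFun) : Prop :=
  ∀ᶠ s : ℝ in atTop, f.eval (AffineMap.lineMap p q s) < 0

/-- The fundamental angle `α = π / (2n+1)`. -/
def alpha (n : ℕ) : ℝ := Real.pi / (2 * n + 1)

/-- The initial triangle has angles `α`, `nα`, `nα` at its vertices `0`, `1`, `2`. -/
structure IsInitialTriangle (n : ℕ) (t : Affine.Triangle ℝ Plane) : Prop where
  angle_zero : EuclideanGeometry.angle (t.points 1) (t.points 0) (t.points 2) = alpha n
  angle_one : EuclideanGeometry.angle (t.points 0) (t.points 1) (t.points 2) = n * alpha n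
  angle_two : EuclideanGeometry.angle (t.points 0) (t.points 2) (t.points 1) = n * alpha n

/-- The seed `S` is given by the initial triangle `t` with an acyclic quiver. The vector `S.v i`
belongs to the side opposite to vertex `i`: it vanishes on this side, and the triangle lies in the
half-plane where it is negative. In the quiver, the base (side `0`) is the source, one leg (side
`2`) is the sink, and there is an arrow from the other leg to the sink. The absolute values
of the weights are determined by the angles because `S` is a seed. -/
structure IsInitialSeed (t : Affine.Triangle ℝ Plane) (S : Seed) : Prop where
  eval_eq_zero : ∀ i j, j ≠ i → (S.v i).eval (t.points j) = 0
  eval_neg : ∀ i, (S.v i).eval (t.points i) < 0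
  arrow_zero_one : 0 < S.B 0 1
  arrow_zero_two : 0 < S.B 0 2
  arrow_one_two : 0 < S.B 1 2

/-- Positivity attached to the initial triangle. The belt line `b` joins the feet of the altitudes
on the source (side `0`) and on the sink (side `2`); the reference point lies infinitely far away
on `b` in the direction from the source to the sink. -/
def BeltPositive (t : Affine.Triangle ℝ Plane) : AffFun → Prop :=
  IsPositive (t.altitudeFoot 0) (t.altitudeFoot 2)

/-- The length `d₁` of the two legs, the longer sides of the initial triangle. -/
def legLength (t : Affine.Triangle ℝ Plane) : ℝ := dist (t.points 0) (t.points 1)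

/-- The lattice `R`, spanned by `d₁ sin(α) sin(nα) / sin²(kα)` for `k ∈ [1, n]` coprime to
`2n+1`. -/
def latticeR (n : ℕ) (d₁ : ℝ) : Submodule ℤ ℝ :=
  Submodule.span ℤ {x | ∃ k : ℕ, 1 ≤ k ∧ k ≤ n ∧ Nat.gcd k (2 * n + 1) = 1 ∧
    x = d₁ * (Real.sin (alpha n) * Real.sin (n * alpha n) / Real.sin (k * alpha n) ^ 2)}

/-- The translation lattice `L`, spanned by the lengths of all vectors which translate one vertex
of the exchange graph of `S₀` to another one. -/
def latticeL (Pos : AffFun → Prop) (S₀ : Seed) : Submodule ℤ ℝ :=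
  Submodule.span ℤ {x | ∃ (w : Plane) (S₁ S₂ : Seed), InExchangeGraph Pos S₀ S₁ ∧
    InExchangeGraph Pos S₀ S₂ ∧ IsTranslate w S₂ S₁ ∧ x = ‖w‖}

/-- The lattice `c • ℤ[2 cos α]`. -/
def cosLattice (n : ℕ) (c : ℝ) : Submodule ℤ ℝ :=
  (Subalgebra.toSubmodule (Algebra.adjoin ℤ {2 * Real.cos (alpha n)})).map (LinearMap.mulLeft ℤ c)

end RealQuiver

end

/-! Write A = ℤ[2 cos α]. The proof shows R ≤ L ≤ A d₁, so that d = 1 already works, and then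
computes the rank of everything in between.

Four things are carried through all mutations (`Invariants.of_inExchangeGraph`). The vector b₀₁ v₂ +
b₁₂ v₀ + b₂₀ v₁ is fixed up to sign; on the initial seed it vanishes on the belt line. Because of
this relation, the positivity of the vectors determines all the inner products (`Coherent.mutate`).
The A-span of the three vectors does not change, since all weights are ± 2 cos(jα). The determinant
of the three vectors changes only by a sign.

Upper bound (`latticeL_le_cosLattice`): a translation w between two vertices of the graph must
preserve the belt vector, hence is parallel to the belt line. Differences of translated vectors are
constants in the invariant span, and evaluating them at the apex, where only one initial vector is
nonzero, gives ⟨v₀, w⟩ ∈ A κ, with κ the negative of the value of v₀ at the apex. Together these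
give 2 cos(nα) · ‖w‖ ∈ A d₁, and 2 cos(nα) is a unit of A.

Lower bound (`latticeR_le_latticeL`): encode the weights by a pair of integers (a, b), with absolute
values 2|cos aα|, 2|cos bα|, 2|cos(a+b)α|. The product formula for cosines turns mutation into (a,
b) ↦ (a, -b), and together with symmetries and periodicity modulo 2n+1 this is the Euclidean
algorithm. So every (k, 0) with k coprime to 2n+1 occurs. Such a seed has two parallel lines, and a
suitable mutation translates it. The length of the translation is read off from the invariant
determinant, and equals the generator of R with index k.

Rank: A has rank at most φ(2n+1)/2 because ℚ(cos α) is a real, hence proper, subfield of the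
cyclotomic field. Conversely the generators of R are independent
(`linearIndependent_one_div_sin_sq`): a relation can be conjugated so that its largest coefficient
sits at 1/sin² α, which exceeds the sum of all other 1/sin² mα with m ≤ n. -/

noncomputable section

namespace RealQuiver

/-! ### Quotients of sines in ℤ[2 cos α] -/

section Trigonometry

/-- The ring `ℤ[2 cos α]`. -/
abbrev cosRing (n : ℕ) : Subalgebra ℤ ℝ := Algebra.adjoin ℤ {2 * Real.cos (alpha n)}

theorem alpha_pos (n : ℕ) : 0 < alpha n := by
  unfold alpha; positivity

theorem mul_alpha (n : ℕ) : (2 * n + 1 : ℝ) * alpha n = Real.pi := by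
  unfold alpha; field_simp

theorem sin_pos_of_lt {n k : ℕ} (hk : 1 ≤ k) (hkn : k < 2 * n + 1) :
    0 < Real.sin (k * alpha n) := by
  have h1 : (1 : ℝ) ≤ k := by exact_mod_cast hk
  have h2 : (k : ℝ) < 2 * n + 1 := by exact_mod_cast hkn
  have := alpha_pos n
  apply Real.sin_pos_of_pos_of_lt_pi (by positivity)
  rw [← mul_alpha n]
  gcongr

theorem two_cos_mul_mem {A : Subalgebra ℤ ℝ} {θ : ℝ} (h : 2 * Real.cos θ ∈ A) (m : ℕ) :
    2 * Real.cos (m * θ) ∈ A := by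
  induction m using Nat.twoStepInduction with
  | zero => simp
  | one => simp [h]
  | more m h1 h2 =>
    have e : 2 * Real.cos ((m + 2 : ℕ) * θ) =
        (2 * Real.cos θ) * (2 * Real.cos ((m + 1 : ℕ) * θ)) - 2 * Real.cos (m * θ) := by
      have h1 : ((m + 2 : ℕ) * θ : ℝ) = (m + 1 : ℕ) * θ + θ := by push_cast; ring
      have h2 : (m * θ : ℝ) = (m + 1 : ℕ) * θ - θ := by push_cast; ring
      rw [h1, h2, Real.cos_add, Real.cos_sub]; ring
    rw [e]
    exact A.sub_mem (A.mul_mem h h2) h1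

/-- The quotient is a Chebyshev polynomial of the second kind evaluated at cos θ, produced here by
its recurrence. -/
theorem exists_sin_mul_eq {A : Subalgebra ℤ ℝ} {θ : ℝ} (h : 2 * Real.cos θ ∈ A) (m : ℕ) :
    ∃ x ∈ A, Real.sin (m * θ) = x * Real.sin θ := by
  induction m using Nat.twoStepInduction with
  | zero => exact ⟨0, A.zero_mem, by simp⟩
  | one => exact ⟨1, A.one_mem, by simp⟩
  | more m h1 h2 =>
    obtain ⟨x, hx, ex⟩ := h1
    obtain ⟨y, hy, ey⟩ := h2
    refine ⟨2 * Real.cos θ * y - x, A.sub_mem (A.mul_mem h hy) hx, ?_⟩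
    have h1 : ((m + 2 : ℕ) * θ : ℝ) = (m + 1 : ℕ) * θ + θ := by push_cast; ring
    have h2 : (m * θ : ℝ) = (m + 1 : ℕ) * θ - θ := by push_cast; ring
    have e : Real.sin ((m + 2 : ℕ) * θ) =
        (2 * Real.cos θ) * Real.sin ((m + 1 : ℕ) * θ) - Real.sin (m * θ) := by
      rw [h1, h2, Real.sin_add, Real.sin_sub]; ring
    rw [e, ey, ex]; ring

theorem two_cos_alpha_mem (n : ℕ) : 2 * Real.cos (alpha n) ∈ cosRing n :=
  Algebra.subset_adjoin rfl

/-- If m inverts k modulo 2n+1, then m(kα) differs from α by a multiple of π, so sin α is, up to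
sign, the sine of an m-fold multiple of kα. -/
theorem exists_sin_alpha_eq {n k : ℕ} (hk : Nat.gcd k (2 * n + 1) = 1) :
    ∃ x ∈ cosRing n, Real.sin (alpha n) = x * Real.sin (k * alpha n) := by
  rcases Nat.eq_zero_or_pos n with rfl | hn
  · exact ⟨0, Subalgebra.zero_mem _, by simp [alpha]⟩
  obtain ⟨m, -, hm⟩ := Nat.exists_mul_mod_eq_one_of_coprime hk (by omega)
  obtain ⟨x, hx, ex⟩ := exists_sin_mul_eq (two_cos_mul_mem (two_cos_alpha_mem n) k) m
  have h1 := Nat.div_add_mod (k * m) (2 * n + 1)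
  rw [hm] at h1
  set q := k * m / (2 * n + 1)
  have h2 : (m * (k * alpha n) : ℝ) = alpha n + q * Real.pi := by
    have h3 : (k * m : ℝ) = (2 * n + 1) * q + 1 := by exact_mod_cast h1.symm
    rw [← mul_alpha n]
    linear_combination alpha n * h3
  rw [h2, Real.sin_add_nat_mul_pi] at ex
  rcases neg_one_pow_eq_or ℝ q with h | h <;> rw [h] at ex
  · exact ⟨x, hx, by linarith⟩
  · exact ⟨-x, Subalgebra.neg_mem _ hx, by linarith⟩

theorem latticeR_le_cosLattice (n : ℕ) (hn : 1 ≤ n) (d : ℝ) : latticeR n d ≤ cosLattice n d := by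
  refine Submodule.span_le.2 ?_
  rintro _ ⟨k, hk1, hkn, hk, rfl⟩
  obtain ⟨x, hx, ex⟩ := exists_sin_alpha_eq hk
  obtain ⟨y, hy, ey⟩ := exists_sin_mul_eq (two_cos_alpha_mem n) n
  -- With sin α = x sin kα and sin nα = y sin α, the generator is d y (sin α / sin kα)² = d y x².
  refine ⟨x * (y * x), Subalgebra.mul_mem _ hx (Subalgebra.mul_mem _ hy hx), ?_⟩
  have := sin_pos_of_lt hk1 (show k < 2 * n + 1 by omega)
  simp only [LinearMap.mulLeft_apply]
  rw [ey, ex]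
  field_simp

end Trigonometry

/-! ### Rank of the lattices: cyclotomic fields and diagonal dominance -/

section Rank

theorem exp_pow_eq (n m : ℕ) :
    Complex.exp (2 * Real.pi * Complex.I / (2 * n + 1 : ℕ)) ^ m =
      Complex.exp ((m * alpha n : ℝ) * Complex.I) ^ 2 := by
  rw [← Complex.exp_nat_mul, ← Complex.exp_nat_mul]
  congr 1
  unfold alpha
  push_cast
  ring

theorem sin_sq_eq (n m : ℕ) :
    ((Real.sin (m * alpha n) ^ 2 : ℝ) : ℂ) =
      -(Complex.exp (2 * Real.pi * Complex.I / (2 * n + 1 : ℕ)) ^ m - 1) ^ 2 /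
        (4 * Complex.exp (2 * Real.pi * Complex.I / (2 * n + 1 : ℕ)) ^ m) := by
  rw [exp_pow_eq]
  push_cast
  rw [Complex.sin, neg_mul, Complex.exp_neg]
  have := Complex.exp_ne_zero ((m * alpha n : ℂ) * Complex.I)
  field_simp
  rw [Complex.I_sq]
  ring

/-- Here ζ = exp(2iα), and 2nα = π - α gives ζⁿ = -exp(-iα). Thus 2 cos α is expressed in ζ although
exp(iα) itself is only a 2(2n+1)-th root of unity. -/
theorem two_cos_eq (n : ℕ) :
    ((2 * Real.cos (alpha n) : ℝ) : ℂ) =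
      -(Complex.exp (2 * Real.pi * Complex.I / (2 * n + 1 : ℕ)) ^ n +
        (Complex.exp (2 * Real.pi * Complex.I / (2 * n + 1 : ℕ)) ^ n)⁻¹) := by
  rw [exp_pow_eq, ← Complex.exp_nat_mul, ← Complex.exp_neg]
  have h : ((2 : ℕ) * ((n * alpha n : ℝ) * Complex.I) : ℂ) =
      Real.pi * Complex.I + (-(alpha n : ℂ) * Complex.I) := by
    have : (2 * n * alpha n : ℝ) = Real.pi - alpha n := by linarith [mul_alpha n]
    have h2 : (2 * n * alpha n : ℂ) = Real.pi - alpha n := by exact_mod_cast this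
    push_cast
    linear_combination Complex.I * h2
  rw [h, neg_add (_ * Complex.I), Complex.exp_add, Complex.exp_add,
    Complex.exp_neg (Real.pi * Complex.I), Complex.exp_pi_mul_I]
  push_cast
  rw [Complex.cos]
  ring_nf

theorem isIntegral_two_cos (n : ℕ) : IsIntegral ℤ (2 * Real.cos (alpha n)) := by
  rw [← isIntegral_algebraMap_iff (B := ℂ) (FaithfulSMul.algebraMap_injective ℝ ℂ)]
  have hζ := Complex.isPrimitiveRoot_exp (2 * n + 1) (by omega)
  have h : IsIntegral ℤ (Complex.exp (2 * Real.pi * Complex.I / (2 * n + 1 : ℕ)) ^ n) :=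
    (hζ.isIntegral (by omega)).pow n
  have h' : IsIntegral ℤ (Complex.exp (2 * Real.pi * Complex.I / (2 * n + 1 : ℕ)) ^ n)⁻¹ := by
    rw [← inv_pow]
    exact (hζ.inv.isIntegral (by omega)).pow n
  have := (h.add h').neg
  rwa [← two_cos_eq] at this

/-- The degree φ(2n+1) of ℚ(ζ) factors through ℚ(2 cos α). The relative degree is not 1, because the
smaller field is real and ζ = exp(2iα) is not; so it is at least 2. -/
theorem natDegree_minpoly_two_cos (n : ℕ) (hn : 1 ≤ n) :
    (minpoly ℚ (2 * Real.cos (alpha n))).natDegree ≤ Nat.totient (2 * n + 1) / 2 := by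
  have hζ := Complex.isPrimitiveRoot_exp (2 * n + 1) (by omega)
  have ec := two_cos_eq n
  set ζ := Complex.exp (2 * Real.pi * Complex.I / (2 * n + 1 : ℕ)) with hζd
  set c : ℂ := ((2 * Real.cos (alpha n) : ℝ) : ℂ) with hc
  have h1 : minpoly ℚ c = minpoly ℚ (2 * Real.cos (alpha n)) :=
    minpoly.algebraMap_eq (FaithfulSMul.algebraMap_injective ℝ ℂ) _
  have hci : IsIntegral ℚ c := by
    rw [hc]
    exact ((isIntegral_two_cos n).tower_top (A := ℚ)).map (Complex.ofRealAm.restrictScalars ℚ)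
  have hζi : IsIntegral ℚ ζ := hζ.isIntegral (by omega) |>.tower_top
  rw [← h1, ← IntermediateField.adjoin.finrank hci]
  have hle : IntermediateField.adjoin ℚ {c} ≤ IntermediateField.adjoin ℚ {ζ} := by
    rw [IntermediateField.adjoin_simple_le_iff, ec]
    have := IntermediateField.mem_adjoin_simple_self ℚ ζ
    exact neg_mem (add_mem (pow_mem this n) (inv_mem (pow_mem this n)))
  have h2 := IntermediateField.finrank_bot_mul_relfinrank hle
  have h3 : Module.finrank ℚ (IntermediateField.adjoin ℚ {ζ}) = Nat.totient (2 * n + 1) := by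
    rw [IntermediateField.adjoin.finrank hζi,
      ← Polynomial.cyclotomic_eq_minpoly_rat hζ (by omega), Polynomial.natDegree_cyclotomic]
  rw [h3] at h2
  have hpos : 0 < Nat.totient (2 * n + 1) := Nat.totient_pos.2 (by omega)
  set x := Module.finrank ℚ (IntermediateField.adjoin ℚ {c})
  set y := IntermediateField.relfinrank (IntermediateField.adjoin ℚ {c})
    (IntermediateField.adjoin ℚ {ζ}) with hy
  have hy0 : y ≠ 0 := by rintro h; rw [h] at h2; omega
  have hy1 : y ≠ 1 := by
    intro h
    rw [hy, IntermediateField.relfinrank_eq_one_iff] at h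
    have h4 : ζ ∈ IntermediateField.adjoin ℚ {c} := h (IntermediateField.mem_adjoin_simple_self ℚ ζ)
    have h5 : IntermediateField.adjoin ℚ {c} ≤
        (Complex.ofRealAm.restrictScalars ℚ).fieldRange := by
      rw [IntermediateField.adjoin_simple_le_iff]
      exact ⟨_, rfl⟩
    obtain ⟨t, ht⟩ := h5 h4
    have ht' : (t : ℂ) = ζ := ht
    have h6 : ζ.im = 0 := by rw [← ht']; simp
    have h7 : ζ = Complex.exp ((2 * alpha n : ℝ) * Complex.I) := by
      rw [hζd]; congr 1; unfold alpha; push_cast; ring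
    rw [h7, Complex.exp_ofReal_mul_I_im] at h6
    have := sin_pos_of_lt (n := n) (k := 2) (by norm_num) (by omega)
    push_cast at this
    linarith
  rw [Nat.le_div_iff_mul_le (by norm_num), ← h2]
  exact Nat.mul_le_mul_left _ (by omega)

theorem finite_cosRing (n : ℕ) : Module.Finite ℤ (cosRing n) :=
  Module.Finite.of_basis (Algebra.adjoin.powerBasis' (isIntegral_two_cos n)).basis

theorem finrank_cosRing_le (n : ℕ) (hn : 1 ≤ n) :
    Module.finrank ℤ (cosRing n) ≤ Nat.totient (2 * n + 1) / 2 := by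
  rw [(Algebra.adjoin.powerBasis' (isIntegral_two_cos n)).finrank,
    Algebra.adjoin.powerBasis'_dim]
  have h := minpoly.isIntegrallyClosed_eq_field_fractions' ℚ (isIntegral_two_cos n)
  have := natDegree_minpoly_two_cos n hn
  rwa [h, (minpoly.monic (isIntegral_two_cos n)).natDegree_map] at this

theorem finite_cosLattice (n : ℕ) (c : ℝ) : Module.Finite ℤ (cosLattice n c) := by
  have := finite_cosRing n
  have : Module.Finite ℤ (Subalgebra.toSubmodule (cosRing n)) := this
  unfold cosLattice
  infer_instance

theorem finrank_cosLattice_le (n : ℕ) (hn : 1 ≤ n) (c : ℝ) :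
    Module.finrank ℤ (cosLattice n c) ≤ Nat.totient (2 * n + 1) / 2 := by
  have : Module.Finite ℤ (Subalgebra.toSubmodule (cosRing n)) := finite_cosRing n
  exact (Submodule.finrank_map_le _ _).trans (finrank_cosRing_le n hn)

/-- Galois conjugation of a linear relation between the numbers `1 / sin² (kα)`. -/
theorem sum_div_sin_sq_conj {n : ℕ} (F : Finset ℕ) (g : ℕ → ℤ)
    {j : ℕ} (hj : Nat.Coprime j (2 * n + 1))
    (h : ∑ k ∈ F, (g k : ℝ) / Real.sin (k * alpha n) ^ 2 = 0) :
    ∑ k ∈ F, (g k : ℝ) / Real.sin ((j * k : ℕ) * alpha n) ^ 2 = 0 := by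
  have hζ := Complex.isPrimitiveRoot_exp (2 * n + 1) (by omega)
  have es := sin_sq_eq n
  set ζ := Complex.exp (2 * Real.pi * Complex.I / (2 * n + 1 : ℕ)) with hζd
  have : NeZero (2 * n + 1) := ⟨by omega⟩
  have : NeZero ((2 * n + 1 : ℕ) : ℚ) := ⟨by positivity⟩
  have : IsCyclotomicExtension {2 * n + 1} ℚ (CyclotomicField (2 * n + 1) ℚ) :=
    CyclotomicField.isCyclotomicExtension (2 * n + 1) ℚ
  have hη := IsCyclotomicExtension.zeta_spec (2 * n + 1) ℚ (CyclotomicField (2 * n + 1) ℚ)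
  set η := IsCyclotomicExtension.zeta (2 * n + 1) ℚ (CyclotomicField (2 * n + 1) ℚ)
  have hirr : Irreducible (Polynomial.cyclotomic (2 * n + 1) ℚ) :=
    Polynomial.cyclotomic.irreducible_rat (by omega)
  have key : ∀ i : ℕ, Nat.Coprime i (2 * n + 1) → ∃ f : CyclotomicField (2 * n + 1) ℚ →ₐ[ℚ] ℂ, f η = ζ ^ i := by
    intro i hi
    have hmem : ζ ^ i ∈ primitiveRoots (2 * n + 1) ℂ :=
      (mem_primitiveRoots (by omega)).2 (hζ.pow_of_coprime i hi)
    refine ⟨(hη.embeddingsEquivPrimitiveRoots ℂ hirr).symm ⟨_, hmem⟩, ?_⟩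
    rw [← hη.embeddingsEquivPrimitiveRoots_apply_coe ℂ hirr, Equiv.apply_symm_apply]
  have eval : ∀ (i : ℕ) (f : CyclotomicField (2 * n + 1) ℚ →ₐ[ℚ] ℂ), f η = ζ ^ i →
      f (∑ k ∈ F, (g k : CyclotomicField (2 * n + 1) ℚ) / (-(η ^ k - 1) ^ 2 / (4 * η ^ k))) =
        ((∑ k ∈ F, (g k : ℝ) / Real.sin ((i * k : ℕ) * alpha n) ^ 2 : ℝ) : ℂ) := by
    intro i f hf
    rw [map_sum, Complex.ofReal_sum]
    refine Finset.sum_congr rfl fun k _ => ?_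
    rw [Complex.ofReal_div, es]
    simp [hf, pow_mul, map_ofNat]
  obtain ⟨f₁, hf₁⟩ := key 1 (by simp)
  obtain ⟨f, hf⟩ := key j hj
  have h1 := eval 1 f₁ hf₁
  have h2 := eval j f hf
  simp only [one_mul] at h1
  -- Both sums are images of one element of the abstract cyclotomic field, under η ↦ ζ and η ↦ ζ^j.
  -- Field embeddings are injective, so vanishing of the first image kills the element itself.
  rw [h, Complex.ofReal_zero, map_eq_zero] at h1
  rw [h1, map_zero] at h2
  exact_mod_cast h2.symm

/-- Telescoping: 1/m² ≤ 1/(m - 1/2) - 1/(m + 1/2). -/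
theorem sum_one_div_sq_le (M : ℕ) (hM : 1 ≤ M) :
    ∑ m ∈ Finset.Icc 2 M, (1 : ℝ) / (m : ℝ) ^ 2 ≤ 2 / 3 - 2 / (2 * M + 1) := by
  induction M, hM using Nat.le_induction with
  | base => norm_num
  | succ M hM ih =>
    rw [Finset.sum_Icc_succ_top (by omega)]
    have : (1 : ℝ) / ((M + 1 : ℕ) : ℝ) ^ 2 ≤ 2 / (2 * M + 1) - 2 / (2 * (M + 1 : ℕ) + 1) := by
      push_cast
      rw [div_sub_div _ _ (by positivity) (by positivity), div_le_div_iff₀ (by positivity)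
        (by positivity)]
      nlinarith
    linarith

/-- This is 1/sin² = 1 + cot² combined with x < tan x. -/
theorem one_div_sin_sq_lt {x : ℝ} (h0 : 0 < x) (h1 : x < Real.pi / 2) :
    1 / Real.sin x ^ 2 < 1 + 1 / x ^ 2 := by
  have hs : 0 < Real.sin x := Real.sin_pos_of_pos_of_lt_pi h0 (by linarith [Real.pi_pos])
  have hc : 0 < Real.cos x := Real.cos_pos_of_mem_Ioo ⟨by linarith, h1⟩
  have ht := Real.lt_tan h0 h1
  rw [Real.tan_eq_sin_div_cos, lt_div_iff₀ hc] at ht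
  have h2 : (x * Real.cos x) ^ 2 < Real.sin x ^ 2 := by gcongr
  have h3 : 1 / Real.sin x ^ 2 = 1 + Real.cos x ^ 2 / Real.sin x ^ 2 := by
    field_simp
    linarith [Real.sin_sq_add_cos_sq x]
  rw [h3]
  gcongr 1 + ?_
  rw [div_lt_div_iff₀ (by positivity) (by positivity)]
  nlinarith

/-- The diagonal dominance estimate. Termwise comparison with 1 + 1/(mα)² bounds the left side by (n
- 1) + (2/3 - 2/(2n+1))/α², and the linear term n - 1 fits into the remaining part of 1/α², which is
less than 1/sin² α. -/
theorem sum_one_div_sin_sq_lt (n : ℕ) (hn : 1 ≤ n) :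
    ∑ m ∈ Finset.Icc 2 n, 1 / Real.sin (m * alpha n) ^ 2 < 1 / Real.sin (alpha n) ^ 2 := by
  have ha := alpha_pos n
  have hN := mul_alpha n
  have hpi := Real.pi_pos
  have hnR : (1 : ℝ) ≤ n := by exact_mod_cast hn
  have h1 : ∑ m ∈ Finset.Icc 2 n, 1 / Real.sin (m * alpha n) ^ 2 ≤
      ∑ m ∈ Finset.Icc 2 n, (1 + (1 / alpha n ^ 2) * (1 / (m : ℝ) ^ 2)) := by
    refine Finset.sum_le_sum fun m hm => ?_
    rw [Finset.mem_Icc] at hm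
    have hm2 : (2 : ℝ) ≤ m := by exact_mod_cast hm.1
    have hmn : (m : ℝ) ≤ n := by exact_mod_cast hm.2
    refine (one_div_sin_sq_lt (by positivity) ?_).le.trans (le_of_eq ?_)
    · rw [← hN]; nlinarith
    · rw [mul_pow]; field_simp
  rw [Finset.sum_add_distrib, ← Finset.mul_sum] at h1
  have hcard : ∑ _m ∈ Finset.Icc 2 n, (1 : ℝ) = n - 1 := by
    rw [Finset.sum_const, Nat.card_Icc, nsmul_eq_mul, Nat.cast_sub (by omega)]; push_cast; ring
  rw [hcard] at h1
  have h2 : 1 / alpha n ^ 2 < 1 / Real.sin (alpha n) ^ 2 := by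
    have hs : 0 < Real.sin (alpha n) := by
      simpa using sin_pos_of_lt (n := n) (k := 1) le_rfl (by omega)
    have := Real.sin_lt ha
    gcongr
  have h3 := sum_one_div_sq_le n hn
  have h4 : (1 / alpha n ^ 2) * ∑ m ∈ Finset.Icc 2 n, (1 : ℝ) / (m : ℝ) ^ 2 ≤
      (1 / alpha n ^ 2) * (2 / 3 - 2 / (2 * n + 1)) := by gcongr
  have h5 : 1 / alpha n ^ 2 = (2 * n + 1) ^ 2 / Real.pi ^ 2 := by
    unfold alpha; field_simp
  have h6 : ((2 * n + 1) ^ 2 : ℝ) / 10 ≤ (2 * n + 1) ^ 2 / Real.pi ^ 2 := by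
    have : Real.pi < 3.15 := Real.pi_lt_d2
    gcongr
    nlinarith
  -- With π² < 10 this becomes a quadratic inequality in n.
  have h7 : (n - 1 : ℝ) ≤ (1 / alpha n ^ 2) * (1 / 3 + 2 / (2 * n + 1)) := by
    rw [h5]
    calc (n - 1 : ℝ) ≤ (2 * n + 1) ^ 2 / 10 * (1 / 3 + 2 / (2 * n + 1)) := by
          have : ((2 * n + 1) ^ 2 / 10 * (1 / 3 + 2 / (2 * n + 1)) : ℝ) =
            (2 * n + 1) ^ 2 / 30 + (2 * n + 1) / 5 := by field_simp; ring
          rw [this]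
          nlinarith [sq_nonneg ((n : ℝ) - 2)]
      _ ≤ _ := by gcongr
  nlinarith

/-- The representative of `± m` modulo `2n+1` in `[0, n]`. -/
def absMod (n m : ℕ) : ℕ := min (m % (2 * n + 1)) ((2 * n + 1) - m % (2 * n + 1))

theorem sin_sq_absMod (n m : ℕ) :
    Real.sin (absMod n m * alpha n) ^ 2 = Real.sin (m * alpha n) ^ 2 := by
  have h := Nat.div_add_mod m (2 * n + 1)
  set q := m / (2 * n + 1)
  set r := m % (2 * n + 1) with hr
  have hlt : r < 2 * n + 1 := Nat.mod_lt _ (by omega)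
  have h1 : Real.sin (r * alpha n) ^ 2 = Real.sin (m * alpha n) ^ 2 := by
    have : (m * alpha n : ℝ) = r * alpha n + q * Real.pi := by
      rw [← mul_alpha n, ← h]; push_cast; ring
    rw [this, Real.sin_add_nat_mul_pi, mul_pow]
    simp [← pow_mul]
  rw [← h1]
  unfold absMod
  rcases min_cases r (2 * n + 1 - r) with ⟨h2, -⟩ | ⟨h2, -⟩ <;> rw [← hr, h2]
  have : ((2 * n + 1 - r : ℕ) * alpha n : ℝ) = Real.pi - r * alpha n := by
    rw [Nat.cast_sub hlt.le, ← mul_alpha n]; push_cast; ring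
  rw [this, Real.sin_pi_sub]

theorem absMod_le (n m : ℕ) : absMod n m ≤ n := by
  unfold absMod; omega

theorem absMod_eq_or (n m : ℕ) :
    absMod n m ≡ m [MOD 2 * n + 1] ∨ absMod n m + m ≡ 0 [MOD 2 * n + 1] := by
  have hlt : m % (2 * n + 1) < 2 * n + 1 := Nat.mod_lt _ (by omega)
  unfold absMod
  rcases min_cases (m % (2 * n + 1)) (2 * n + 1 - m % (2 * n + 1)) with ⟨h, -⟩ | ⟨h, -⟩ <;> rw [h]
  · exact Or.inl (Nat.mod_modEq _ _)
  · right
    have : 2 * n + 1 - m % (2 * n + 1) + m ≡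
        2 * n + 1 - m % (2 * n + 1) + m % (2 * n + 1) [MOD 2 * n + 1] :=
      Nat.ModEq.add_left _ (Nat.mod_modEq _ _).symm
    refine this.trans ?_
    rw [Nat.sub_add_cancel hlt.le]
    simp [Nat.ModEq]

/-- The natural numbers in `[1, n]` which are coprime to `2n+1`. -/
def coprimeIcc (n : ℕ) : Finset ℕ := (Finset.Icc 1 n).filter fun k => Nat.gcd k (2 * n + 1) = 1

theorem mem_coprimeIcc {n k : ℕ} :
    k ∈ coprimeIcc n ↔ 1 ≤ k ∧ k ≤ n ∧ Nat.gcd k (2 * n + 1) = 1 := by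
  simp [coprimeIcc, and_assoc]

/-- The involution k ↦ 2n+1-k pairs the units up to n with those above n. -/
theorem totient_eq_two_mul_card (n : ℕ) (hn : 1 ≤ n) :
    Nat.totient (2 * n + 1) = 2 * (coprimeIcc n).card := by
  classical
  rw [Nat.totient_eq_card_coprime]
  have h : (Finset.range (2 * n + 1)).filter (Nat.Coprime (2 * n + 1)) =
      coprimeIcc n ∪ (coprimeIcc n).image fun k => 2 * n + 1 - k := by
    ext k
    simp only [Finset.mem_filter, Finset.mem_range, Finset.mem_union, Finset.mem_image,
      mem_coprimeIcc]
    constructor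
    · rintro ⟨h1, h2⟩
      have h0 : k ≠ 0 := by
        rintro rfl
        simp at h2; omega
      by_cases hk : k ≤ n
      · exact Or.inl ⟨by omega, hk, h2.symm⟩
      · refine Or.inr ⟨2 * n + 1 - k, ⟨by omega, by omega, ?_⟩, by omega⟩
        exact (Nat.coprime_self_sub_left h1.le).2 h2.symm
    · rintro (⟨h1, h2, h3⟩ | ⟨m, ⟨h1, h2, h3⟩, rfl⟩)
      · exact ⟨by omega, Nat.Coprime.symm h3⟩
      · refine ⟨by omega, Nat.Coprime.symm ?_⟩
        exact (Nat.coprime_self_sub_left (by omega)).2 h3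
  rw [h, Finset.card_union_of_disjoint, Finset.card_image_of_injOn, two_mul]
  · intro a ha b hb hab
    have ha := mem_coprimeIcc.1 ha
    have hb := mem_coprimeIcc.1 hb
    simp only at hab
    omega
  · rw [Finset.disjoint_left]
    intro a ha hb
    obtain ⟨b, hb', rfl⟩ := Finset.mem_image.1 hb
    have ha := mem_coprimeIcc.1 ha
    have hb := mem_coprimeIcc.1 hb'
    omega

theorem absMod_mul_mem {n j k : ℕ} (hj : Nat.Coprime j (2 * n + 1)) (hk : k ∈ coprimeIcc n) :
    absMod n (j * k) ∈ coprimeIcc n := by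
  obtain ⟨hk1, hkn, hk⟩ := mem_coprimeIcc.1 hk
  have h1 : Nat.Coprime (j * k) (2 * n + 1) := Nat.Coprime.mul_left hj hk
  have h3 : Nat.gcd (absMod n (j * k)) (2 * n + 1) = 1 := by
    have hlt : (j * k) % (2 * n + 1) < 2 * n + 1 := Nat.mod_lt _ (by omega)
    have h4 : Nat.Coprime ((j * k) % (2 * n + 1)) (2 * n + 1) := by
      rw [Nat.Coprime, ← Nat.gcd_rec, Nat.gcd_comm]; exact h1
    unfold absMod
    rcases min_cases (j * k % (2 * n + 1)) (2 * n + 1 - j * k % (2 * n + 1)) with ⟨h, -⟩ | ⟨h, -⟩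
      <;> rw [h]
    · exact h4
    · exact (Nat.coprime_self_sub_left hlt.le).2 h4
  refine mem_coprimeIcc.2 ⟨?_, absMod_le _ _, h3⟩
  by_contra h0
  have h0 : absMod n (j * k) = 0 := by omega
  rw [h0] at h3
  simp at h3
  omega

/-- Equal values force 2n+1 to divide k - l or k + l; both are smaller than 2n+1 in absolute value,
and k + l is positive, so k = l. -/
theorem absMod_mul_injOn {n j : ℕ} (hj : Nat.Coprime j (2 * n + 1)) :
    Set.InjOn (fun k => absMod n (j * k)) (coprimeIcc n : Set ℕ) := by
  intro k hk l hl hkl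
  obtain ⟨hk1, hkn, hk⟩ := mem_coprimeIcc.1 hk
  obtain ⟨hl1, hln, hl⟩ := mem_coprimeIcc.1 hl
  simp only at hkl
  have hj' : IsCoprime ((2 * n + 1 : ℕ) : ℤ) (j : ℤ) :=
    (Nat.isCoprime_iff_coprime.2 hj).symm
  have key : ((2 * n + 1 : ℕ) : ℤ) ∣ (j : ℤ) * (k - l) ∨ ((2 * n + 1 : ℕ) : ℤ) ∣ (j : ℤ) * (k + l) := by
    have e1 := absMod_eq_or n (j * k)
    have e2 := absMod_eq_or n (j * l)
    rw [hkl] at e1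
    simp only [← Int.natCast_modEq_iff, Int.modEq_iff_dvd] at e1 e2
    push_cast at e1 e2 ⊢
    rcases e1 with ⟨a, ha⟩ | ⟨a, ha⟩ <;> rcases e2 with ⟨b, hb⟩ | ⟨b, hb⟩
    · exact Or.inl ⟨a - b, by linear_combination ha - hb⟩
    · exact Or.inr ⟨a - b, by linear_combination ha - hb⟩
    · exact Or.inr ⟨b - a, by linear_combination hb - ha⟩
    · exact Or.inl ⟨b - a, by linear_combination hb - ha⟩
  rcases key with h | h
  · have := Int.eq_zero_of_abs_lt_dvd (hj'.dvd_of_dvd_mul_left h) (by rw [abs_lt]; omega)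
    omega
  · have := Int.eq_zero_of_abs_lt_dvd (hj'.dvd_of_dvd_mul_left h) (by rw [abs_lt]; omega)
    omega

/-- The numbers `1 / sin² (kα)` are linearly independent, because the matrix of their conjugates
is diagonally dominant after a permutation. -/
theorem linearIndependent_one_div_sin_sq (n : ℕ) (hn : 1 ≤ n) {c : ℝ} (hc : c ≠ 0) :
    LinearIndependent ℤ fun k : coprimeIcc n => c / Real.sin ((k : ℕ) * alpha n) ^ 2 := by
  rw [Fintype.linearIndependent_iff]
  intro g hg
  by_contra! hne
  obtain ⟨i₀, hi₀⟩ := hne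
  obtain ⟨l, -, hl⟩ := Finset.exists_max_image Finset.univ (fun i => |g i|) ⟨i₀, Finset.mem_univ _⟩
  have hgl : 0 < |(g l : ℝ)| := by
    have := hl i₀ (Finset.mem_univ _)
    have h2 := abs_pos.2 hi₀
    have h3 : 0 < |g l| := by omega
    exact_mod_cast h3
  let G : ℕ → ℤ := fun k => if hk : k ∈ coprimeIcc n then g ⟨k, hk⟩ else 0
  have hG : ∀ k : coprimeIcc n, G k = g k := fun k => by simp [G]
  have hsum : ∑ k ∈ coprimeIcc n, (G k : ℝ) / Real.sin (k * alpha n) ^ 2 = 0 := by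
    rw [← Finset.sum_coe_sort]
    have h1 : c * ∑ i : coprimeIcc n, (G i : ℝ) / Real.sin ((i : ℕ) * alpha n) ^ 2 = 0 := by
      rw [← hg, Finset.mul_sum]
      refine Finset.sum_congr rfl fun i _ => ?_
      rw [hG, zsmul_eq_mul]; ring
    exact (mul_eq_zero.1 h1).resolve_left hc
  obtain ⟨hl1, hln, hlc⟩ := mem_coprimeIcc.1 l.2
  -- Conjugating by the inverse j of l moves the coefficient of largest absolute value to 1/sin² α.
  -- All other indices are sent injectively into [2, n].
  obtain ⟨j, -, hj⟩ := Nat.exists_mul_mod_eq_one_of_coprime hlc (by omega)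
  have hjc : Nat.Coprime j (2 * n + 1) := by
    have h1 : Nat.Coprime ((l : ℕ) * j) (2 * n + 1) := by
      rw [Nat.Coprime, Nat.gcd_comm, Nat.gcd_rec, hj]; simp
    exact Nat.Coprime.coprime_mul_left h1
  have hconj := sum_div_sin_sq_conj _ _ hjc hsum
  have hjl : absMod n (j * l) = 1 := by
    unfold absMod
    rw [mul_comm, hj]; omega
  have hs : ∀ k, Real.sin ((j * k : ℕ) * alpha n) ^ 2 =
    Real.sin (absMod n (j * k) * alpha n) ^ 2 := fun k => (sin_sq_absMod n _).symm
  simp only [hs] at hconj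
  rw [← Finset.add_sum_erase _ _ l.2, hjl] at hconj
  have hmem : ∀ k ∈ (coprimeIcc n).erase l, absMod n (j * k) ∈ Finset.Icc 2 n := by
    intro k hk
    rw [Finset.mem_erase] at hk
    have h1 := mem_coprimeIcc.1 (absMod_mul_mem hjc hk.2)
    have h2 : absMod n (j * k) ≠ 1 := fun h =>
      hk.1 (absMod_mul_injOn hjc hk.2 l.2 (h.trans hjl.symm))
    rw [Finset.mem_Icc]
    omega
  have hbound : |∑ k ∈ (coprimeIcc n).erase l,
      (G k : ℝ) / Real.sin (absMod n (j * k) * alpha n) ^ 2| ≤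
      |(g l : ℝ)| * ∑ m ∈ Finset.Icc 2 n, 1 / Real.sin (m * alpha n) ^ 2 := by
    refine (Finset.abs_sum_le_sum_abs _ _).trans ?_
    have h1 : ∀ k ∈ (coprimeIcc n).erase l,
        |(G k : ℝ) / Real.sin (absMod n (j * k) * alpha n) ^ 2| ≤
          |(g l : ℝ)| * (1 / Real.sin (absMod n (j * k) * alpha n) ^ 2) := by
      intro k hk
      have hk' := (Finset.mem_erase.1 hk).2
      rw [abs_div, div_eq_mul_one_div, abs_of_nonneg (sq_nonneg (Real.sin _))]
      refine mul_le_mul_of_nonneg_right ?_ (by positivity)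
      have := hl ⟨k, hk'⟩ (Finset.mem_univ _)
      rw [← hG ⟨k, hk'⟩] at this
      exact_mod_cast this
    refine (Finset.sum_le_sum h1).trans ?_
    rw [← Finset.mul_sum]
    gcongr
    rw [← Finset.sum_image (s := (coprimeIcc n).erase l) (g := fun k => absMod n (j * k))
      (f := fun m : ℕ => 1 / Real.sin (m * alpha n) ^ 2)
      ((absMod_mul_injOn hjc).mono (by simp))]
    refine Finset.sum_le_sum_of_subset_of_nonneg ?_ fun _ _ _ => by positivity
    intro m hm
    obtain ⟨k, hk, rfl⟩ := Finset.mem_image.1 hm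
    exact hmem k hk
  have hlt := mul_lt_mul_of_pos_left (sum_one_div_sin_sq_lt n hn) hgl
  have heq : |(g l : ℝ)| * (1 / Real.sin (alpha n) ^ 2) =
      |∑ k ∈ (coprimeIcc n).erase l,
        (G k : ℝ) / Real.sin (absMod n (j * k) * alpha n) ^ 2| := by
    rw [← neg_eq_iff_add_eq_zero.2 hconj, abs_neg, hG, abs_div,
      abs_of_nonneg (sq_nonneg (Real.sin _))]
    simp [div_eq_mul_inv]
  linarith

theorem finrank_latticeR (n : ℕ) (hn : 1 ≤ n) {d : ℝ} (hd : d ≠ 0) :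
    Module.finrank ℤ (latticeR n d) = Nat.totient (2 * n + 1) / 2 := by
  have h1 := sin_pos_of_lt (n := n) (k := 1) le_rfl (by omega)
  have h2 := sin_pos_of_lt (n := n) (k := n) hn (by omega)
  rw [Nat.cast_one, one_mul] at h1
  have hli := linearIndependent_one_div_sin_sq n hn
    (mul_ne_zero hd (mul_ne_zero h1.ne' h2.ne'))
  have hspan : latticeR n d = Submodule.span ℤ (Set.range fun k : coprimeIcc n =>
      d * (Real.sin (alpha n) * Real.sin (n * alpha n)) / Real.sin ((k : ℕ) * alpha n) ^ 2) := by
    unfold latticeR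
    congr 1
    ext x
    constructor
    · rintro ⟨k, hk1, hkn, hk, rfl⟩
      exact ⟨⟨k, mem_coprimeIcc.2 ⟨hk1, hkn, hk⟩⟩, mul_div_assoc _ _ _⟩
    · rintro ⟨⟨k, hk⟩, rfl⟩
      obtain ⟨hk1, hkn, hk⟩ := mem_coprimeIcc.1 hk
      exact ⟨k, hk1, hkn, hk, mul_div_assoc _ _ _⟩
  rw [hspan, finrank_span_eq_card hli, totient_eq_two_mul_card n hn]
  simp

/-- All lattices between `R` and `ℤ[2 cos α] d` have the same rank. -/
theorem finrank_of_latticeR_le (n : ℕ) (hn : 1 ≤ n) {d : ℝ} (hd : d ≠ 0) {M : Submodule ℤ ℝ}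
    (h1 : latticeR n d ≤ M) (h2 : M ≤ cosLattice n d) :
    Module.finrank ℤ M = Nat.totient (2 * n + 1) / 2 := by
  have := finite_cosLattice n d
  have : Module.Finite ℤ M := Module.Finite.of_injective (Submodule.inclusion h2)
    (Submodule.inclusion_injective h2)
  refine le_antisymm ((Submodule.finrank_mono h2).trans (finrank_cosLattice_le n hn d)) ?_
  rw [← finrank_latticeR n hn hd]
  exact Submodule.finrank_mono h1

end Rank

/-! ### Linear algebra in the Euclidean plane -/

section Plane

theorem plane_inner_eq (x y : Plane) : inner ℝ x y = x 0 * y 0 + x 1 * y 1 := by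
  simp [PiLp.inner_apply, Fin.sum_univ_two, mul_comm]

theorem plane_ext {x y : Plane} (h0 : x 0 = y 0) (h1 : x 1 = y 1) : x = y := by
  ext i; fin_cases i <;> assumption

theorem norm_sq_plane (w : Plane) : ‖w‖ ^ 2 = w 0 * w 0 + w 1 * w 1 := by
  rw [← real_inner_self_eq_norm_sq, plane_inner_eq]

/-- The length of a vector in the plane in terms of its inner products with two vectors. -/
theorem norm_sq_mul_gram (a b w : Plane) :
    ‖w‖ ^ 2 * (inner ℝ a a * inner ℝ b b - inner ℝ a b ^ 2) =
      inner ℝ b b * inner ℝ a w ^ 2 - 2 * inner ℝ a b * inner ℝ a w * inner ℝ b w +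
        inner ℝ a a * inner ℝ b w ^ 2 := by
  simp only [norm_sq_plane, plane_inner_eq]
  ring

theorem exists_eq_smul_of_inner_eq_zero {a b w : Plane} (ha : a ≠ 0) (hw : w ≠ 0)
    (h1 : inner ℝ a w = 0) (h2 : inner ℝ b w = 0) : ∃ c : ℝ, b = c • a := by
  have haa : a 0 * a 0 + a 1 * a 1 ≠ 0 := by
    rw [← plane_inner_eq]; exact inner_self_ne_zero.2 ha
  have hww : w 0 * w 0 + w 1 * w 1 ≠ 0 := by
    rw [← plane_inner_eq]; exact inner_self_ne_zero.2 hw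
  rw [plane_inner_eq] at h1 h2
  have hdet : a 0 * b 1 - a 1 * b 0 = 0 := by
    refine (mul_eq_zero.1 ?_).resolve_right hww
    linear_combination (w 0 * b 1 - w 1 * b 0) * h1 + (a 0 * w 1 - a 1 * w 0) * h2
  refine ⟨(a 0 * b 0 + a 1 * b 1) / (a 0 * a 0 + a 1 * a 1), plane_ext ?_ ?_⟩ <;>
    rw [PiLp.smul_apply, smul_eq_mul, div_mul_eq_mul_div, eq_div_iff haa]
  · linear_combination -a 1 * hdet
  · linear_combination a 0 * hdet

theorem exists_inner_eq {a b : Plane} (h : inner ℝ a a * inner ℝ b b - inner ℝ a b ^ 2 ≠ 0)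
    (x y : ℝ) : ∃ w : Plane, inner ℝ a w = x ∧ inner ℝ b w = y := by
  have hdet : a 0 * b 1 - a 1 * b 0 ≠ 0 := by
    intro h0
    apply h
    simp only [plane_inner_eq]
    linear_combination (a 0 * b 1 - a 1 * b 0) * h0
  refine ⟨!₂[(x * b 1 - y * a 1) / (a 0 * b 1 - a 1 * b 0),
    (y * a 0 - x * b 0) / (a 0 * b 1 - a 1 * b 0)], ?_, ?_⟩ <;>
  · simp only [plane_inner_eq, Matrix.cons_val_zero, Matrix.cons_val_one]
    rw [mul_div_assoc', mul_div_assoc', ← add_div, div_eq_iff hdet]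
    ring

end Plane

/-! ### Affine functions along the ray towards the reference point -/

section AffineFunctions

theorem eval_add (f g : AffFun) (x : Plane) : (f + g).eval x = f.eval x + g.eval x := by
  simp only [AffFun.eval, Prod.fst_add, Prod.snd_add, inner_add_left]; ring

theorem eval_smul (c : ℝ) (f : AffFun) (x : Plane) : AffFun.eval (c • f) x = c * f.eval x := by
  simp only [AffFun.eval, Prod.smul_fst, Prod.smul_snd, real_inner_smul_left, smul_eq_mul]; ring

theorem eval_neg (f : AffFun) (x : Plane) : (-f).eval x = -f.eval x := by
  rw [← neg_one_smul ℝ, eval_smul]; ring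

theorem eval_sub_eval (f : AffFun) (x y : Plane) :
    f.eval x - f.eval y = inner ℝ f.1 (x - y) := by
  simp only [AffFun.eval, inner_sub_right]; ring

theorem eval_lineMap (f : AffFun) (p q : Plane) (s : ℝ) :
    f.eval (AffineMap.lineMap p q s) = f.eval p + s * (f.eval q - f.eval p) := by
  simp only [AffFun.eval, AffineMap.lineMap_apply, vsub_eq_sub, vadd_eq_add, inner_add_right,
    real_inner_smul_right, inner_sub_right]
  ring

theorem isPositive_of_slope_neg {f : AffFun} {p q : Plane} (h : f.eval q < f.eval p) :
    IsPositive p q f := by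
  unfold IsPositive
  filter_upwards [eventually_gt_atTop (f.eval p / (f.eval p - f.eval q))] with s hs
  rw [eval_lineMap]
  have := (div_lt_iff₀ (by linarith)).1 hs
  linarith

theorem isPositive_of_le {f : AffFun} {p q : Plane} (h : f.eval q ≤ f.eval p)
    (hp : f.eval p < 0) : IsPositive p q f := by
  unfold IsPositive
  filter_upwards [eventually_ge_atTop 0] with s hs
  rw [eval_lineMap]
  nlinarith

/-- On a ray an affine function is eventually negative, eventually positive, or identically zero;
only the last case is left. -/
theorem eval_eq_zero_of_not_isPositive {f : AffFun} {p q : Plane} (h1 : ¬ IsPositive p q f)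
    (h2 : ¬ IsPositive p q (-f)) : f.eval p = 0 ∧ f.eval q = 0 := by
  have e1 : f.eval p ≤ f.eval q := not_lt.1 fun h => h1 (isPositive_of_slope_neg h)
  have e2 : f.eval q ≤ f.eval p := not_lt.1 fun h => h2 (isPositive_of_slope_neg (by
    rw [eval_neg, eval_neg]; linarith))
  have e3 : 0 ≤ f.eval p := not_lt.1 fun h => h1 (isPositive_of_le e2 h)
  have e4 : f.eval p ≤ 0 := not_lt.1 fun h => h2 (isPositive_of_le (by
    rw [eval_neg, eval_neg]; linarith) (by rw [eval_neg]; linarith))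
  constructor <;> linarith

theorem IsPositive.not_neg {f : AffFun} {p q : Plane} (h : IsPositive p q f) :
    ¬ IsPositive p q (-f) := by
  intro h'
  obtain ⟨s, h1, h2⟩ := (h.and h').exists
  rw [eval_neg] at h2
  linarith

/-- Two affine functions which vanish at two distinct points are proportional. -/
theorem exists_eq_smul_of_eval_eq_zero {f g : AffFun} {p q : Plane} (hpq : p ≠ q) (hf : f.1 ≠ 0)
    (hfp : f.eval p = 0) (hfq : f.eval q = 0) (hgp : g.eval p = 0) (hgq : g.eval q = 0) :
    ∃ c : ℝ, g = c • f := by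
  obtain ⟨c, hc⟩ := exists_eq_smul_of_inner_eq_zero hf (sub_ne_zero.2 hpq)
    (by rw [← eval_sub_eval, hfp, hfq, sub_zero]) (by rw [← eval_sub_eval, hgp, hgq, sub_zero])
  refine ⟨c, Prod.ext hc ?_⟩
  simp only [AffFun.eval] at hfp hgp
  rw [hc, real_inner_smul_left] at hgp
  simp only [Prod.smul_snd, smul_eq_mul]
  linear_combination hgp - c * hfp

end AffineFunctions

/-! ### The invariant kernel vector and sign coherence -/

section Coherent

/-- The linear relation between the weights of the quiver and the vectors. -/
def kernelVec (S : Seed) (i j k : Fin 3) : AffFun :=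
  S.B i j • S.v k + S.B j k • S.v i + S.B k i • S.v j

theorem Seed.B_skew (S : Seed) (i j : Fin 3) : S.B j i = -S.B i j :=
  congrFun (congrFun S.skew i) j

theorem kernelVec_rotate (S : Seed) (i j k : Fin 3) : kernelVec S j k i = kernelVec S i j k := by
  unfold kernelVec; abel

theorem kernelVec_swap (S : Seed) (i j k : Fin 3) : kernelVec S j i k = -kernelVec S i j k := by
  unfold kernelVec
  rw [S.B_skew i j, S.B_skew k i, S.B_skew j k]
  module

theorem kernelVec_eq_or (S : Seed) {i j k : Fin 3} (hij : i ≠ j) (hik : i ≠ k) (hjk : j ≠ k) :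
    kernelVec S i j k = kernelVec S 0 1 2 ∨ kernelVec S i j k = -kernelVec S 0 1 2 := by
  have h1 := kernelVec_rotate S 0 1 2
  have h2 := kernelVec_rotate S 1 2 0
  have h3 := kernelVec_swap S 0 1 2
  have h4 := kernelVec_swap S 1 2 0
  have h5 := kernelVec_swap S 2 0 1
  rw [h1] at h4 h2
  rw [h2] at h5
  fin_cases i <;> fin_cases j <;> fin_cases k <;> first
    | exact absurd rfl hij
    | exact absurd rfl hik
    | exact absurd rfl hjk
    | exact Or.inl rfl
    | exact Or.inl h1
    | exact Or.inl h2
    | exact Or.inr h3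
    | exact Or.inr h4
    | exact Or.inr h5

open Classical in
/-- The inner product prescribed by a weight and by the positivity of two vectors: it is
positive only for an arrow from a non-positive vector to a positive one. -/
def signedWeight (b : ℝ) (P Q : Prop) : ℝ :=
  if (0 < b ∧ ¬ P ∧ Q) ∨ (b < 0 ∧ P ∧ ¬ Q) then |b| else -|b|

theorem signedWeight_neg (b : ℝ) (P Q : Prop) : signedWeight (-b) P Q = signedWeight b Q P := by
  unfold signedWeight
  rw [abs_neg]
  congr 1
  apply propext
  rw [neg_pos, neg_lt_zero]
  tauto

theorem abs_signedWeight (b : ℝ) (P Q : Prop) : |signedWeight b P Q| = |b| := by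
  unfold signedWeight
  split_ifs <;> simp

/-- The two excluded sign patterns are those in which the three terms of the kernel vector all have
the same sign at the reference point. What remains is a truth table in the signs of the weights and
the positivity of the vectors. -/
theorem signedWeight_prod {x y z : ℝ} {P₀ P₁ P₂ : Prop} (hx : x ≠ 0) (hy : y ≠ 0) (hz : z ≠ 0)
    (h1 : ¬ ((0 < y ↔ P₀) ∧ (0 < z ↔ P₁) ∧ (0 < x ↔ P₂)))
    (h2 : ¬ (¬ (0 < y ↔ P₀) ∧ ¬ (0 < z ↔ P₁) ∧ ¬ (0 < x ↔ P₂))) :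
    signedWeight x P₀ P₁ * signedWeight z P₂ P₀ * signedWeight y P₁ P₂ < 0 ↔ ¬ Cyc x y z := by
  have key : ∀ {b : ℝ} {P Q : Prop}, b ≠ 0 → (0 < signedWeight b P Q ↔
      ((0 < b ∧ ¬ P ∧ Q) ∨ (b < 0 ∧ P ∧ ¬ Q))) ∧ signedWeight b P Q ≠ 0 := by
    intro b P Q hb
    have := abs_pos.2 hb
    unfold signedWeight
    split_ifs with h
    · exact ⟨⟨fun _ => h, fun _ => this⟩, this.ne'⟩
    · exact ⟨⟨fun h' => by linarith, fun h' => absurd h' h⟩, by simpa using hb⟩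
  obtain ⟨a1, a2⟩ := key (P := P₀) (Q := P₁) hx
  obtain ⟨b1, b2⟩ := key (P := P₂) (Q := P₀) hz
  obtain ⟨c1, c2⟩ := key (P := P₁) (Q := P₂) hy
  generalize signedWeight x P₀ P₁ = X at *
  generalize signedWeight z P₂ P₀ = Z at *
  generalize signedWeight y P₁ P₂ = Y at *
  have neg : ∀ {t : ℝ}, t ≠ 0 → (t < 0 ↔ ¬ 0 < t) := fun ht =>
    ⟨fun h => h.le.not_gt, fun h => lt_of_le_of_ne (not_lt.1 h) ht⟩
  have hprod : X * Z * Y < 0 ↔ ((0 < X ↔ 0 < Z) ↔ ¬ 0 < Y) := by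
    rcases lt_or_gt_of_ne a2 with h | h <;> rcases lt_or_gt_of_ne b2 with h' | h' <;>
      rcases lt_or_gt_of_ne c2 with h'' | h'' <;>
      simp [h, h', h'', h.le.not_gt, h'.le.not_gt, h''.le.not_gt, mul_neg_iff, mul_pos_iff]
  rw [hprod, a1, b1, c1, Cyc, neg hx, neg hy, neg hz]
  generalize (0 < x) = X' at h1 h2 ⊢
  generalize (0 < y) = Y' at h1 h2 ⊢
  generalize (0 < z) = Z' at h1 h2 ⊢
  clear a1 b1 c1 a2 b2 c2 hprod key neg hx hy hz
  by_cases X' <;> by_cases Y' <;> by_cases Z' <;> by_cases P₀ <;> by_cases P₁ <;>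
    by_cases P₂ <;> simp_all

/-- The inner products of the vectors of `S` are determined by the positivity of the vectors, and
the vectors satisfy the linear relation `z`. -/
structure Coherent (p q : Plane) (z : AffFun) (S : Seed) : Prop where
  ne_zero : ∀ i j, i ≠ j → S.B i j ≠ 0
  kernel : kernelVec S 0 1 2 = z ∨ kernelVec S 0 1 2 = -z
  form_eq : ∀ i j, i ≠ j →
    form (S.v i) (S.v j) =
      signedWeight (S.B i j) (IsPositive p q (S.v i)) (IsPositive p q (S.v j))

variable {p q : Plane} {z : AffFun} {S : Seed}

theorem coeff_eq_zero_of_sum_smul_v {x : Fin 3 → ℝ} (h : ∑ i, x i • S.v i = 0) (i : Fin 3) :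
    x i = 0 :=
  Fintype.linearIndependent_iff.1 S.realisation.linearIndependent x h i

theorem fst_v_ne_zero (S : Seed) (i : Fin 3) : (S.v i).1 ≠ 0 := by
  intro h
  have := S.realisation.form_self i
  simp [form, h] at this

/-- Otherwise the i-th vector vanishes on the whole line through p and q, as z does, so the kernel
vector is a multiple of it. By linear independence two weights would then be zero. -/
theorem isPositive_neg_of_not (hpq : p ≠ q) (hzp : z.eval p = 0) (hzq : z.eval q = 0)
    (hne : ∀ i j, i ≠ j → S.B i j ≠ 0) (hker : kernelVec S 0 1 2 = z ∨ kernelVec S 0 1 2 = -z)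
    (i : Fin 3) (h : ¬ IsPositive p q (S.v i)) : IsPositive p q (-S.v i) := by
  by_contra h'
  obtain ⟨hp, hq⟩ := eval_eq_zero_of_not_isPositive h h'
  obtain ⟨c, hc⟩ : ∃ c : ℝ, kernelVec S 0 1 2 = c • S.v i := by
    refine exists_eq_smul_of_eval_eq_zero hpq (fst_v_ne_zero S i) hp hq ?_ ?_ <;>
      rcases hker with e | e <;> rw [e] <;> simp [eval_neg, hzp, hzq]
  have h0 := coeff_eq_zero_of_sum_smul_v (S := S)
    (x := fun j => ![S.B 1 2, S.B 2 0, S.B 0 1] j - if j = i then c else 0) (by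
      simp only [sub_smul, Finset.sum_sub_distrib, ite_smul, zero_smul, Finset.sum_ite_eq',
        Finset.mem_univ, if_true, Fin.sum_univ_three]
      rw [← hc]
      simp [kernelVec]
      abel)
  have h1 := h0 (i + 1)
  fin_cases i <;> simp at h1
  · exact hne 2 0 (by decide) h1
  · exact hne 0 1 (by decide) h1
  · exact hne 1 2 (by decide) h1

theorem eventually_mul_neg {f : AffFun} {c : ℝ} (hc : c ≠ 0)
    (hf : ¬ IsPositive p q f → IsPositive p q (-f)) (h : 0 < c ↔ IsPositive p q f) :
    ∀ᶠ s : ℝ in atTop, c * f.eval (AffineMap.lineMap p q s) < 0 := by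
  by_cases hp : 0 < c
  · filter_upwards [h.1 hp] with s hs
    exact mul_neg_of_pos_of_neg hp hs
  · have hc' : c < 0 := lt_of_le_of_ne (not_lt.1 hp) hc
    filter_upwards [hf (mt h.2 hp)] with s hs
    rw [eval_neg] at hs
    nlinarith

/-- Along the line the three terms of the kernel vector add up to zero, while each has a strict sign
far out. Hence they are neither all negative nor all positive there. -/
theorem kernel_signs (hpq : p ≠ q) (hzp : z.eval p = 0) (hzq : z.eval q = 0)
    (hne : ∀ i j, i ≠ j → S.B i j ≠ 0) (hker : kernelVec S 0 1 2 = z ∨ kernelVec S 0 1 2 = -z) :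
    ¬ ((0 < S.B 1 2 ↔ IsPositive p q (S.v 0)) ∧ (0 < S.B 2 0 ↔ IsPositive p q (S.v 1)) ∧
        (0 < S.B 0 1 ↔ IsPositive p q (S.v 2))) ∧
    ¬ (¬ (0 < S.B 1 2 ↔ IsPositive p q (S.v 0)) ∧ ¬ (0 < S.B 2 0 ↔ IsPositive p q (S.v 1)) ∧
        ¬ (0 < S.B 0 1 ↔ IsPositive p q (S.v 2))) := by
  have hneg := isPositive_neg_of_not hpq hzp hzq hne hker
  have h0 : ∀ s : ℝ, (kernelVec S 0 1 2).eval (AffineMap.lineMap p q s) = 0 := by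
    intro s
    rw [eval_lineMap]
    rcases hker with e | e <;> rw [e] <;> simp [eval_neg, hzp, hzq]
  have h1 : ∀ s : ℝ, S.B 1 2 * (S.v 0).eval (AffineMap.lineMap p q s) +
      S.B 2 0 * (S.v 1).eval (AffineMap.lineMap p q s) +
      S.B 0 1 * (S.v 2).eval (AffineMap.lineMap p q s) = 0 := by
    intro s
    have := h0 s
    rw [kernelVec, eval_add, eval_add, eval_smul, eval_smul, eval_smul] at this
    linarith
  have flip : ∀ {c : ℝ} {P : Prop}, c ≠ 0 → ¬ (0 < c ↔ P) → (0 < -c ↔ P) := by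
    intro c P hc h
    rw [neg_pos]
    have : c < 0 ↔ ¬ 0 < c := ⟨fun h => h.le.not_gt, fun h => lt_of_le_of_ne (not_lt.1 h) hc⟩
    tauto
  have n12 := hne 1 2 (by decide)
  have n20 := hne 2 0 (by decide)
  have n01 := hne 0 1 (by decide)
  constructor
  · rintro ⟨a, b, c⟩
    obtain ⟨s, h2, h3, h4⟩ := ((eventually_mul_neg n12 (hneg 0) a).and
      ((eventually_mul_neg n20 (hneg 1) b).and (eventually_mul_neg n01 (hneg 2) c))).exists
    linarith [h1 s]
  · rintro ⟨a, b, c⟩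
    obtain ⟨s, h2, h3, h4⟩ := ((eventually_mul_neg (neg_ne_zero.2 n12) (hneg 0) (flip n12 a)).and
      ((eventually_mul_neg (neg_ne_zero.2 n20) (hneg 1) (flip n20 b)).and
        (eventually_mul_neg (neg_ne_zero.2 n01) (hneg 2) (flip n01 c)))).exists
    linarith [h1 s]

theorem eq_of_abs_eq_of_mul_neg_iff {x y c : ℝ} (h : |x| = |y|) (hx : x ≠ 0) (hc : c ≠ 0)
    (h' : x * c < 0 ↔ y * c < 0) : x = y := by
  rcases abs_eq_abs.1 h with e | e
  · exact e
  · exfalso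
    have hy : y ≠ 0 := by rintro rfl; simp at e; exact hx e
    have hyc := mul_ne_zero hy hc
    rw [e] at h'
    rcases lt_or_gt_of_ne hyc with h1 | h1
    · have := h'.2 h1; nlinarith
    · have := h'.1 (by nlinarith); linarith

/-- The sign of the third inner product follows from the signs of the two others. -/
theorem Coherent.of_form_eq (hpq : p ≠ q) (hzp : z.eval p = 0) (hzq : z.eval q = 0)
    (hne : ∀ i j, i ≠ j → S.B i j ≠ 0) (hker : kernelVec S 0 1 2 = z ∨ kernelVec S 0 1 2 = -z)
    (k : Fin 3) (h : ∀ i, i ≠ k → form (S.v i) (S.v k) =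
      signedWeight (S.B i k) (IsPositive p q (S.v i)) (IsPositive p q (S.v k))) :
    Coherent p q z S := by
  refine ⟨hne, hker, ?_⟩
  obtain ⟨s1, s2⟩ := kernel_signs hpq hzp hzq hne hker
  have hprod := signedWeight_prod (hne 0 1 (by decide)) (hne 1 2 (by decide))
    (hne 2 0 (by decide)) s1 s2
  have hpar := (parity_iff S.skew).1 S.realisation.parity
  have habs : ∀ i j, i ≠ j → |form (S.v i) (S.v j)| =
      |signedWeight (S.B i j) (IsPositive p q (S.v i)) (IsPositive p q (S.v j))| :=
    fun i j hij => by rw [abs_signedWeight, S.realisation.abs_form i j hij]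
  have hf0 : ∀ i j, i ≠ j → form (S.v i) (S.v j) ≠ 0 := fun i j hij => by
    rw [← abs_pos, S.realisation.abs_form i j hij, abs_pos]; exact hne i j hij
  have symm : ∀ i j, signedWeight (S.B i j) (IsPositive p q (S.v i)) (IsPositive p q (S.v j)) =
      signedWeight (S.B j i) (IsPositive p q (S.v j)) (IsPositive p q (S.v i)) := fun i j => by
    rw [S.B_skew i j, signedWeight_neg]
  have comm := fun i j => form_comm (S.v i) (S.v j)
  have f01 := hf0 0 1 (by decide)
  have f02 := hf0 0 2 (by decide)
  have f12 := hf0 1 2 (by decide)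
  -- Parity in the seed and `signedWeight_prod` say that the product of the three inner products and
  -- the product of the three prescribed values have the same sign. Two of the factors agree, and
  -- the absolute values agree, so the third factors agree too.
  have hpar' := hpar (mul_ne_zero (mul_ne_zero f01 f02) f12)
  rw [← hprod, symm 2 0] at hpar'
  have main : form (S.v 0) (S.v 1) =
      signedWeight (S.B 0 1) (IsPositive p q (S.v 0)) (IsPositive p q (S.v 1)) ∧
    form (S.v 0) (S.v 2) =
      signedWeight (S.B 0 2) (IsPositive p q (S.v 0)) (IsPositive p q (S.v 2)) ∧
    form (S.v 1) (S.v 2) =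
      signedWeight (S.B 1 2) (IsPositive p q (S.v 1)) (IsPositive p q (S.v 2)) := by
    have hk : k = 0 ∨ k = 1 ∨ k = 2 := by fin_cases k <;> simp
    have a01 := habs 0 1 (by decide)
    have a02 := habs 0 2 (by decide)
    have a12 := habs 1 2 (by decide)
    rcases hk with rfl | rfl | rfl
    · have e1 := h 1 (by decide)
      have e2 := h 2 (by decide)
      rw [comm, symm] at e1 e2
      rw [← e1, ← e2] at hpar'
      refine ⟨e1, e2, eq_of_abs_eq_of_mul_neg_iff a12 f12 (mul_ne_zero f01 f02) ?_⟩
      rw [mul_comm, hpar', mul_comm]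
    · have e1 := h 0 (by decide)
      have e2 := h 2 (by decide)
      rw [comm, symm] at e2
      rw [← e1, ← e2, mul_right_comm] at hpar'
      refine ⟨e1, eq_of_abs_eq_of_mul_neg_iff a02 f02 (mul_ne_zero f01 f12) ?_, e2⟩
      rw [mul_comm, hpar', ← mul_assoc, mul_comm (signedWeight _ _ _)]
    · have e1 := h 0 (by decide)
      have e2 := h 1 (by decide)
      rw [← e1, ← e2, mul_assoc, mul_assoc] at hpar'
      exact ⟨eq_of_abs_eq_of_mul_neg_iff a01 f01 (mul_ne_zero f02 f12) hpar', e1, e2⟩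
  obtain ⟨m1, m2, m3⟩ := main
  intro i j hij
  fin_cases i <;> fin_cases j <;> first
    | exact absurd rfl hij
    | assumption
    | (rw [comm, symm]; assumption)

theorem signedWeight_of_move {b : ℝ} {P Q : Prop} (h : (Q ∧ b < 0) ∨ (¬ Q ∧ 0 < b)) :
    signedWeight b P Q = -|b| := by
  unfold signedWeight
  rw [if_neg]
  rintro (⟨h1, -, h2⟩ | ⟨h1, -, h2⟩)
  · rcases h with ⟨-, h⟩ | ⟨h, -⟩
    · linarith
    · exact h h2
  · rcases h with ⟨h, -⟩ | ⟨-, h⟩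
    · exact h2 h
    · linarith

theorem signedWeight_neg_of_not_move {b : ℝ} {P Q : Prop} (hb : b ≠ 0)
    (h : ¬ ((Q ∧ b < 0) ∨ (¬ Q ∧ 0 < b))) :
    signedWeight (-b) P (¬ Q) = -signedWeight b P Q := by
  unfold signedWeight
  simp only [abs_neg, neg_pos, neg_lt_zero]
  rcases lt_or_gt_of_ne hb with hb | hb <;> by_cases hP : P <;> by_cases hQ : Q <;>
    simp [hb, hb.le.not_gt, hP, hQ] at h ⊢

/-- The mutation of the vectors of a coherent seed. -/
theorem Coherent.mutate_v (hS : Coherent p q z S) (k : Fin 3) :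
    ∃ c : Fin 3 → ℝ, c k = 2 ∧ (∀ i, (S.mutate (IsPositive p q) k).v i = S.v i - c i • S.v k) ∧
      ∀ i, i ≠ k →
        (((IsPositive p q (S.v k) ∧ S.B i k < 0) ∨ (¬ IsPositive p q (S.v k) ∧ 0 < S.B i k)) ∧
            c i = form (S.v i) (S.v k) ∧ c i = -|S.B i k|) ∨
        (¬ ((IsPositive p q (S.v k) ∧ S.B i k < 0) ∨ (¬ IsPositive p q (S.v k) ∧ 0 < S.B i k)) ∧
            c i = 0) := by
  obtain ⟨c, hck, hc, hcc⟩ := mutateVectors_eq (IsPositive p q) (v := S.v) (B := S.B) k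
  refine ⟨c, hck, hc, fun i hi => ?_⟩
  rcases hcc i hi with ⟨h1, h2⟩ | h
  · refine Or.inl ⟨h1, h2, ?_⟩
    rw [h2, hS.form_eq i k hi, signedWeight_of_move h1]
  · exact Or.inr h

theorem mutate_B_left (Pos : AffFun → Prop) (S : Seed) (k j : Fin 3) :
    (S.mutate Pos k).B k j = -S.B k j := by
  simp [Seed.mutate, mutateMatrix]

theorem mutate_B_right (Pos : AffFun → Prop) (S : Seed) (i k : Fin 3) :
    (S.mutate Pos k).B i k = -S.B i k := by
  simp [Seed.mutate, mutateMatrix]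

theorem mutate_B_of_ne (Pos : AffFun → Prop) (S : Seed) {i j k : Fin 3} (hi : i ≠ k)
    (hj : j ≠ k) : (S.mutate Pos k).B i j =
      S.B i j + (S.B i k * |S.B k j| + |S.B i k| * S.B k j) / 2 := by
  simp [Seed.mutate, mutateMatrix, hi, hj]

/-- In a coherent seed every moved vector becomes vᵢ + |bᵢₖ| vₖ. The resulting multiples of vₖ
cancel exactly against the change of the weight bᵢⱼ. -/
theorem Coherent.kernelVec_mutate (hS : Coherent p q z S) {i j k : Fin 3}
    (hik : i ≠ k) (hjk : j ≠ k) :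
    kernelVec (S.mutate (IsPositive p q) k) i j k = -kernelVec S i j k := by
  obtain ⟨c, hck, hc, hcc⟩ := hS.mutate_v k
  have hi := hcc i hik
  have hj := hcc j hjk
  have ni := hS.ne_zero i k hik
  have nj := hS.ne_zero j k hjk
  have key : (S.B i k * |S.B k j| + |S.B i k| * S.B k j) / 2 =
      S.B k i * c j + S.B j k * c i := by
    rw [S.B_skew j k, S.B_skew i k, abs_neg]
    by_cases hp : IsPositive p q (S.v k) <;>
      rcases lt_or_gt_of_ne ni with a | a <;> rcases lt_or_gt_of_ne nj with b | b <;>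
      simp only [hp, a, b, a.le.not_gt, b.le.not_gt, true_and, false_and, not_true, not_false_iff,
        or_false, or_true, or_self, false_or, abs_of_pos, abs_of_neg] at hi hj ⊢ <;>
      (try rw [hi.2]) <;> (try rw [hj.2]) <;> (try rw [hi]) <;> (try rw [hj]) <;> ring
  unfold kernelVec
  rw [mutate_B_right, mutate_B_left, mutate_B_of_ne _ _ hik hjk, hc, hc, hc, hck, key]
  module

/-- By `Coherent.of_form_eq` only inner products with the mutated vector matter. For a moved vᵢ the
product stays -|bᵢₖ|, which is the prescribed value whatever the new positivity of vᵢ is. For an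
unmoved vᵢ both the product and the prescribed value change sign. -/
theorem Coherent.mutate (hpq : p ≠ q) (hzp : z.eval p = 0) (hzq : z.eval q = 0)
    (hS : Coherent p q z S) (k : Fin 3)
    (hne : ∀ i j, i ≠ j → (S.mutate (IsPositive p q) k).B i j ≠ 0) :
    Coherent p q z (S.mutate (IsPositive p q) k) := by
  have hker : kernelVec (S.mutate (IsPositive p q) k) 0 1 2 = z ∨
      kernelVec (S.mutate (IsPositive p q) k) 0 1 2 = -z := by
    obtain ⟨i, j, hij, hik, hjk⟩ : ∃ i j : Fin 3, i ≠ j ∧ i ≠ k ∧ j ≠ k := by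
      clear hne; revert k; decide
    have h1 := hS.kernelVec_mutate hik hjk
    have h2 := kernelVec_eq_or S hij hik hjk
    have h3 := kernelVec_eq_or (S.mutate (IsPositive p q) k) hij hik hjk
    have h4 := hS.kernel
    generalize kernelVec (S.mutate (IsPositive p q) k) i j k = A at *
    generalize kernelVec (S.mutate (IsPositive p q) k) 0 1 2 = A' at *
    generalize kernelVec S i j k = C at *
    generalize kernelVec S 0 1 2 = C' at *
    subst h1
    have hA : A' = C ∨ A' = -C := h3.symm.imp (fun h => (neg_injective h).symm) Eq.symm
    rcases hA with rfl | rfl <;> rcases h2 with rfl | rfl <;> rcases h4 with rfl | rfl <;> simp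
  refine Coherent.of_form_eq hpq hzp hzq hne hker k fun i hi => ?_
  obtain ⟨c, hck, hc, hcc⟩ := hS.mutate_v k
  have hvk : (S.mutate (IsPositive p q) k).v k = -S.v k := by
    rw [hc, hck, two_smul]; abel
  have hpos : IsPositive p q (-S.v k) ↔ ¬ IsPositive p q (S.v k) :=
    ⟨fun h h' => h'.not_neg h, isPositive_neg_of_not hpq hzp hzq hS.ne_zero hS.kernel k⟩
  have hform : form (S.v i - c i • S.v k) (-S.v k) = 2 * c i - form (S.v i) (S.v k) := by
    have := form_sub_smul (S.v i) (S.v k) (S.v k) (c i) 2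
    rw [S.realisation.form_self, show S.v k - (2 : ℝ) • S.v k = -S.v k by
      rw [two_smul]; abel] at this
    rw [this]; ring
  rw [hvk, hc, hform, mutate_B_right, hpos]
  rcases hcc i hi with ⟨h1, h2, h3⟩ | ⟨h1, h2⟩
  · rw [signedWeight_of_move, abs_neg, ← h2, ← h3]
    · ring
    · rw [neg_pos, neg_lt_zero]
      tauto
  · rw [h2, zero_smul, sub_zero, signedWeight_neg_of_not_move (hS.ne_zero i k hi) h1,
      hS.form_eq i k hi]
    ring

end Coherent

/-! ### Invariance of the volume and of the span over a coefficient ring -/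

section Lattice

/-- The volume spanned by three affine functions, with respect to the coordinates of `V`. -/
def vol (f g h : AffFun) : ℝ :=
  f.1 0 * (g.1 1 * h.2 - g.2 * h.1 1) - f.1 1 * (g.1 0 * h.2 - g.2 * h.1 0) +
    f.2 * (g.1 0 * h.1 1 - g.1 1 * h.1 0)

/-- Mutation negates one vector and adds multiples of it to the others. -/
theorem vol_mutate (Pos : AffFun → Prop) (S : Seed) (k : Fin 3) :
    vol ((S.mutate Pos k).v 0) ((S.mutate Pos k).v 1) ((S.mutate Pos k).v 2) =
      -vol (S.v 0) (S.v 1) (S.v 2) := by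
  obtain ⟨c, hck, hc, -⟩ := mutateVectors_eq Pos (v := S.v) (B := S.B) k
  have hc' : ∀ i, (S.mutate Pos k).v i = S.v i - c i • S.v k := hc
  rw [hc', hc', hc']
  have hk : k = 0 ∨ k = 1 ∨ k = 2 := by fin_cases k <;> simp
  rcases hk with rfl | rfl | rfl <;>
  · simp only [vol, hck, Prod.fst_sub, Prod.snd_sub, Prod.smul_fst, Prod.smul_snd, smul_eq_mul,
      PiLp.sub_apply, PiLp.smul_apply]
    ring

/-- The volume of two functions with a constant sum and a third one. -/
theorem vol_sq_of_add_eq_const {f g h : AffFun} {d : ℝ} (hfg : f + g = (0, d)) :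
    vol f g h ^ 2 = d ^ 2 * (form f f * form h h - form f h ^ 2) := by
  have e : g = (0, d) - f := by rw [← hfg]; abel
  rw [e]
  simp only [vol, form, plane_inner_eq, Prod.fst_sub, Prod.snd_sub, PiLp.sub_apply,
    PiLp.zero_apply]
  ring

/-- The change of basis has coefficients in A, and so has its inverse, which has the same shape
because the mutated vector is just negated. -/
theorem span_mutate (A : Subalgebra ℤ ℝ) (Pos : AffFun → Prop) (S : Seed) (k : Fin 3)
    (hA : ∀ i, i ≠ k → form (S.v i) (S.v k) ∈ A) :
    Submodule.span A (Set.range (S.mutate Pos k).v) = Submodule.span A (Set.range S.v) := by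
  obtain ⟨c, hck, hc, hcc⟩ := mutateVectors_eq Pos (v := S.v) (B := S.B) k
  have hc' : ∀ i, (S.mutate Pos k).v i = S.v i - c i • S.v k := hc
  have hcA : ∀ i, c i ∈ A := by
    intro i
    by_cases hi : i = k
    · rw [hi, hck]; exact_mod_cast A.natCast_mem 2
    · rcases hcc i hi with ⟨-, h⟩ | ⟨-, h⟩ <;> rw [h]
      · exact hA i hi
      · exact A.zero_mem
  have hvk : S.v k = -(S.mutate Pos k).v k := by
    rw [hc', hck, two_smul]; abel
  refine le_antisymm (Submodule.span_le.2 ?_) (Submodule.span_le.2 ?_)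
  · rintro _ ⟨i, rfl⟩
    rw [hc']
    exact Submodule.sub_mem _ (Submodule.subset_span ⟨i, rfl⟩)
      (Submodule.smul_mem _ (⟨c i, hcA i⟩ : A) (Submodule.subset_span ⟨k, rfl⟩))
  · rintro _ ⟨i, rfl⟩
    have : S.v i = (S.mutate Pos k).v i - c i • (S.mutate Pos k).v k := by
      rw [hc' i, hvk]
      module
    rw [this]
    exact Submodule.sub_mem _ (Submodule.subset_span ⟨i, rfl⟩)
      (Submodule.smul_mem _ (⟨c i, hcA i⟩ : A) (Submodule.subset_span ⟨k, rfl⟩))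

end Lattice

/-! ### Periodic cosine weights -/

section Weight

/-- The weight `2 cos (j (π + α))`, which is periodic in `j` with period `2n+1`. -/
def weight (n : ℕ) (j : ℤ) : ℝ := 2 * Real.cos (j * (Real.pi + alpha n))

theorem weight_neg (n : ℕ) (j : ℤ) : weight n (-j) = weight n j := by
  unfold weight; push_cast; rw [neg_mul, Real.cos_neg]

theorem weight_zero (n : ℕ) : weight n 0 = 2 := by simp [weight]

theorem weight_add_mul (n : ℕ) (j m : ℤ) : weight n (j + m * (2 * n + 1)) = weight n j := by
  unfold weight
  have : ((j + m * (2 * n + 1) : ℤ) : ℝ) * (Real.pi + alpha n) =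
      j * (Real.pi + alpha n) + (m * (n + 1) : ℤ) * (2 * Real.pi) := by
    push_cast
    linear_combination (m : ℝ) * mul_alpha n
  rw [this, Real.cos_add_int_mul_two_pi]

theorem weight_mul (n : ℕ) (a b : ℤ) :
    weight n a * weight n b = weight n (a + b) + weight n (a + -b) := by
  unfold weight
  push_cast
  rw [add_mul, add_mul, neg_mul, ← sub_eq_add_neg, Real.cos_add, Real.cos_sub]
  ring

theorem weight_eq (n : ℕ) (j : ℕ) : weight n j = (-1) ^ j * (2 * Real.cos (j * alpha n)) := by
  unfold weight
  rw [Int.cast_natCast, mul_add, add_comm, Real.cos_add_nat_mul_pi]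
  ring

/-- A zero would give 2j(2n+2) = (2k+1)(2n+1), an even number equal to an odd one. -/
theorem weight_ne_zero (n : ℕ) (j : ℤ) : weight n j ≠ 0 := by
  intro h
  unfold weight at h
  rw [mul_eq_zero, Real.cos_eq_zero_iff] at h
  obtain ⟨k, hk⟩ := h.resolve_left two_ne_zero
  have h1 : (2 * j * (2 * n + 2) - (2 * k + 1) * (2 * n + 1) : ℝ) * alpha n = 0 := by
    linear_combination 2 * hk + (2 * j - (2 * k + 1)) * mul_alpha n
  have h2 := (mul_eq_zero.1 h1).resolve_right (alpha_pos n).ne'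
  have h3 : (2 * j * (2 * n + 2) - (2 * k + 1) * (2 * n + 1) : ℤ) = 0 := by exact_mod_cast h2
  have h4 : 2 * (j * (2 * n + 2) - k * (2 * n + 1) - n) = (1 : ℤ) := by linear_combination h3
  omega

theorem weight_mem (n : ℕ) (j : ℤ) : weight n j ∈ cosRing n := by
  have h1 : 2 * Real.cos (Real.pi + alpha n) ∈ cosRing n := by
    rw [add_comm, Real.cos_add_pi, mul_neg]
    exact Subalgebra.neg_mem _ (two_cos_alpha_mem n)
  have h2 := two_cos_mul_mem h1 j.natAbs
  have h3 : weight n j = weight n j.natAbs := by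
    rcases Int.natAbs_eq j with h | h <;> conv_lhs => rw [h]
    rw [weight_neg]
  rw [h3, weight, Int.cast_natCast]
  exact h2

end Weight

/-! ### Mutation of weights as a Euclidean algorithm modulo 2n+1 -/

section Class

theorem Cyc.rotate_iff (x y z : ℝ) : Cyc y z x ↔ Cyc x y z := by
  unfold Cyc; tauto

theorem cyc_swap_iff (x y z : ℝ) : Cyc (-x) (-z) (-y) ↔ Cyc x y z := by
  unfold Cyc; simp only [neg_pos, neg_lt_zero]; tauto

theorem isAcyclic_iff_of_ne (S : Seed) {i j k : Fin 3} (hij : i ≠ j) (hik : i ≠ k) (hjk : j ≠ k) :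
    IsAcyclic S.B ↔ ¬ Cyc (S.B i j) (S.B j k) (S.B k i) := by
  rw [isAcyclic_iff S.skew, not_iff_not]
  have h1 : ∀ i j k, Cyc (S.B j k) (S.B k i) (S.B i j) ↔ Cyc (S.B i j) (S.B j k) (S.B k i) :=
    fun i j k => Cyc.rotate_iff _ _ _
  have h2 : Cyc (S.B 1 0) (S.B 0 2) (S.B 2 1) ↔ Cyc (S.B 0 1) (S.B 1 2) (S.B 2 0) := by
    rw [S.B_skew 0 1, S.B_skew 2 0, S.B_skew 1 2]; exact cyc_swap_iff _ _ _
  fin_cases i <;> fin_cases j <;> fin_cases k <;> first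
    | exact absurd rfl hij
    | exact absurd rfl hik
    | exact absurd rfl hjk
    | exact Iff.rfl
    | exact (h1 _ _ _).symm
    | exact h1 _ _ _
    | exact h2.symm
    | exact (((h1 _ _ _)).trans h2).symm
    | exact (((h1 _ _ _).symm).trans h2).symm

/-- The weights of the quiver of `S` are given by the pair `(a, b)` of integers. -/
structure HasClass (n : ℕ) (S : Seed) (i j k : Fin 3) (a b : ℤ) : Prop where
  hij : i ≠ j
  hik : i ≠ k
  hjk : j ≠ k
  abs_left : |S.B i j| = |weight n a|
  abs_right : |S.B j k| = |weight n b|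
  abs_sum : |S.B k i| = |weight n (a + b)|
  acyclic : IsAcyclic S.B ↔ weight n a * weight n b * weight n (a + b) < 0

variable {n : ℕ} {S : Seed} {i j k : Fin 3} {a b : ℤ} {Pos : AffFun → Prop}

theorem abs_B_comm (S : Seed) (i j : Fin 3) : |S.B j i| = |S.B i j| := by
  rw [S.B_skew i j, abs_neg]

theorem HasClass.rotate (h : HasClass n S i j k a b) : HasClass n S j k i b (-a - b) := by
  have e1 : weight n (-a - b) = weight n (a + b) := by rw [← weight_neg]; congr 1; ring
  have e2 : weight n (b + (-a - b)) = weight n a := by rw [← weight_neg]; congr 1; ring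
  refine ⟨h.hjk, h.hij.symm, h.hik.symm, h.abs_right, ?_, ?_, ?_⟩
  · rw [e1]; exact h.abs_sum
  · rw [e2]; exact h.abs_left
  · rw [e1, e2, h.acyclic, show weight n a * weight n b * weight n (a + b) =
      weight n b * weight n (a + b) * weight n a by ring]

theorem HasClass.swap (h : HasClass n S i j k a b) : HasClass n S k j i b a := by
  refine ⟨h.hjk.symm, h.hik.symm, h.hij.symm, ?_, ?_, ?_, ?_⟩
  · rw [abs_B_comm]; exact h.abs_right
  · rw [abs_B_comm]; exact h.abs_left
  · rw [abs_B_comm, add_comm]; exact h.abs_sum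
  · rw [h.acyclic, add_comm b, mul_comm (weight n b)]

theorem HasClass.congr {a' b' : ℤ} (h : HasClass n S i j k a b) (ha : weight n a' = weight n a)
    (hb : weight n b' = weight n b) (hab : weight n (a' + b') = weight n (a + b)) :
    HasClass n S i j k a' b' :=
  ⟨h.hij, h.hik, h.hjk, ha ▸ h.abs_left, hb ▸ h.abs_right, hab ▸ h.abs_sum,
    by rw [ha, hb, hab]; exact h.acyclic⟩

theorem HasClass.ne_zero (h : HasClass n S i j k a b) : S.B i j ≠ 0 ∧ S.B j k ≠ 0 ∧ S.B k i ≠ 0 := by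
  refine ⟨?_, ?_, ?_⟩ <;> rw [← abs_pos]
  · rw [h.abs_left, abs_pos]; exact weight_ne_zero _ _
  · rw [h.abs_right, abs_pos]; exact weight_ne_zero _ _
  · rw [h.abs_sum, abs_pos]; exact weight_ne_zero _ _

/-- Mutation at the middle vertex of a path with weights p, q and closing weight r. The hypothesis
on `Cyc` fixes the orientation of r relative to the path as the sign of W relative to P, so that the
new closing weight is P - W up to sign, again with matching orientation. -/
theorem weights_mutate {p q r P W : ℝ} (hpq : 0 < p * q) (hP : |p * q| = |P|) (hW : |r| = |W|)
    (hr : r ≠ 0) (hPW : P - W ≠ 0) (h : ¬ Cyc p q r ↔ P * W < 0) :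
    |r - (q * |p| + |q| * p) / 2| = |P - W| ∧
      (¬ Cyc (-p) (-q) (r - (q * |p| + |q| * p) / 2) ↔ P * (P - W) < 0) := by
  have hP0 : P ≠ 0 := by rintro rfl; simp at hP; rcases hP with rfl | rfl <;> simp at hpq
  rw [abs_of_pos hpq] at hP
  unfold Cyc at h ⊢
  rcases pos_and_pos_or_neg_and_neg_of_mul_pos hpq with ⟨hp, hq⟩ | ⟨hp, hq⟩
  · have e : (q * |p| + |q| * p) / 2 = p * q := by rw [abs_of_pos hp, abs_of_pos hq]; ring
    rw [e]
    have h1 : 0 < r ↔ ¬ P * W < 0 := by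
      rw [← not_iff_not, not_not, ← h, not_iff_not]
      simp [hp, hq, hp.le.not_gt]
    have h2 : ((0 < -p ∧ 0 < -q ∧ 0 < r - p * q) ∨ (-p < 0 ∧ -q < 0 ∧ r - p * q < 0)) ↔
        r - p * q < 0 := by
      simp [hp, hq, hp.le.not_gt]
    rw [h2]
    rcases lt_or_gt_of_ne hP0 with hP1 | hP1
    · rw [abs_of_neg hP1] at hP
      have e2 : r = -W := by
        rcases abs_eq_abs.1 hW with e | e
        · exfalso
          rcases lt_or_gt_of_ne hr with h3 | h3
          · exact h3.le.not_gt (h1.2 (by rw [← e]; nlinarith))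
          · exact h1.1 h3 (by rw [← e]; nlinarith)
        · exact e
      rw [hP, e2]
      refine ⟨by congr 1; ring, ?_⟩
      constructor
      · intro h3
        have : 0 < P - W := lt_of_le_of_ne (by linarith) hPW.symm
        nlinarith
      · intro h3 h4
        nlinarith
    · rw [abs_of_pos hP1] at hP
      have e2 : r = W := by
        rcases abs_eq_abs.1 hW with e | e
        · exact e
        · exfalso
          rcases lt_or_gt_of_ne hr with h3 | h3
          · exact h3.le.not_gt (h1.2 (by nlinarith))
          · exact h1.1 h3 (by nlinarith)
      rw [hP, e2]
      refine ⟨abs_sub_comm _ _, ?_⟩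
      constructor
      · intro h3
        have : P - W < 0 := lt_of_le_of_ne (by linarith) hPW
        nlinarith
      · intro h3 h4
        nlinarith
  · have e : (q * |p| + |q| * p) / 2 = -(p * q) := by rw [abs_of_neg hp, abs_of_neg hq]; ring
    rw [e]
    have h1 : r < 0 ↔ ¬ P * W < 0 := by
      rw [← not_iff_not, not_not, ← h, not_iff_not]
      simp [hp, hq, hp.le.not_gt]
    have h2 : ((0 < -p ∧ 0 < -q ∧ 0 < r - -(p * q)) ∨ (-p < 0 ∧ -q < 0 ∧ r - -(p * q) < 0)) ↔
        0 < r - -(p * q) := by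
      simp [hp, hq, hp.le.not_gt]
    rw [h2]
    rcases lt_or_gt_of_ne hP0 with hP1 | hP1
    · rw [abs_of_neg hP1] at hP
      have e2 : r = W := by
        rcases abs_eq_abs.1 hW with e | e
        · exact e
        · exfalso
          rcases lt_or_gt_of_ne hr with h3 | h3
          · exact h1.1 h3 (by nlinarith)
          · exact h3.le.not_gt (h1.2 (by nlinarith))
      rw [hP, e2]
      refine ⟨by rw [← abs_neg]; congr 1; ring, ?_⟩
      constructor
      · intro h3
        have : 0 < P - W := lt_of_le_of_ne (by linarith) hPW.symm
        nlinarith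
      · intro h3 h4
        nlinarith
    · rw [abs_of_pos hP1] at hP
      have e2 : r = -W := by
        rcases abs_eq_abs.1 hW with e | e
        · exfalso
          rcases lt_or_gt_of_ne hr with h3 | h3
          · exact h1.1 h3 (by rw [← e]; nlinarith)
          · exact h3.le.not_gt (h1.2 (by rw [← e]; nlinarith))
        · exact e
      rw [hP, e2]
      refine ⟨by congr 1; ring, ?_⟩
      constructor
      · intro h3
        have : P - W < 0 := lt_of_le_of_ne (by linarith) hPW
        nlinarith
      · intro h3 h4
        nlinarith

/-- The product formula w(a) w(b) - w(a+b) = w(a-b) identifies the new closing weight. -/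
theorem HasClass.mutate_of_pos (h : HasClass n S i j k a b) (hpos : 0 < S.B i j * S.B j k) :
    HasClass n (S.mutate Pos j) i j k a (-b) := by
  have hw := weight_mul n a b
  have hacy := h.acyclic
  rw [isAcyclic_iff_of_ne S h.hij h.hik h.hjk] at hacy
  have e : (S.mutate Pos j).B k i =
      S.B k i - (S.B j k * |S.B i j| + |S.B j k| * S.B i j) / 2 := by
    rw [mutate_B_of_ne _ _ h.hjk.symm h.hij, S.B_skew j k, S.B_skew i j, abs_neg, abs_neg]
    ring
  have key := weights_mutate (P := weight n a * weight n b) (W := weight n (a + b)) hpos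
    (by rw [abs_mul, abs_mul, h.abs_left, h.abs_right]) h.abs_sum h.ne_zero.2.2
    (by rw [hw, add_sub_cancel_left]; exact weight_ne_zero _ _) hacy
  rw [← e] at key
  have e2 : weight n a * weight n b - weight n (a + b) = weight n (a + -b) := by linarith
  rw [e2] at key
  refine ⟨h.hij, h.hik, h.hjk, ?_, ?_, key.1, ?_⟩
  · rw [mutate_B_right, abs_neg]; exact h.abs_left
  · rw [mutate_B_left, abs_neg, weight_neg]; exact h.abs_right
  · rw [isAcyclic_iff_of_ne _ h.hij h.hik h.hjk, mutate_B_right, mutate_B_left, weight_neg]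
    exact key.2

/-- The vertex is a source or a sink: mutation only reverses its arrows, and the quiver is acyclic
before and after. -/
theorem HasClass.mutate_of_neg (h : HasClass n S i j k a b) (hneg : S.B i j * S.B j k < 0) :
    HasClass n (S.mutate Pos j) i j k a b ∧ (S.mutate Pos j).B k i = S.B k i := by
  have e : (S.mutate Pos j).B k i = S.B k i := by
    rw [mutate_B_of_ne _ _ h.hjk.symm h.hij, S.B_skew j k, S.B_skew i j, abs_neg, abs_neg]
    rcases lt_or_gt_of_ne h.ne_zero.1 with h1 | h1
    · have h2 : 0 < S.B j k := by nlinarith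
      rw [abs_of_neg h1, abs_of_pos h2]; ring
    · have h2 : S.B j k < 0 := by nlinarith
      rw [abs_of_pos h1, abs_of_neg h2]; ring
  have n1 : ¬ Cyc (S.B i j) (S.B j k) (S.B k i) := by
    rintro (⟨h1, h2, -⟩ | ⟨h1, h2, -⟩) <;> nlinarith
  have n2 : ¬ Cyc (-S.B i j) (-S.B j k) (S.B k i) := by
    rintro (⟨h1, h2, -⟩ | ⟨h1, h2, -⟩) <;> nlinarith
  refine ⟨⟨h.hij, h.hik, h.hjk, ?_, ?_, ?_, ?_⟩, e⟩
  · rw [mutate_B_right, abs_neg]; exact h.abs_left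
  · rw [mutate_B_left, abs_neg]; exact h.abs_right
  · rw [e]; exact h.abs_sum
  · rw [isAcyclic_iff_of_ne _ h.hij h.hik h.hjk, mutate_B_right, mutate_B_left, e, ← h.acyclic,
      isAcyclic_iff_of_ne S h.hij h.hik h.hjk]
    exact ⟨fun _ => n1, fun _ => n2⟩

theorem HasClass.exists_mutate (h : HasClass n S i j k a b) (m : Fin 3) :
    ∃ i' j' k' a' b', HasClass n (S.mutate Pos m) i' j' k' a' b' := by
  have key : ∀ {i k a b}, HasClass n S i m k a b →
      ∃ i' j' k' a' b', HasClass n (S.mutate Pos m) i' j' k' a' b' := by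
    intro i k a b h
    rcases lt_or_gt_of_ne (mul_ne_zero h.ne_zero.1 h.ne_zero.2.1) with h1 | h1
    · exact ⟨_, _, _, _, _, (h.mutate_of_neg h1).1⟩
    · exact ⟨_, _, _, _, _, h.mutate_of_pos h1⟩
  have hm : m = i ∨ m = j ∨ m = k := by
    have h1 := h.hij
    have h2 := h.hik
    have h3 := h.hjk
    revert h1 h2 h3
    clear h key
    revert i j k m
    decide
  rcases hm with rfl | rfl | rfl
  · exact key h.rotate.rotate
  · exact key h
  · exact key h.rotate

theorem HasClass.B_mem_or (h : HasClass n S i j k a b) {l m : Fin 3} (hlm : l ≠ m) :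
    ∃ c : ℤ, |S.B l m| = |weight n c| := by
  have key : |S.B l m| = |S.B i j| ∨ |S.B l m| = |S.B j k| ∨ |S.B l m| = |S.B k i| := by
    have hm : (l = i ∧ m = j) ∨ (l = j ∧ m = k) ∨ (l = k ∧ m = i) ∨ (l = j ∧ m = i) ∨
        (l = k ∧ m = j) ∨ (l = i ∧ m = k) := by
      have h1 := h.hij
      have h2 := h.hik
      have h3 := h.hjk
      revert h1 h2 h3 hlm
      clear h
      revert i j k l m
      decide
    rcases hm with ⟨rfl, rfl⟩ | ⟨rfl, rfl⟩ | ⟨rfl, rfl⟩ | ⟨rfl, rfl⟩ | ⟨rfl, rfl⟩ | ⟨rfl, rfl⟩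
    · exact Or.inl rfl
    · exact Or.inr (Or.inl rfl)
    · exact Or.inr (Or.inr rfl)
    · exact Or.inl (abs_B_comm _ _ _)
    · exact Or.inr (Or.inl (abs_B_comm _ _ _))
    · exact Or.inr (Or.inr (abs_B_comm _ _ _))
  rcases key with e | e | e <;> rw [e]
  · exact ⟨_, h.abs_left⟩
  · exact ⟨_, h.abs_right⟩
  · exact ⟨_, h.abs_sum⟩

/-- The exchange graph of `S₀` contains a seed with weights given by `(a, b)`. -/
def Reachable (n : ℕ) (Pos : AffFun → Prop) (S₀ : Seed) (a b : ℤ) : Prop :=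
  ∃ S i j k, InExchangeGraph Pos S₀ S ∧ HasClass n S i j k a b

theorem InExchangeGraph.mutate {S₀ : Seed} (h : InExchangeGraph Pos S₀ S) (k : Fin 3) :
    InExchangeGraph Pos S₀ (S.mutate Pos k) :=
  Relation.ReflTransGen.tail h ⟨k, rfl⟩

namespace Reachable

variable {S₀ : Seed}

theorem rotate (h : Reachable n Pos S₀ a b) : Reachable n Pos S₀ b (-a - b) := by
  obtain ⟨S, i, j, k, hS, h⟩ := h
  exact ⟨S, j, k, i, hS, h.rotate⟩

theorem swap (h : Reachable n Pos S₀ a b) : Reachable n Pos S₀ b a := by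
  obtain ⟨S, i, j, k, hS, h⟩ := h
  exact ⟨S, k, j, i, hS, h.swap⟩

/-- If a path runs through j, mutate there. Otherwise j is a source or sink of an acyclic quiver,
and so is i or k; mutating at that vertex reverses one arrow at j and leaves the class alone, which
creates the required path. -/
theorem neg_right (h : Reachable n Pos S₀ a b) : Reachable n Pos S₀ a (-b) := by
  obtain ⟨S, i, j, k, hS, h⟩ := h
  have key : ∀ {S}, InExchangeGraph Pos S₀ S → HasClass n S i j k a b →
      0 < S.B i j * S.B j k → Reachable n Pos S₀ a (-b) := fun hS h hpos =>
    ⟨_, i, j, k, hS.mutate j, h.mutate_of_pos hpos⟩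
  obtain ⟨n1, n2, n3⟩ := h.ne_zero
  rcases lt_or_gt_of_ne (mul_ne_zero n1 n2) with h1 | h1
  · rcases lt_or_gt_of_ne (mul_ne_zero n3 n1) with h2 | h2
    · obtain ⟨h3, h4⟩ := h.rotate.rotate.mutate_of_neg (Pos := Pos) h2
      refine key (hS.mutate i) (h3.rotate.congr ?_ ?_ ?_) ?_
      · congr 1; ring
      · congr 1; ring
      · congr 1; ring
      · rw [mutate_B_left, h4]; linarith
    · have h2' : S.B j k * S.B k i < 0 := by
        rcases lt_or_gt_of_ne n1 with h3 | h3
        · have : 0 < S.B j k := by nlinarith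
          have : S.B k i < 0 := by nlinarith
          nlinarith
        · have : S.B j k < 0 := by nlinarith
          have : 0 < S.B k i := by nlinarith
          nlinarith
      obtain ⟨h3, h4⟩ := h.rotate.mutate_of_neg (Pos := Pos) h2'
      refine key (hS.mutate k) (h3.rotate.rotate.congr ?_ ?_ ?_) ?_
      · congr 1; ring
      · congr 1; ring
      · congr 1; ring
      · rw [mutate_B_right, h4]; linarith
  · exact key hS h h1

theorem add_right (h : Reachable n Pos S₀ a b) : Reachable n Pos S₀ a (b + a) := by
  have := h.swap.rotate.neg_right
  rwa [show -(-b - a) = b + a by ring] at this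

theorem sub_right (h : Reachable n Pos S₀ a b) : Reachable n Pos S₀ a (b - a) := by
  have := h.neg_right.add_right.neg_right
  rwa [show -(-b + a) = b - a by ring] at this

theorem add_mul_right (h : Reachable n Pos S₀ a b) (m : ℤ) :
    Reachable n Pos S₀ a (b + m * a) := by
  induction m using Int.induction_on with
  | zero => simpa using h
  | succ m ih =>
    have := ih.add_right
    rwa [show b + (m : ℤ) * a + a = b + (m + 1) * a by ring] at this
  | pred m ih =>
    have := ih.sub_right
    rwa [show b + -(m : ℤ) * a - a = b + (-m - 1) * a by ring] at this

theorem periodic (h : Reachable n Pos S₀ a b) (m : ℤ) :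
    Reachable n Pos S₀ a (b + m * (2 * n + 1)) := by
  obtain ⟨S, i, j, k, hS, h⟩ := h
  refine ⟨S, i, j, k, hS, h.congr rfl (weight_add_mul _ _ _) ?_⟩
  rw [← add_assoc, weight_add_mul]

/-- The moves (a, b) ↦ (a, b ± a) and the swap are the steps of the Euclidean algorithm, and they
are reversible. -/
theorem iff_gcd (c d : ℕ) : Reachable n Pos S₀ c d ↔ Reachable n Pos S₀ (Nat.gcd c d) 0 := by
  induction c, d using Nat.gcd.induction with
  | H0 d => rw [Nat.gcd_zero_left]; exact ⟨swap, swap⟩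
  | H1 c d _ ih =>
    rw [Nat.gcd_rec, ← ih]
    have e : (d : ℤ) = (d % c : ℕ) + (d / c : ℕ) * (c : ℤ) := by
      exact_mod_cast (Nat.mod_add_div' d c).symm
    constructor
    · intro h
      have := (h.add_mul_right (-(d / c : ℕ))).swap
      rwa [show (d : ℤ) + -((d / c : ℕ) : ℤ) * c = (d % c : ℕ) by linear_combination e] at this
    · intro h
      rw [e]
      exact h.swap.add_mul_right _

/-- Any two pairs which are unimodular modulo `2n+1` are connected. -/
theorem of_coprime {c k : ℕ} (hc : Nat.gcd c (2 * n + 1) = 1) (hk : Nat.gcd k (2 * n + 1) = 1)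
    (h : Reachable n Pos S₀ c 0) : Reachable n Pos S₀ k 0 := by
  -- Replacing 0 by 2n+1 turns (c, 0) into a coprime pair, which Euclid connects to (1, 0); the same
  -- path is then run backwards for k.
  have h1 : Reachable n Pos S₀ c (2 * n + 1 : ℕ) := by simpa using h.periodic 1
  rw [iff_gcd, hc, ← hk, ← iff_gcd] at h1
  simpa using h1.periodic (-1)

end Reachable

end Class

/-! ### Seeds with two parallel lines and their translations -/

section Translation

variable {p q : Plane} {z : AffFun} {S : Seed}

theorem vol_sq_eq (f : Fin 3 → AffFun) {i j k : Fin 3} (hij : i ≠ j) (hik : i ≠ k) (hjk : j ≠ k) :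
    vol (f i) (f j) (f k) ^ 2 = vol (f 0) (f 1) (f 2) ^ 2 := by
  fin_cases i <;> fin_cases j <;> fin_cases k <;> first
    | exact absurd rfl hij
    | exact absurd rfl hik
    | exact absurd rfl hjk
    | rfl
    | (simp only [vol, Fin.zero_eta, Fin.mk_one, Fin.reduceFinMk]; ring)

theorem fst_eq_of_form_eq_two {f g : AffFun} (hf : form f f = 2) (hg : form g g = 2)
    (h : form f g = 2) : f.1 = g.1 := by
  rw [← sub_eq_zero, ← inner_self_eq_zero (𝕜 := ℝ), inner_sub_left, inner_sub_right,
    inner_sub_right]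
  unfold form at *
  rw [hf, hg, h, real_inner_comm, h]; norm_num

theorem fst_eq_neg_of_form_eq {f g : AffFun} (hf : form f f = 2) (hg : form g g = 2)
    (h : form f g = -2) : f.1 = -g.1 := by
  refine fst_eq_of_form_eq_two (f := f) (g := -g) hf ?_ ?_
  · simpa [form] using hg
  · simp only [form, Prod.fst_neg, inner_neg_right] at *; linarith

/-- In a coherent seed with two parallel lines, the first of them is positive. -/
theorem Coherent.isPositive_of_parallel (hpq : p ≠ q) (hzp : z.eval p = 0) (hzq : z.eval q = 0)
    (hS : Coherent p q z S) {i j k : Fin 3} (hij : i ≠ j) (hik : i ≠ k) (hjk : j ≠ k) {x : ℝ}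
    (hx2 : x ^ 2 < 4) (h12 : S.B i j = 2) (h23 : S.B j k = x) (h31 : S.B k i = x) :
    IsPositive p q (S.v i) ∧ (S.v i).1 = -(S.v j).1 := by
  have hself := S.realisation.form_self
  have hker : x * ((S.v i).eval q - (S.v i).eval p) + x * ((S.v j).eval q - (S.v j).eval p) +
      2 * ((S.v k).eval q - (S.v k).eval p) = 0 := by
    have h0 : ∀ y, z.eval y = 0 → (kernelVec S i j k).eval y = 0 := by
      intro y hy
      rcases kernelVec_eq_or S hij hik hjk with e | e <;> rcases hS.kernel with e' | e' <;>
        rw [e, e'] <;> simp [eval_neg, hy]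
    have h1 := h0 p hzp
    have h2 := h0 q hzq
    simp only [kernelVec, eval_add, eval_smul, h12, h23, h31] at h1 h2
    linear_combination h2 - h1
  simp only [eval_sub_eval] at hker
  -- If the i-th and k-th lines were both parallel to the line pq, they would be parallel to each
  -- other, giving x² = 4.
  have hpar : inner ℝ (S.v i).1 (q - p) = 0 → inner ℝ (S.v k).1 (q - p) = 0 → False := by
    intro h1 h2
    obtain ⟨c, hc⟩ := exists_eq_smul_of_inner_eq_zero (fst_v_ne_zero S i)
      (sub_ne_zero.2 hpq.symm) h1 h2
    have e1 : form (S.v k) (S.v k) = c ^ 2 * form (S.v i) (S.v i) := by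
      simp only [form, hc, real_inner_smul_left, real_inner_smul_right]; ring
    have e2 : form (S.v k) (S.v i) = c * form (S.v i) (S.v i) := by
      simp only [form, hc, real_inner_smul_left]
    have e3 := S.realisation.abs_form k i hik.symm
    rw [h31, ← sq_eq_sq_iff_abs_eq_abs, e2, hself] at e3
    rw [hself, hself] at e1
    nlinarith
  have hP : ∀ l, inner ℝ (S.v l).1 (q - p) < 0 → IsPositive p q (S.v l) := fun l hl =>
    isPositive_of_slope_neg (by rw [← eval_sub_eval] at hl; linarith)
  have hN : ∀ l, 0 < inner ℝ (S.v l).1 (q - p) → ¬ IsPositive p q (S.v l) := fun l hl h =>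
    h.not_neg (isPositive_of_slope_neg (by
      rw [← eval_sub_eval] at hl; rw [eval_neg, eval_neg]; linarith))
  have hform := hS.form_eq i j hij
  rw [h12, signedWeight] at hform
  split_ifs at hform with h
  -- Equal linear parts would force the same positivity on vᵢ and vⱼ unless both are constant along
  -- pq, but the inner product 2 is prescribed only when vᵢ is not positive and vⱼ is.
  · exfalso
    have h' : ¬ IsPositive p q (S.v i) ∧ IsPositive p q (S.v j) := by
      rcases h with ⟨-, h⟩ | ⟨h, -⟩
      · exact h
      · norm_num at h
    rw [abs_of_pos two_pos] at hform
    have e := fst_eq_of_form_eq_two (hself i) (hself j) hform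
    rcases lt_trichotomy (inner ℝ (S.v i).1 (q - p)) 0 with h1 | h1 | h1
    · exact h'.1 (hP i h1)
    · rw [← e, h1] at hker
      exact hpar h1 (by linarith)
    · rw [e] at h1
      exact hN j h1 h'.2
  · rw [abs_of_pos two_pos] at hform
    have e := fst_eq_neg_of_form_eq (hself i) (hself j) hform
    refine ⟨?_, e⟩
    have e' : inner ℝ (S.v i).1 (q - p) = -inner ℝ (S.v j).1 (q - p) := by rw [e, inner_neg_left]
    rw [e'] at hker
    rcases lt_trichotomy (inner ℝ (S.v i).1 (q - p)) 0 with h1 | h1 | h1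
    · exact hP i h1
    · exact absurd (hpar h1 (by linarith)) id
    · exact absurd (Or.inl ⟨two_pos, hN i h1, hP j (by linarith)⟩) h

/-- In a coherent seed with two parallel lines, one mutation translates the seed. -/
theorem Coherent.exists_isTranslate (hpq : p ≠ q) (hzp : z.eval p = 0) (hzq : z.eval q = 0)
    (hS : Coherent p q z S) {i j k : Fin 3} (hij : i ≠ j) (hik : i ≠ k) (hjk : j ≠ k) {x : ℝ}
    (hx : 0 < x) (hx2 : x ^ 2 < 4) (h12 : S.B i j = 2) (h23 : S.B j k = x) (h31 : S.B k i = x) :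
    ∃ w : Plane, IsTranslate w S (S.mutate (IsPositive p q) i) ∧
      ‖w‖ ^ 2 * (4 - x ^ 2) ^ 2 = 2 * vol (S.v 0) (S.v 1) (S.v 2) ^ 2 := by
  obtain ⟨hpos, hpar⟩ := hS.isPositive_of_parallel hpq hzp hzq hij hik hjk hx2 h12 h23 h31
  obtain ⟨c, hci, hc, hcc⟩ := hS.mutate_v i
  have h21 : S.B j i = -2 := by rw [S.B_skew i j, h12]
  have h13 : S.B i k = -x := by rw [S.B_skew k i, h31]
  have hcj : c j = -2 := by
    rcases hcc j hij.symm with ⟨-, -, h⟩ | ⟨h, -⟩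
    · rw [h, h21]; norm_num
    · exact absurd (Or.inl ⟨hpos, by rw [h21]; norm_num⟩) h
  have hck : c k = 0 := by
    rcases hcc k hik.symm with ⟨h | h, -⟩ | ⟨-, h⟩
    · rw [h31] at h; linarith [h.2]
    · exact absurd hpos h.1
    · exact h
  set d := (S.v i).2 + (S.v j).2 with hd
  have hsum : S.v i + S.v j = (0, d) := Prod.ext (by simp [hpar]) rfl
  have hfik : form (S.v i) (S.v k) ^ 2 = x ^ 2 := by
    rw [sq_eq_sq_iff_abs_eq_abs, S.realisation.abs_form i k hik, h13, abs_neg]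
  have hgram : form (S.v i) (S.v i) * form (S.v k) (S.v k) - form (S.v i) (S.v k) ^ 2 =
      4 - x ^ 2 := by
    rw [hfik, S.realisation.form_self, S.realisation.form_self]; ring
  have hgram' : inner ℝ (S.v i).1 (S.v i).1 * inner ℝ (S.v k).1 (S.v k).1 -
      inner ℝ (S.v i).1 (S.v k).1 ^ 2 = 4 - x ^ 2 := hgram
  -- Since vᵢ + vⱼ is the constant d, the mutated vectors are vᵢ' = vⱼ - d, vⱼ' = vᵢ + d and vₖ' =
  -- vₖ. So w has to be parallel to the k-th line and shift vᵢ by d.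
  obtain ⟨w, hw1, hw2⟩ := exists_inner_eq (by rw [hgram']; linarith) (-d) 0
  have hvi : (S.mutate (IsPositive p q) i).v i = (S.v j).translate w := by
    rw [hc, hci]
    refine Prod.ext ?_ ?_
    · change (S.v i).1 - (2 : ℝ) • (S.v i).1 = (S.v j).1
      rw [hpar]; module
    · simp only [AffFun.translate, Prod.snd_sub, Prod.smul_snd, smul_eq_mul]
      rw [hpar, inner_neg_left] at hw1
      linarith
  have hvj : (S.mutate (IsPositive p q) i).v j = (S.v i).translate w := by
    rw [hc, hcj]
    refine Prod.ext ?_ ?_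
    · change (S.v j).1 - (-2 : ℝ) • (S.v i).1 = (S.v i).1
      rw [hpar]; module
    · simp only [AffFun.translate, Prod.snd_sub, Prod.smul_snd, smul_eq_mul, hw1]
      linarith
  have hvk : (S.mutate (IsPositive p q) i).v k = (S.v k).translate w := by
    rw [hc, hck]
    refine Prod.ext ?_ ?_ <;> simp [AffFun.translate, hw2]
  have hBij : (S.mutate (IsPositive p q) i).B i j = -2 := by rw [mutate_B_left, h12]
  have hBki : (S.mutate (IsPositive p q) i).B k i = -x := by rw [mutate_B_right, h31]
  have hBjk : (S.mutate (IsPositive p q) i).B j k = -x := by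
    rw [mutate_B_of_ne _ _ hij.symm hik.symm, h21, h13, h23, abs_neg, abs_neg, abs_of_pos hx,
      abs_of_pos two_pos]
    ring
  have hall : ∀ m, m = i ∨ m = j ∨ m = k := by
    clear_value d
    clear hvi hvj hvk hBij hBki hBjk hw1 hw2 hgram hgram' hfik hsum hd hck hcj h13 h21 hcc hc hci
      hpos hpar h31 h23 h12 hS
    revert i j k
    decide
  have hσi : Equiv.swap i j i = j := Equiv.swap_apply_left _ _
  have hσj : Equiv.swap i j j = i := Equiv.swap_apply_right _ _
  have hσk : Equiv.swap i j k = k := Equiv.swap_apply_of_ne_of_ne hik.symm hjk.symm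
  have hdiag : ∀ (T : Seed) (m : Fin 3), T.B m m = 0 := fun T m => by linarith [T.B_skew m m]
  -- The mutation reverses all three arrows, which amounts to exchanging i and j.
  refine ⟨w, ⟨Equiv.swap i j, ?_, ?_⟩, ?_⟩
  · intro m
    rcases hall m with rfl | rfl | rfl
    · rw [hσi, hvj]
    · rw [hσj, hvi]
    · rw [hσk, hvk]
  · intro l m
    have s1 := (S.mutate (IsPositive p q) i).B_skew i j
    have s2 := (S.mutate (IsPositive p q) i).B_skew j k
    have s3 := (S.mutate (IsPositive p q) i).B_skew k i
    have s4 := S.B_skew j k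
    rcases hall l with h | h | h <;> rcases hall m with h' | h' | h' <;> rw [h, h'] <;>
      simp only [hσi, hσj, hσk, hdiag] <;> linarith
  · have h1 := norm_sq_mul_gram (S.v i).1 (S.v k).1 w
    rw [hgram', hw1, hw2] at h1
    have h2 := vol_sq_of_add_eq_const (h := S.v k) hsum
    rw [hgram, vol_sq_eq S.v hij hik hjk] at h2
    have h3 : inner ℝ (S.v k).1 (S.v k).1 = (2 : ℝ) := S.realisation.form_self k
    rw [h3] at h1
    rw [h2]
    linear_combination (4 - x ^ 2) * h1

end Translation

/-! ### Numerical data of the initial triangle -/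

section InitialTriangle

/-- Two outer normals of length `√2` of the sides of an angle. -/
theorem form_eq_neg_two_cos {f g : AffFun} {o x y : Plane} (hf : form f f = 2)
    (hg : form g g = 2) (hfo : f.eval o = 0) (hgo : g.eval o = 0) (hfx : f.eval x = 0)
    (hgy : g.eval y = 0) (hfy : f.eval y < 0) (hgx : g.eval x < 0) :
    form f g = -(2 * Real.cos (EuclideanGeometry.angle x o y)) := by
  have h1 : inner ℝ f.1 (x - o) = 0 := by rw [← eval_sub_eval, hfo, hfx, sub_zero]
  have h2 : inner ℝ g.1 (y - o) = 0 := by rw [← eval_sub_eval, hgo, hgy, sub_zero]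
  have h3 : inner ℝ f.1 (y - o) < 0 := by rw [← eval_sub_eval, hfo, sub_zero]; exact hfy
  have h4 : inner ℝ g.1 (x - o) < 0 := by rw [← eval_sub_eval, hgo, sub_zero]; exact hgx
  unfold EuclideanGeometry.angle
  rw [vsub_eq_sub, vsub_eq_sub]
  set X := x - o
  set Y := y - o
  have hX : X ≠ 0 := by rintro h; rw [h, inner_zero_right] at h4; exact lt_irrefl _ h4
  have hY : Y ≠ 0 := by rintro h; rw [h, inner_zero_right] at h3; exact lt_irrefl _ h3
  have rot : ∀ (Z : Plane) (F : Plane), Z ≠ 0 → inner ℝ F Z = 0 →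
      ∃ c : ℝ, F 0 = -c * Z 1 ∧ F 1 = c * Z 0 := by
    intro Z F hZ hF
    have hJ : (!₂[-Z 1, Z 0] : Plane) ≠ 0 := by
      intro h
      apply hZ
      have e0 := congrArg (fun v : Plane => v 0) h
      have e1 := congrArg (fun v : Plane => v 1) h
      simp at e0 e1
      exact plane_ext e1 e0
    obtain ⟨c, hc⟩ := exists_eq_smul_of_inner_eq_zero hJ hZ (by
      simp [plane_inner_eq]; ring) hF
    exact ⟨c, by rw [hc]; simp, by rw [hc]; simp⟩
  -- Each normal is a multiple of its side rotated by a right angle. The two negativity conditions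
  -- make the factors c and e opposite in sign, so the inner product is a negative multiple of that
  -- of the sides.
  obtain ⟨c, hc0, hc1⟩ := rot X f.1 hX h1
  obtain ⟨e, he0, he1⟩ := rot Y g.1 hY h2
  have hXn := norm_sq_plane X
  have hYn := norm_sq_plane Y
  have hXpos := norm_pos_iff.2 hX
  have hYpos := norm_pos_iff.2 hY
  have hfX : c ^ 2 * ‖X‖ ^ 2 = 2 := by
    rw [hXn, ← hf, form, plane_inner_eq, hc0, hc1]; ring
  have hgY : e ^ 2 * ‖Y‖ ^ 2 = 2 := by
    rw [hYn, ← hg, form, plane_inner_eq, he0, he1]; ring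
  rw [plane_inner_eq, hc0, hc1] at h3
  rw [plane_inner_eq, he0, he1] at h4
  have hce : c * e < 0 := by
    by_contra! h
    have : 0 < (-c * X 1 * Y 0 + c * X 0 * Y 1) * (-e * Y 1 * X 0 + e * Y 0 * X 1) :=
      mul_pos_of_neg_of_neg h3 h4
    nlinarith [mul_nonneg h (sq_nonneg (X 0 * Y 1 - X 1 * Y 0))]
  have hprod : (c * e * (‖X‖ * ‖Y‖)) ^ 2 = 2 ^ 2 := by
    linear_combination (e ^ 2 * ‖Y‖ ^ 2) * hfX + 2 * hgY
  have hval : c * e * (‖X‖ * ‖Y‖) = -2 := by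
    rcases sq_eq_sq_iff_eq_or_eq_neg.1 hprod with h | h
    · have := mul_neg_of_neg_of_pos hce (mul_pos hXpos hYpos)
      linarith
    · exact h
  have hcos := InnerProductGeometry.cos_angle_mul_norm_mul_norm X Y
  have hform : form f g = c * e * inner ℝ X Y := by
    rw [form, plane_inner_eq, plane_inner_eq, hc0, hc1, he0, he1]; ring
  rw [hform, ← hcos]
  linear_combination Real.cos (InnerProductGeometry.angle X Y) * hval

variable {n : ℕ} {t : Affine.Triangle ℝ Plane} {S : Seed}

theorem IsInitialSeed.form_eq (hS : IsInitialSeed t S) {i j k : Fin 3} (hij : i ≠ j) (hik : i ≠ k)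
    (hjk : j ≠ k) : form (S.v i) (S.v j) =
      -(2 * Real.cos (EuclideanGeometry.angle (t.points j) (t.points k) (t.points i))) :=
  form_eq_neg_two_cos (S.realisation.form_self i) (S.realisation.form_self j)
    (hS.eval_eq_zero i k hik.symm) (hS.eval_eq_zero j k hjk.symm) (hS.eval_eq_zero i j hij.symm)
    (hS.eval_eq_zero j i hij) (hS.eval_neg i) (hS.eval_neg j)

theorem IsInitialSeed.eval_altitudeFoot_self (hS : IsInitialSeed t S) (i : Fin 3) :
    (S.v i).eval (t.altitudeFoot i) = 0 := by
  refine affineSpan_induction (p := fun x => (S.v i).eval x = 0)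
    (t.altitudeFoot_mem_affineSpan_image_compl i) ?_ ?_
  · rintro _ ⟨j, hj, rfl⟩
    exact hS.eval_eq_zero i j hj
  · intro c u v w hu hv hw
    have h1 : (S.v i).eval (c • (u -ᵥ v) +ᵥ w) = c * ((S.v i).eval u - (S.v i).eval v) +
        (S.v i).eval w := by
      simp only [AffFun.eval, vsub_eq_sub, vadd_eq_add, inner_add_right, real_inner_smul_right,
        inner_sub_right]
      ring
    rw [h1, hu, hv, hw]; ring

/-- The foot differs from its vertex by a multiple of the normal of the i-th side; vanishing of vᵢ
at the foot determines the multiple, using (vᵢ, vᵢ) = 2. -/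
theorem IsInitialSeed.eval_altitudeFoot (hS : IsInitialSeed t S) {i l : Fin 3} (hil : i ≠ l) :
    (S.v l).eval (t.altitudeFoot i) = -((S.v i).eval (t.points i) / 2) * form (S.v l) (S.v i) := by
  obtain ⟨m, him, hlm⟩ : ∃ m, i ≠ m ∧ l ≠ m := by
    clear hS; revert i l; decide
  have h1 := t.inner_vsub_altitudeFoot_vsub_altitudeFoot_eq_zero hil
  have h2 := t.inner_vsub_altitudeFoot_vsub_altitudeFoot_eq_zero him
  simp only [vsub_eq_sub] at h1 h2
  have h3 : inner ℝ (t.altitudeFoot i - t.points i) (t.points l - t.points m) = (0 : ℝ) := by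
    rw [real_inner_comm, ← neg_sub (t.points i), inner_neg_right,
      show t.points l - t.points m = (t.points l - t.altitudeFoot i) -
        (t.points m - t.altitudeFoot i) by abel, inner_sub_left, h1, h2]
    simp
  have h4 : inner ℝ (S.v i).1 (t.points l - t.points m) = (0 : ℝ) := by
    rw [← eval_sub_eval, hS.eval_eq_zero i l hil.symm, hS.eval_eq_zero i m him.symm, sub_zero]
  have hne : t.points l - t.points m ≠ 0 :=
    sub_ne_zero.2 fun h => hlm (t.independent.injective h)
  obtain ⟨c, hc⟩ := exists_eq_smul_of_inner_eq_zero (fst_v_ne_zero S i) hne h4 h3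
  have h5 := eval_sub_eval (S.v i) (t.altitudeFoot i) (t.points i)
  have h6 := eval_sub_eval (S.v l) (t.altitudeFoot i) (t.points i)
  have h7 : inner ℝ (S.v i).1 (S.v i).1 = (2 : ℝ) := S.realisation.form_self i
  rw [hS.eval_altitudeFoot_self, hc, real_inner_smul_right, h7] at h5
  rw [hS.eval_eq_zero l i hil, hc, real_inner_smul_right, sub_zero] at h6
  rw [h6, form]
  linear_combination (-(1 / 2) * inner ℝ (S.v l).1 (S.v i).1) * h5

/-- The numerical data of the initial seed: the weights, and the values of its vectors at the apex
`o` and at the feet `p` and `q` of the altitudes. -/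
structure InitialData (s κ d : ℝ) (o p q : Plane) (S : Seed) : Prop where
  s_pos : 0 < s
  s_le : s ≤ 1 / 2
  B01 : S.B 0 1 = 2 * s
  B02 : S.B 0 2 = 2 * s
  B12 : S.B 1 2 = 2 - 4 * s ^ 2
  form01 : form (S.v 0) (S.v 1) = -(2 * s)
  form02 : form (S.v 0) (S.v 2) = -(2 * s)
  form12 : form (S.v 1) (S.v 2) = -(2 - 4 * s ^ 2)
  linear : (2 * s) • (S.v 0).1 + (S.v 1).1 + (S.v 2).1 = 0
  κ_pos : 0 < κ
  d_pos : 0 < d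
  κ_sq : κ ^ 2 = 2 * d ^ 2 * (1 - s ^ 2)
  o0 : (S.v 0).eval o = -κ
  o1 : (S.v 1).eval o = 0
  o2 : (S.v 2).eval o = 0
  p0 : (S.v 0).eval p = 0
  p1 : (S.v 1).eval p = -(κ * s)
  p2 : (S.v 2).eval p = -(κ * s)
  q0 : (S.v 0).eval q = -(2 * s ^ 2 * κ)
  q1 : (S.v 1).eval q = -(2 * s * κ * (1 - 2 * s ^ 2))
  q2 : (S.v 2).eval q = 0

theorem cos_mul_alpha_pos (n : ℕ) : 0 < Real.cos (n * alpha n) := by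
  have h := mul_alpha n
  have := alpha_pos n
  apply Real.cos_pos_of_mem_Ioo
  constructor
  · have : 0 ≤ n * alpha n := by positivity
    linarith [Real.pi_pos]
  · linarith

theorem cos_mul_alpha_le (n : ℕ) (hn : 1 ≤ n) : Real.cos (n * alpha n) ≤ 1 / 2 := by
  have h := mul_alpha n
  have h0 := alpha_pos n
  have h1 : (1 : ℝ) ≤ n := by exact_mod_cast hn
  rw [← Real.cos_pi_div_three]
  apply Real.cos_le_cos_of_nonneg_of_le_pi
  · linarith [Real.pi_pos]
  · nlinarith
  · nlinarith

theorem cos_alpha_eq (n : ℕ) : 2 * Real.cos (alpha n) = 2 - 4 * Real.cos (n * alpha n) ^ 2 := by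
  have h : alpha n = Real.pi - 2 * (n * alpha n) := by linarith [mul_alpha n]
  conv_lhs => rw [h]
  rw [Real.cos_pi_sub, Real.cos_two_mul]; ring

theorem sin_alpha_eq (n : ℕ) :
    Real.sin (alpha n) = 2 * Real.sin (n * alpha n) * Real.cos (n * alpha n) := by
  have h : alpha n = Real.pi - 2 * (n * alpha n) := by linarith [mul_alpha n]
  conv_lhs => rw [h]
  rw [Real.sin_pi_sub, Real.sin_two_mul]

theorem IsInitialSeed.initialData (hn : 1 ≤ n) (ht : IsInitialTriangle n t)
    (hS : IsInitialSeed t S) : InitialData (Real.cos (n * alpha n))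
      (-(S.v 0).eval (t.points 0)) (legLength t) (t.points 0) (t.altitudeFoot 0)
      (t.altitudeFoot 2) S := by
  have hs := cos_mul_alpha_pos n
  have hs2 := cos_mul_alpha_le n hn
  have hc := cos_alpha_eq n
  have f01 : form (S.v 0) (S.v 1) = -(2 * Real.cos (n * alpha n)) := by
    rw [hS.form_eq (k := 2) (by decide) (by decide) (by decide), EuclideanGeometry.angle_comm,
      ht.angle_two]
  have f02 : form (S.v 0) (S.v 2) = -(2 * Real.cos (n * alpha n)) := by
    rw [hS.form_eq (k := 1) (by decide) (by decide) (by decide), EuclideanGeometry.angle_comm,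
      ht.angle_one]
  have f12 : form (S.v 1) (S.v 2) = -(2 - 4 * Real.cos (n * alpha n) ^ 2) := by
    rw [hS.form_eq (k := 0) (by decide) (by decide) (by decide), EuclideanGeometry.angle_comm,
      ht.angle_zero, hc]
  have hself := S.realisation.form_self
  have hB : ∀ i j, i ≠ j → 0 < S.B i j → form (S.v i) (S.v j) < 0 →
      S.B i j = -form (S.v i) (S.v j) := fun i j hij h1 h2 => by
    have := S.realisation.abs_form i j hij
    rw [abs_of_pos h1, abs_of_neg h2] at this
    exact this.symm
  generalize Real.cos (n * alpha n) = s at *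
  -- The Gram matrix of the normals is degenerate, and this combination has square length zero.
  have hlin : (2 * s) • (S.v 0).1 + (S.v 1).1 + (S.v 2).1 = 0 := by
    rw [← inner_self_eq_zero (𝕜 := ℝ)]
    have c01 := form_comm (S.v 0) (S.v 1)
    have c02 := form_comm (S.v 0) (S.v 2)
    have c12 := form_comm (S.v 1) (S.v 2)
    have e0 := hself 0
    have e1 := hself 1
    have e2 := hself 2
    simp only [inner_add_left, inner_add_right, real_inner_smul_left, real_inner_smul_right,
      form] at *
    rw [← c01, ← c02, ← c12, f01, f02, f12, e0, e1, e2]; ring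
  have hv : ∀ x y, (2 * s) * ((S.v 0).eval x - (S.v 0).eval y) +
      ((S.v 1).eval x - (S.v 1).eval y) + ((S.v 2).eval x - (S.v 2).eval y) = 0 := by
    intro x y
    rw [eval_sub_eval, eval_sub_eval, eval_sub_eval, ← real_inner_smul_left, ← inner_add_left,
      ← inner_add_left, hlin, inner_zero_left]
  have z01 := hS.eval_eq_zero 0 1 (by decide)
  have z02 := hS.eval_eq_zero 0 2 (by decide)
  have z10 := hS.eval_eq_zero 1 0 (by decide)
  have z12 := hS.eval_eq_zero 1 2 (by decide)
  have z20 := hS.eval_eq_zero 2 0 (by decide)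
  have z21 := hS.eval_eq_zero 2 1 (by decide)
  have hκ := hS.eval_neg 0
  have hk2 : (S.v 2).eval (t.points 2) = 2 * s * (S.v 0).eval (t.points 0) := by
    have := hv (t.points 0) (t.points 2)
    rw [z10, z20, z02, z12] at this
    linarith
  have hleg : legLength t = ‖t.points 1 - t.points 0‖ := by
    rw [legLength, dist_comm, dist_eq_norm]
  have hκ2 : (S.v 0).eval (t.points 0) ^ 2 = 2 * legLength t ^ 2 * (1 - s ^ 2) := by
    have h1 := norm_sq_mul_gram (S.v 0).1 (S.v 2).1 (t.points 1 - t.points 0)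
    rw [← hleg, ← eval_sub_eval, ← eval_sub_eval, z01, z21, z20] at h1
    have h2 : inner ℝ (S.v 0).1 (S.v 0).1 = (2 : ℝ) := hself 0
    have h3 : inner ℝ (S.v 2).1 (S.v 2).1 = (2 : ℝ) := hself 2
    have h4 : inner ℝ (S.v 0).1 (S.v 2).1 = -(2 * s) := f02
    rw [h2, h3, h4] at h1
    linear_combination -(1 / 2) * h1
  refine ⟨hs, hs2, ?_, ?_, ?_, f01, f02, f12, hlin, by linarith, ?_, ?_, by ring, z10, z20,
    hS.eval_altitudeFoot_self 0, ?_, ?_, ?_, ?_, hS.eval_altitudeFoot_self 2⟩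
  · rw [hB 0 1 (by decide) hS.arrow_zero_one (by rw [f01]; linarith), f01]; ring
  · rw [hB 0 2 (by decide) hS.arrow_zero_two (by rw [f02]; linarith), f02]; ring
  · rw [hB 1 2 (by decide) hS.arrow_one_two (by rw [f12]; nlinarith), f12]; ring
  · rw [hleg]
    exact norm_pos_iff.2 (sub_ne_zero.2 fun h => absurd (t.independent.injective h) (by decide))
  · rw [neg_sq, hκ2]
  · rw [hS.eval_altitudeFoot (by decide), form_comm, f01]; ring
  · rw [hS.eval_altitudeFoot (by decide), form_comm, f02]; ring
  · rw [hS.eval_altitudeFoot (by decide), hk2, f02]; ring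
  · rw [hS.eval_altitudeFoot (by decide), hk2, f12]; ring

namespace InitialData

variable {s κ d : ℝ} {o p q : Plane}

theorem B12_pos (h : InitialData s κ d o p q S) : 0 < S.B 1 2 := by
  have := h.s_pos
  have := h.s_le
  rw [h.B12]; nlinarith

theorem B01_pos (h : InitialData s κ d o p q S) : 0 < S.B 0 1 := by
  rw [h.B01]; linarith [h.s_pos]

theorem B02_pos (h : InitialData s κ d o p q S) : 0 < S.B 0 2 := by
  rw [h.B02]; linarith [h.s_pos]

theorem ne (h : InitialData s κ d o p q S) : p ≠ q := by
  intro e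
  have h1 := h.q0
  rw [← e, h.p0] at h1
  have := h.s_pos
  have := h.κ_pos
  have : 0 < 2 * s ^ 2 * κ := by positivity
  linarith

/-- This makes the kernel vector an equation of the belt line, the property on which sign coherence
rests. -/
theorem eval_kernelVec (h : InitialData s κ d o p q S) :
    (kernelVec S 0 1 2).eval p = 0 ∧ (kernelVec S 0 1 2).eval q = 0 := by
  simp only [kernelVec, eval_add, eval_smul, S.B_skew 0 2, h.B01, h.B02, h.B12, h.p0, h.p1, h.p2,
    h.q0, h.q1, h.q2]
  constructor <;> ring

theorem fst_kernelVec_ne_zero (h : InitialData s κ d o p q S) : (kernelVec S 0 1 2).1 ≠ 0 := by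
  intro h0
  have h1 : form (kernelVec S 0 1 2) (S.v 0) = 0 := by rw [form, h0, inner_zero_left]
  have c01 := form_comm (S.v 1) (S.v 0)
  have c02 := form_comm (S.v 2) (S.v 0)
  rw [h.form01] at c01
  rw [h.form02] at c02
  have e0 := S.realisation.form_self 0
  simp only [form, kernelVec, Prod.fst_add, Prod.smul_fst, inner_add_left, real_inner_smul_left]
    at *
  rw [c01, c02, e0, S.B_skew 0 2, h.B12, h.B01, h.B02] at h1
  nlinarith [h.s_pos, h.s_le]

theorem isPositive (h : InitialData s κ d o p q S) : IsPositive p q (S.v 0) ∧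
    IsPositive p q (S.v 1) ∧ ¬ IsPositive p q (S.v 2) := by
  have hs := h.s_pos
  have hs2 := h.s_le
  have hκ := h.κ_pos
  refine ⟨isPositive_of_slope_neg ?_, isPositive_of_le ?_ ?_, fun hp =>
    hp.not_neg (isPositive_of_slope_neg ?_)⟩
  · rw [h.q0, h.p0]
    have : 0 < 2 * s ^ 2 * κ := by positivity
    linarith
  -- In the equilateral case s = 1/2 the second line is parallel to the belt line, so the slope is
  -- only nonpositive and the negative value at p is needed.
  · rw [h.q1, h.p1]
    have h1 : 0 ≤ κ * s * (1 - 4 * s ^ 2) := by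
      apply mul_nonneg (by positivity)
      nlinarith
    nlinarith
  · rw [h.p1]
    have : 0 < κ * s := by positivity
    linarith
  · rw [eval_neg, eval_neg, h.q2, h.p2]
    have : 0 < κ * s := by positivity
    linarith

theorem coherent (h : InitialData s κ d o p q S) :
    Coherent p q (kernelVec S 0 1 2) S := by
  have h01 := h.B01_pos
  have h02 := h.B02_pos
  have h12 := h.B12_pos
  have h10 : S.B 1 0 < 0 := by rw [S.B_skew 0 1]; linarith
  have h20 : S.B 2 0 < 0 := by rw [S.B_skew 0 2]; linarith
  have h21 : S.B 2 1 < 0 := by rw [S.B_skew 1 2]; linarith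
  obtain ⟨P0, P1, P2⟩ := h.isPositive
  have f01 := h.form01
  have f02 := h.form02
  have f12 := h.form12
  rw [← h.B01] at f01
  rw [← h.B02] at f02
  rw [← h.B12] at f12
  refine ⟨?_, Or.inl rfl, ?_⟩
  · intro i j hij
    fin_cases i <;> fin_cases j <;> first
      | exact absurd rfl hij
      | exact h01.ne'
      | exact h02.ne'
      | exact h12.ne'
      | exact h10.ne
      | exact h20.ne
      | exact h21.ne
  · have key : ∀ i j, 0 < S.B i j → (IsPositive p q (S.v j) → IsPositive p q (S.v i)) →
        form (S.v i) (S.v j) = -S.B i j →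
        form (S.v i) (S.v j) =
          signedWeight (S.B i j) (IsPositive p q (S.v i)) (IsPositive p q (S.v j)) ∧
        form (S.v j) (S.v i) =
          signedWeight (S.B j i) (IsPositive p q (S.v j)) (IsPositive p q (S.v i)) := by
      intro i j hij hP hf
      rw [form_comm (S.v j), S.B_skew i j, signedWeight_neg, and_self, hf, signedWeight, if_neg,
        abs_of_pos hij]
      rintro (⟨-, h1, h2⟩ | ⟨h1, -⟩)
      · exact h1 (hP h2)
      · linarith
    obtain ⟨a1, a2⟩ := key 0 1 h01 (fun _ => P0) f01
    obtain ⟨b1, b2⟩ := key 0 2 h02 (fun _ => P0) f02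
    obtain ⟨c1, c2⟩ := key 1 2 h12 (fun _ => P1) f12
    intro i j hij
    fin_cases i <;> fin_cases j <;> first
      | exact absurd rfl hij
      | assumption

/-- The combination 2s v₀ + v₁ + v₂ is the constant -2sκ. Replacing v₂ by it reduces the determinant
to the Gram determinant of v₀ and v₁. -/
theorem vol_sq (h : InitialData s κ d o p q S) :
    vol (S.v 0) (S.v 1) (S.v 2) ^ 2 = 32 * (s * (1 - s ^ 2) * d) ^ 2 := by
  have hsum : (2 * s) • S.v 0 + S.v 1 + S.v 2 = (0, -(2 * s * κ)) := by
    have h1 : ((2 * s) • S.v 0 + S.v 1 + S.v 2).1 = 0 := h.linear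
    refine Prod.ext h1 ?_
    have h2 : ((2 * s) • S.v 0 + S.v 1 + S.v 2).eval o = -(2 * s * κ) := by
      rw [eval_add, eval_add, eval_smul, h.o0, h.o1, h.o2]; ring
    rw [AffFun.eval, h1, inner_zero_left, zero_add] at h2
    exact h2
  have hv2 : S.v 2 = (0, -(2 * s * κ)) - (2 * s) • S.v 0 - S.v 1 := by rw [← hsum]; abel
  have hgram : vol (S.v 0) (S.v 1) (S.v 2) ^ 2 = (2 * s * κ) ^ 2 *
      (form (S.v 0) (S.v 0) * form (S.v 1) (S.v 1) - form (S.v 0) (S.v 1) ^ 2) := by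
    rw [hv2]
    simp only [vol, form, plane_inner_eq, Prod.fst_sub, Prod.snd_sub, Prod.smul_fst,
      Prod.smul_snd, PiLp.sub_apply, PiLp.zero_apply, PiLp.smul_apply, smul_eq_mul]
    ring
  rw [hgram, S.realisation.form_self, S.realisation.form_self, h.form01]
  linear_combination (2 * s) ^ 2 * (4 - 4 * s ^ 2) * h.κ_sq

/-- The length of a vector along the belt line. -/
theorem norm_sq_eq (h : InitialData s κ d o p q S) {w : Plane}
    (hw : inner ℝ (kernelVec S 0 1 2).1 w = (0 : ℝ)) {x : ℝ}
    (hx : inner ℝ (S.v 0).1 w = x * κ) : ‖w‖ ^ 2 * (2 * s) ^ 2 = (x * d) ^ 2 := by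
  have hs := h.s_pos
  have h1 : (2 * s) * inner ℝ (S.v 0).1 w + inner ℝ (S.v 1).1 w + inner ℝ (S.v 2).1 w = 0 := by
    rw [← real_inner_smul_left, ← inner_add_left, ← inner_add_left, h.linear, inner_zero_left]
  simp only [kernelVec, Prod.fst_add, Prod.smul_fst, inner_add_left, real_inner_smul_left,
    S.B_skew 0 2, h.B01, h.B02, h.B12] at hw
  have h2 : 2 * s * inner ℝ (S.v 1).1 w = (1 - 4 * s ^ 2) * inner ℝ (S.v 0).1 w := by
    linear_combination -(1 / 2) * hw + s * h1
  have h3 := norm_sq_mul_gram (S.v 0).1 (S.v 1).1 w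
  have e0 : inner ℝ (S.v 0).1 (S.v 0).1 = (2 : ℝ) := S.realisation.form_self 0
  have e1 : inner ℝ (S.v 1).1 (S.v 1).1 = (2 : ℝ) := S.realisation.form_self 1
  have e2 : inner ℝ (S.v 0).1 (S.v 1).1 = -(2 * s) := h.form01
  rw [e0, e1, e2, hx] at h3
  rw [hx] at h2
  have hs1 : 1 - s ^ 2 ≠ 0 := by nlinarith [h.s_le]
  refine mul_left_cancel₀ (mul_ne_zero two_ne_zero hs1) ?_
  have h4 : ‖w‖ ^ 2 * (2 * s) ^ 2 * (4 - 4 * s ^ 2) = 2 * (x * κ) ^ 2 := by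
    linear_combination (2 * s) ^ 2 * h3 +
      (2 * (2 * s * inner ℝ (S.v 1).1 w) + 2 * (1 - 4 * s ^ 2) * (x * κ) +
        8 * s ^ 2 * (x * κ)) * h2
  linear_combination (1 / 2) * h4 + x ^ 2 * h.κ_sq

end InitialData

end InitialTriangle

/-! ### Invariants on the exchange graph and the two inclusions -/

section Reached

variable {n : ℕ} {s κ d : ℝ} {o p q : Plane} {S₀ : Seed}

/-- The properties which are shared by all vertices of the exchange graph of `S₀`. -/
structure Invariants (n : ℕ) (p q : Plane) (S₀ S : Seed) : Prop where
  coherent : Coherent p q (kernelVec S₀ 0 1 2) S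
  hasClass : ∃ i j k a b, HasClass n S i j k a b
  span_eq : Submodule.span (cosRing n) (Set.range S.v) =
    Submodule.span (cosRing n) (Set.range S₀.v)
  vol_sq_eq : vol (S.v 0) (S.v 1) (S.v 2) ^ 2 = vol (S₀.v 0) (S₀.v 1) (S₀.v 2) ^ 2

theorem InitialData.hasClass (h : InitialData s κ d o p q S₀)
    (hs : s = Real.cos (n * alpha n)) : HasClass n S₀ 1 0 2 n n := by
  have hw : |weight n n| = 2 * s := by
    rw [weight_eq, abs_mul, abs_neg_one_pow, one_mul, ← hs, abs_of_pos (by linarith [h.s_pos])]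
  have hw1 : weight n (n + n) = -S₀.B 1 2 := by
    have e : weight n (n + n) = weight n (1 : ℕ) := by
      rw [← weight_neg, ← weight_add_mul n _ 1]; congr 1; push_cast; ring
    rw [e, weight_eq, h.B12, hs, ← cos_alpha_eq]; simp
  have h12 := h.B12_pos
  refine ⟨by decide, by decide, by decide, ?_, ?_, ?_, ?_⟩
  · rw [hw, S₀.B_skew 0 1, abs_neg, abs_of_pos h.B01_pos, h.B01]
  · rw [hw, abs_of_pos h.B02_pos, h.B02]
  · rw [hw1, abs_neg, S₀.B_skew 1 2, abs_neg]
  · rw [isAcyclic_iff S₀.skew, hw1, S₀.B_skew 0 2]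
    have h01 := h.B01_pos
    have h02 := h.B02_pos
    have hne := weight_ne_zero n n
    have : 0 < weight n n * weight n n := mul_self_pos.2 hne
    refine ⟨fun _ => by nlinarith, fun _ => ?_⟩
    rintro (⟨-, -, h3⟩ | ⟨h3, -, -⟩) <;> linarith

theorem Invariants.of_inExchangeGraph (h : InitialData s κ d o p q S₀)
    (hs : s = Real.cos (n * alpha n)) {S : Seed} (hS : InExchangeGraph (IsPositive p q) S₀ S) :
    Invariants n p q S₀ S := by
  induction hS with
  | refl => exact ⟨h.coherent, ⟨_, _, _, _, _, h.hasClass hs⟩, rfl, rfl⟩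
  | tail _ hstep ih =>
    obtain ⟨k, rfl⟩ := hstep
    rename_i S _
    obtain ⟨i', j', l', a', b', hcl⟩ := ih.hasClass
    obtain ⟨i, j, l, a, b, hcl'⟩ := hcl.exists_mutate (Pos := IsPositive p q) k
    refine ⟨ih.coherent.mutate h.ne h.eval_kernelVec.1 h.eval_kernelVec.2 k ?_,
      ⟨i, j, l, a, b, hcl'⟩, ?_, ?_⟩
    · intro i j hij
      obtain ⟨c, hc⟩ := hcl'.B_mem_or hij
      rw [← abs_pos, hc, abs_pos]
      exact weight_ne_zero n c
    · rw [span_mutate, ih.span_eq]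
      intro i hi
      obtain ⟨c, hc⟩ := hcl.B_mem_or hi
      rw [← S.realisation.abs_form i k hi] at hc
      rcases abs_eq_abs.1 hc with e | e <;> rw [e]
      · exact weight_mem n c
      · exact Subalgebra.neg_mem _ (weight_mem n c)
    · rw [vol_mutate, neg_sq, ih.vol_sq_eq]

theorem AffFun.translate_eq (w : Plane) (f : AffFun) :
    f.translate w = f - (0, inner ℝ f.1 w) := by
  simp [AffFun.translate, Prod.ext_iff]

/-- A translation between two vertices of the exchange graph is parallel to the belt line. -/
theorem inner_kernelVec_eq_zero (h : InitialData s κ d o p q S₀) {S T : Seed} {w : Plane}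
    (hS : Coherent p q (kernelVec S₀ 0 1 2) S) (hT : Coherent p q (kernelVec S₀ 0 1 2) T)
    (hw : IsTranslate w S T) : inner ℝ (kernelVec S₀ 0 1 2).1 w = (0 : ℝ) := by
  obtain ⟨σ, hσ, hB⟩ := hw
  have h1 : kernelVec T (σ 0) (σ 1) (σ 2) = (kernelVec S 0 1 2).translate w := by
    refine Prod.ext ?_ ?_
    · simp [kernelVec, hσ, hB, AffFun.translate]
    · simp only [kernelVec, hσ, hB, AffFun.translate, Prod.snd_add, Prod.smul_snd, Prod.fst_add,
        Prod.smul_fst, inner_add_left, real_inner_smul_left, smul_eq_mul]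
      ring
  have h2 : kernelVec T (σ 0) (σ 1) (σ 2) = kernelVec S₀ 0 1 2 ∨
      kernelVec T (σ 0) (σ 1) (σ 2) = -kernelVec S₀ 0 1 2 := by
    have ne : ∀ {i j : Fin 3}, i ≠ j → σ i ≠ σ j := fun hij => σ.injective.ne hij
    rcases kernelVec_eq_or T (ne (show (0 : Fin 3) ≠ 1 by decide))
      (ne (show (0 : Fin 3) ≠ 2 by decide)) (ne (show (1 : Fin 3) ≠ 2 by decide)) with e | e <;>
      rcases hT.kernel with e' | e' <;> rw [e, e'] <;> simp
  have h3 := hS.kernel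
  have hne := h.fst_kernelVec_ne_zero
  rw [h1, AffFun.translate_eq] at h2
  generalize kernelVec S₀ 0 1 2 = z at *
  have flip : ∀ v : Plane, v = -v → v = 0 := fun v hv => by
    have : (2 : ℝ) • v = 0 := by rw [two_smul]; nth_rewrite 1 [hv]; abel
    exact (smul_eq_zero.1 this).resolve_left two_ne_zero
  -- A translation changes only the constant term. A sign change of z would therefore kill its
  -- linear part, and otherwise the shift ⟨z, w⟩ of the constant term is zero.
  rcases h3 with e | e <;> rw [e] at h2 <;> rcases h2 with e' | e'
  · have := congrArg Prod.snd e'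
    simp only [Prod.snd_sub] at this
    linarith
  · have := congrArg Prod.fst e'
    simp only [Prod.fst_sub, sub_zero, Prod.fst_neg] at this
    exact absurd (flip _ this) hne
  · have := congrArg Prod.fst e'
    simp only [Prod.fst_sub, sub_zero, Prod.fst_neg] at this
    exact absurd (flip _ this.symm) hne
  · have := congrArg Prod.snd e'
    simp only [Prod.snd_sub, Prod.fst_neg, Prod.snd_neg, inner_neg_left] at this
    linarith

/-- A vector of either seed and its translate lie in the same invariant span M, so M contains the
constants ⟨f, w⟩ for all f in M. Expanding ⟨v₀, w⟩ in the initial vectors and evaluating at the apex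
o leaves only the v₀ term, which is -κ times an element of the ring. -/
theorem exists_inner_eq_mul (h : InitialData s κ d o p q S₀) {S T : Seed} {w : Plane}
    (hS : Invariants n p q S₀ S) (hT : Invariants n p q S₀ T) (hw : IsTranslate w S T) :
    ∃ x ∈ cosRing n, inner ℝ (S₀.v 0).1 w = x * κ := by
  obtain ⟨σ, hσ, -⟩ := hw
  set M := Submodule.span (cosRing n) (Set.range S₀.v) with hM
  have hmem : ∀ f ∈ M, ((0, inner ℝ f.1 w) : AffFun) ∈ M := by
    intro f hf
    rw [hM, ← hS.span_eq] at hf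
    induction hf using Submodule.span_induction with
    | mem f hf =>
      obtain ⟨i, rfl⟩ := hf
      have e : ((0, inner ℝ (S.v i).1 w) : AffFun) = S.v i - T.v (σ i) := by
        rw [hσ, AffFun.translate_eq]; abel
      rw [e]
      refine Submodule.sub_mem _ ?_ ?_
      · rw [hM, ← hS.span_eq]; exact Submodule.subset_span ⟨i, rfl⟩
      · rw [hM, ← hT.span_eq]; exact Submodule.subset_span ⟨σ i, rfl⟩
    | zero =>
      convert M.zero_mem using 1
      simp
    | add f g _ _ hf hg =>
      convert M.add_mem hf hg using 1
      simp [inner_add_left]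
    | smul c f _ hf =>
      convert M.smul_mem c hf using 1
      have : inner ℝ (c • f).1 w = (c : ℝ) * inner ℝ f.1 w := real_inner_smul_left _ _ _
      rw [this]
      refine Prod.ext ?_ rfl
      simp
  have h0 := hmem _ (Submodule.subset_span ⟨0, rfl⟩)
  obtain ⟨x, hx⟩ := (Submodule.mem_span_range_iff_exists_fun _).1 h0
  have h1 := congrArg (fun f : AffFun => f.eval o) hx
  have hsmul : ∀ i, AffFun.eval (x i • S₀.v i) o = (x i : ℝ) * (S₀.v i).eval o :=
    fun i => eval_smul (x i : ℝ) _ _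
  simp only [Fin.sum_univ_three, eval_add, hsmul, h.o0, h.o1, h.o2] at h1
  have h2 : AffFun.eval ((0, inner ℝ (S₀.v 0).1 w) : AffFun) o = inner ℝ (S₀.v 0).1 w := by
    simp [AffFun.eval]
  rw [h2] at h1
  exact ⟨-(x 0 : ℝ), Subalgebra.neg_mem _ (x 0).2, by rw [← h1]; ring⟩

theorem latticeL_le_cosLattice (h : InitialData s κ d o p q S₀)
    (hs : s = Real.cos (n * alpha n)) (hn : 1 ≤ n) :
    latticeL (IsPositive p q) S₀ ≤ cosLattice n d := by
  refine Submodule.span_le.2 ?_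
  rintro _ ⟨w, S₁, S₂, h1, h2, hw, rfl⟩
  have i1 := Invariants.of_inExchangeGraph h hs h1
  have i2 := Invariants.of_inExchangeGraph h hs h2
  obtain ⟨x, hx, ex⟩ := exists_inner_eq_mul h i2 i1 hw
  have hz := inner_kernelVec_eq_zero h i2.coherent i1.coherent hw
  have hnorm := h.norm_sq_eq hz ex
  obtain ⟨y, hy, ey⟩ := exists_sin_mul_eq (two_cos_alpha_mem n) n
  -- Since sin α = 2 sin(nα) cos(nα), the quotient y = sin(nα)/sin α is the inverse of 2 cos(nα),
  -- which is therefore a unit; no denominator arises.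
  have hys : y * (2 * s) = 1 := by
    rw [sin_alpha_eq, ← hs] at ey
    have := sin_pos_of_lt (n := n) (k := n) hn (by omega)
    have h3 : (y * (2 * s)) * Real.sin (n * alpha n) = 1 * Real.sin (n * alpha n) := by
      linear_combination -ey
    exact mul_right_cancel₀ this.ne' h3
  have hsq : ‖w‖ ^ 2 = (d * (x * y)) ^ 2 := by
    linear_combination y ^ 2 * hnorm - ‖w‖ ^ 2 * (y * (2 * s) + 1) * hys
  have hxy := Subalgebra.mul_mem _ hx hy
  rcases sq_eq_sq_iff_eq_or_eq_neg.1 hsq with e | e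
  · exact ⟨x * y, hxy, e.symm⟩
  · exact ⟨-(x * y), Subalgebra.neg_mem _ hxy, by rw [e]; simp⟩

/-- The exchange graph contains a cyclic seed with weights `2`, `2 cos kα`, `2 cos kα`. -/
theorem exists_parallel_seed (h : InitialData s κ d o p q S₀) (hs : s = Real.cos (n * alpha n))
    {k : ℕ} (hk : Nat.gcd k (2 * n + 1) = 1) :
    ∃ S, ∃ i j l : Fin 3, InExchangeGraph (IsPositive p q) S₀ S ∧ i ≠ j ∧ i ≠ l ∧ j ≠ l ∧
      S.B i j = 2 ∧ S.B j l = |weight n k| ∧ S.B l i = |weight n k| := by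
  have h1 : Reachable n (IsPositive p q) S₀ n n :=
    ⟨S₀, 1, 0, 2, Relation.ReflTransGen.refl, h.hasClass hs⟩
  have h2 : Reachable n (IsPositive p q) S₀ n 0 := by simpa using h1.sub_right
  have hn : Nat.gcd n (2 * n + 1) = 1 := by simp
  obtain ⟨S, i, j, l, hS, hc⟩ := h2.of_coprime hn hk
  have hw := weight_ne_zero n k
  have hw' : 0 < |weight n k| := abs_pos.2 hw
  -- The weights w(k), 2, w(k) have positive product, so the quiver is cyclic; up to orientation and
  -- relabelling this is the required triangle.
  have hcyc : Cyc (S.B i j) (S.B j l) (S.B l i) := by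
    have := hc.acyclic
    rw [isAcyclic_iff_of_ne S hc.hij hc.hik hc.hjk, add_zero, weight_zero] at this
    by_contra hcon
    have h3 := this.1 hcon
    nlinarith [mul_self_pos.2 hw]
  have e1 := hc.abs_left
  have e2 := hc.abs_right
  have e3 := hc.abs_sum
  rw [add_zero] at e3
  rw [weight_zero, abs_of_pos (two_pos (α := ℝ))] at e2
  rcases hcyc with ⟨c1, c2, c3⟩ | ⟨c1, c2, c3⟩
  · rw [abs_of_pos c1] at e1
    rw [abs_of_pos c2] at e2
    rw [abs_of_pos c3] at e3
    exact ⟨S, j, l, i, hS, hc.hjk, hc.hij.symm, hc.hik.symm, e2, e3, e1⟩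
  · rw [abs_of_neg c1] at e1
    rw [abs_of_neg c2] at e2
    rw [abs_of_neg c3] at e3
    refine ⟨S, l, j, i, hS, hc.hjk.symm, hc.hik.symm, hc.hij.symm, ?_, ?_, ?_⟩
    · rw [S.B_skew j l, e2]
    · rw [S.B_skew i j, e1]
    · rw [S.B_skew l i, e3]

theorem latticeR_le_latticeL (h : InitialData s κ d o p q S₀)
    (hs : s = Real.cos (n * alpha n)) : latticeR n d ≤ latticeL (IsPositive p q) S₀ := by
  refine Submodule.span_le.2 ?_
  rintro _ ⟨k, hk1, hkn, hk, rfl⟩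
  obtain ⟨S, i, j, l, hS, hij, hil, hjl, b1, b2, b3⟩ := exists_parallel_seed h hs hk
  have hinv := Invariants.of_inExchangeGraph h hs hS
  have hsin := sin_pos_of_lt hk1 (show k < 2 * n + 1 by omega)
  have hsn := sin_pos_of_lt (n := n) (k := n) (by omega) (by omega)
  have hx2 : |weight n k| ^ 2 = 4 - 4 * Real.sin (k * alpha n) ^ 2 := by
    rw [sq_abs, weight_eq, mul_pow, ← pow_mul, pow_mul', neg_one_sq, one_pow]
    linear_combination 4 * Real.sin_sq_add_cos_sq (k * alpha n)
  obtain ⟨w, hw, hnorm⟩ := hinv.coherent.exists_isTranslate h.ne h.eval_kernelVec.1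
    h.eval_kernelVec.2 hij hil hjl (abs_pos.2 (weight_ne_zero n k)) (by
      rw [hx2]; have : 0 < Real.sin (k * alpha n) ^ 2 := by positivity
      linarith) b1 b2 b3
  refine Submodule.subset_span ⟨w, _, S, hS.mutate i, hS, hw, ?_⟩
  rw [hx2, hinv.vol_sq_eq, h.vol_sq] at hnorm
  -- With 4 - x² = 4 sin²(kα), the length formula reads ‖w‖ sin²(kα) = 2 s (1 - s²) d, and the right
  -- side is the numerator of the generator of R.
  have h1 : s * (1 - s ^ 2) * d * 2 =
      d * (Real.sin (alpha n) * Real.sin (n * alpha n)) := by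
    rw [sin_alpha_eq, ← hs]
    have : Real.sin (n * alpha n) ^ 2 = 1 - s ^ 2 := by rw [hs, Real.sin_sq]
    linear_combination -(2 * s * d) * this
  have hd := h.d_pos
  have hsa : 0 < Real.sin (alpha n) := by
    simpa using sin_pos_of_lt (n := n) (k := 1) le_rfl (by omega)
  have h2 : (‖w‖ * Real.sin (k * alpha n) ^ 2) ^ 2 =
      (d * (Real.sin (alpha n) * Real.sin (n * alpha n))) ^ 2 := by
    rw [← h1]
    linear_combination (1 / 16) * hnorm
  have h3 := (sq_eq_sq₀ (by positivity) (by positivity)).1 h2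
  rw [← mul_div_assoc, ← h3]
  field_simp

end Reached

end RealQuiver

end

theorem proposition5p2 (n : ℕ) (hn : 1 ≤ n) (t : Affine.Triangle ℝ RealQuiver.Plane)
    (ht : RealQuiver.IsInitialTriangle n t) (S₀ : RealQuiver.Seed)
    (hS₀ : RealQuiver.IsInitialSeed t S₀) (d₁ : ℝ) (hd₁ : d₁ = RealQuiver.legLength t)
    (R L Z : Submodule ℤ ℝ) (hR : R = RealQuiver.latticeR n d₁)
    (hL : L = RealQuiver.latticeL (RealQuiver.BeltPositive t) S₀)
    (hZ : Z = RealQuiver.cosLattice n d₁) :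
    (∃ d : ℕ, 0 < d ∧
      R ≤ L ∧ R ≤ Z ∧
      L ≤ RealQuiver.cosLattice n ((1 / (d : ℝ)) * d₁) ∧
      Z ≤ RealQuiver.cosLattice n ((1 / (d : ℝ)) * d₁) ∧
      Module.finrank ℤ (RealQuiver.cosLattice n ((1 / (d : ℝ)) * d₁)) =
        Nat.totient (2 * n + 1) / 2) ∧
    Module.finrank ℤ R = Nat.totient (2 * n + 1) / 2 ∧
    Module.finrank ℤ L = Nat.totient (2 * n + 1) / 2 ∧
    Module.finrank ℤ Z = Nat.totient (2 * n + 1) / 2 := by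
  subst hR hL hZ hd₁
  have h := hS₀.initialData hn ht
  have hd := h.d_pos.ne'
  have hRZ := RealQuiver.latticeR_le_cosLattice n hn (RealQuiver.legLength t)
  have hRL := RealQuiver.latticeR_le_latticeL h rfl
  have hLZ := RealQuiver.latticeL_le_cosLattice h rfl hn
  have rank := @RealQuiver.finrank_of_latticeR_le n hn _ hd
  -- No denominator is needed: L already lies in ℤ[2 cos α] d₁.
  refine ⟨⟨1, one_pos, ?_⟩, rank le_rfl hRZ, rank hRL hLZ, rank hRZ le_rfl⟩
  rw [Nat.cast_one, div_one, one_mul]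
  exact ⟨hRL, hRZ, hLZ, le_rfl, rank hRZ le_rfl⟩
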